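/- Let $n\ge 3$ and let $\Omega\subset\mathbb R^n$ be a bounded domain with $C^1$ boundary such that $\mathbb R^n\setminus\overline\Omega$ is connected. Let $T>0$, $\Omega_T=\Omega\times(0,T)$, $\Sigma_1=\Omega\times\{T\}$, $\Sigma_2=\Omega\times\{0\}$, $\Sigma_3=\partial\Omega\times(0,T)$, $\Sigma=\partial\Omega_T$, and let $\sigma$ denote surface measure. Let $\mathsf a=(a_{hk})$ be a real symmetric positive definite $n\times n$ matrix, $Ev=\sum_{h,k}a_{hk}\,\partial^2v/\partial x_h\partial x_k$, $H=E-\partial_t$, $H^*=E+\partial_t$. Let $\nu$ be the interior unit normal of $\partial\Omega$ and let $\partial/\partial\overline\nu$ be the derivative in the direction of the conormal vector $(\mathsf a\nu,0)$. Let $G(x,t)=(4\pi t)^{-n/2}(\det\mathsf a)^{-1/2}\exp\bigl(-\langle\mathsf a^{-1}x,x\rangle/(4t)\bigr)$ for $t>0$ and $G(x,t)=0$ for $t\le0$. Let $1\le p<\infty$; functions on $\Omega_T$ that agree almost everywhere are identified. A function $u\in L^p(\Omega_T)$ belongs to $\mathscr A^p(\Omega_T)$ if there are $A\in L^p(\Sigma)$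 and $B\in L^p(\Sigma_3)$ such that, for all $v\in C^\infty(\mathbb R^{n+1})$, $$\int_{\Omega_T}u\,H^*v\,dx\,dt=\int_{\Sigma_3}\Bigl(Bv-A\frac{\partial v}{\partial\overline\nu}\Bigr)d\sigma+\int_{\Sigma_1}Av\,d\sigma-\int_{\Sigma_2}Av\,d\sigma ,$$ and to $\mathscr A^p_*(\Omega_T)$ if there are $A\in L^p(\Sigma)$ and $B\in L^p(\Sigma_3)$ such that, for all $v\in C^\infty(\mathbb R^{n+1})$, $$\int_{\Omega_T}u\,Hv\,dx\,dt=\int_{\Sigma_3}\Bigl(Bv-A\frac{\partial v}{\partial\overline\nu}\Bigr)d\sigma-\int_{\Sigma_1}Av\,d\sigma+\int_{\Sigma_2}Av\,d\sigma .$$ A function $u$ on $\Omega_T$ belongs to $\mathscr B^p(\Omega_T)$ if there are $A\in L^p(\Sigma)$ and $B\in L^p(\Sigma_3)$ such that, after modification of $u$ on a null set, $$\int_{\Sigma_3}\Bigl(A(y,s)\frac{\partial}{\partial\overline\nu_{y,s}}G(x-y,t-s)-B(y,s)\,G(x-y,t-s)\Bigr)d\sigma_{y,s}-\int_{\Sigma_1}A(y,T)\,G(x-y,t-T)\,dy+\int_{\Sigma_2}A(y,0)\,G(x-y,t)\,dy$$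 equals $u(x,t)$ for every $(x,t)\in\Omega_T$ and $0$ for every $(x,t)\notin\overline{\Omega}_T$. It belongs to $\mathscr B^p_*(\Omega_T)$ if there are $A\in L^p(\Sigma)$ and $B\in L^p(\Sigma_3)$ such that, after modification of $u$ on a null set, $$\int_{\Sigma_3}\Bigl(A(x,t)\frac{\partial}{\partial\overline\nu_{x,t}}G(x-y,t-s)-B(x,t)\,G(x-y,t-s)\Bigr)d\sigma_{x,t}+\int_{\Sigma_1}A(x,T)\,G(x-y,T-s)\,dx-\int_{\Sigma_2}A(x,0)\,G(x-y,-s)\,dx$$ equals $u(y,s)$ for every $(y,s)\in\Omega_T$ and $0$ for every $(y,s)\notin\overline{\Omega}_T$. Then $\mathscr A^p(\Omega_T)=\mathscr B^p(\Omega_T)$ and $\mathscr A^p_*(\Omega_T)=\mathscr B^p_*(\Omega_T)$. -/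

import Mathlib

open MeasureTheory Set
open scoped ContDiff ENNReal Matrix

noncomputable section

namespace Parabolic

/-- The space `ℝⁿ` with its Euclidean inner product. Points of `ℝⁿ⁺¹` are pairs `(x, t)` in
`Space n × ℝ`. -/
abbrev Space (n : ℕ) := EuclideanSpace ℝ (Fin n)

/-! ### Domains with `C¹` boundary, normal and conormal vectors -/

/-- `φ` is a `C¹` defining function of `Ω` in the open set `U`: it is `C¹` with nowhere vanishing
gradient in `U`, and `Ω` is the set where `φ` is positive, inside `U`. -/
structure IsC1DefiningFunction {n : ℕ} (Ω U : Set (Space n)) (φ : Space n → ℝ) : Prop where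
  isOpen : IsOpen U
  contDiffOn : ContDiffOn ℝ 1 φ U
  gradient_ne_zero : ∀ x ∈ U, gradient φ x ≠ 0
  mem_iff : ∀ x ∈ U, x ∈ Ω ↔ 0 < φ x

/-- The boundary of `Ω` is of class `C¹`: near each of its boundary points, `Ω` has a
`C¹` defining function. -/
def HasC1Boundary {n : ℕ} (Ω : Set (Space n)) : Prop :=
  ∀ x ∈ frontier Ω, ∃ U φ, x ∈ U ∧ IsC1DefiningFunction Ω U φ

/-- `ν` is an interior unit normal vector of `Ω` at `x`: it is the normalized gradient at `x` of
a `C¹` defining function of `Ω` near `x`. -/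
def IsInnerUnitNormal {n : ℕ} (Ω : Set (Space n)) (x ν : Space n) : Prop :=
  ∃ U φ, x ∈ U ∧ IsC1DefiningFunction Ω U φ ∧ ν = ‖gradient φ x‖⁻¹ • gradient φ x

/-- A `C¹` defining function vanishes at the boundary points. -/
theorem IsC1DefiningFunction.eq_zero {n : ℕ} {Ω U : Set (Space n)} {φ : Space n → ℝ}
    (h : IsC1DefiningFunction Ω U φ) {x : Space n} (hx : x ∈ frontier Ω) (hxU : x ∈ U) :
    φ x = 0 := by
  have hU := h.isOpen.mem_nhds hxU
  have hc : ContinuousAt φ x := (h.contDiffOn.continuousOn).continuousAt hU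
  rcases lt_trichotomy (φ x) 0 with hlt | heq | hgt
  · exfalso
    have h1 : ∀ᶠ y in nhds x, y ∉ Ω := by
      filter_upwards [hU, hc.eventually_lt continuousAt_const hlt] with y hy hy' hyΩ
      exact absurd ((h.mem_iff y hy).1 hyΩ) (not_lt.2 (le_of_lt hy'))
    exact (mem_closure_iff_frequently.1 hx.1) h1
  · exact heq
  · exfalso
    apply hx.2
    rw [mem_interior_iff_mem_nhds]
    filter_upwards [hU, continuousAt_const.eventually_lt hc hgt] with y hy hy'
    exact (h.mem_iff y hy).2 hy'

theorem IsC1DefiningFunction.eventually_sign {n : ℕ} {Ω U : Set (Space n)} {φ : Space n → ℝ}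
    (h : IsC1DefiningFunction Ω U φ) {x : Space n} (hx : x ∈ frontier Ω) (hxU : x ∈ U)
    (w : Space n) :
    (0 < inner ℝ (gradient φ x) w → ∀ᶠ ε : ℝ in nhdsWithin 0 (Ioi 0), x + ε • w ∈ Ω) ∧
    (inner ℝ (gradient φ x) w < 0 → ∀ᶠ ε : ℝ in nhdsWithin 0 (Ioi 0), x + ε • w ∉ Ω) := by
  have h0 := h.eq_zero hx hxU
  have hU := h.isOpen.mem_nhds hxU
  have hd : DifferentiableAt ℝ φ x :=
    (h.contDiffOn.contDiffAt hU).differentiableAt (by norm_num)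
  have hl : HasDerivAt (fun ε : ℝ => x + ε • w) w 0 := by
    simpa using ((hasDerivAt_id (0 : ℝ)).smul_const w).const_add x
  have hg : HasDerivAt (fun ε : ℝ => φ (x + ε • w)) (inner ℝ (gradient φ x) w) 0 := by
    have h2 : HasFDerivAt φ (fderiv ℝ φ x) (x + (0 : ℝ) • w) := by
      simpa using hd.hasFDerivAt
    have h3 := h2.comp_hasDerivAt (0 : ℝ) hl
    have h4 : inner ℝ (gradient φ x) w = fderiv ℝ φ x w := by
      simp [gradient]
    rw [h4]
    exact h3
  have hs := hasDerivWithinAt_iff_tendsto_slope' (s := Ioi (0 : ℝ)) (by simp)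
    |>.1 (hg.hasDerivWithinAt (s := Ioi 0))
  have hU' : ∀ᶠ ε : ℝ in nhdsWithin 0 (Ioi 0), x + ε • w ∈ U := by
    have h5 : Filter.Tendsto (fun ε : ℝ => x + ε • w) (nhdsWithin 0 (Ioi 0)) (nhds x) := by
      have := hl.continuousAt.tendsto.mono_left (nhdsWithin_le_nhds (s := Ioi (0 : ℝ)))
      simpa using this
    exact h5 hU
  refine ⟨fun hw => ?_, fun hw => ?_⟩
  · filter_upwards [hU', hs.eventually (lt_mem_nhds hw), self_mem_nhdsWithin] with ε h1 h2 h3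
    rw [slope_def_field] at h2
    have h3' : (0 : ℝ) < ε - 0 := by simpa using h3
    have h6 := (div_pos_iff_of_pos_right h3').1 h2
    refine (h.mem_iff _ h1).2 ?_
    simpa [h0] using h6
  · filter_upwards [hU', hs.eventually (gt_mem_nhds hw), self_mem_nhdsWithin] with ε h1 h2 h3 h7
    rw [slope_def_field] at h2
    have h3' : (0 : ℝ) < ε - 0 := by simpa using h3
    have h6 := (div_lt_iff₀ h3').1 h2
    have h8 := (h.mem_iff _ h1).1 h7
    simp [h0] at h6
    linarith

/-- The interior unit normal vector at a boundary point is unique. -/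
theorem IsInnerUnitNormal.unique {n : ℕ} {Ω : Set (Space n)} {x ν μ : Space n}
    (hx : x ∈ frontier Ω) (hν : IsInnerUnitNormal Ω x ν) (hμ : IsInnerUnitNormal Ω x μ) :
    ν = μ := by
  obtain ⟨U, φ, hxU, hφ, rfl⟩ := hν
  obtain ⟨V, ψ, hxV, hψ, rfl⟩ := hμ
  have hg := norm_pos_iff.2 (hφ.gradient_ne_zero x hxU)
  have hk := norm_pos_iff.2 (hψ.gradient_ne_zero x hxV)
  set g := gradient φ x with hgdef
  set k := gradient ψ x with hkdef
  have hg1 : ‖‖g‖⁻¹ • g‖ = 1 := by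
    rw [norm_smul, norm_inv, norm_norm, inv_mul_cancel₀ hg.ne']
  have hk1 : ‖‖k‖⁻¹ • k‖ = 1 := by
    rw [norm_smul, norm_inv, norm_norm, inv_mul_cancel₀ hk.ne']
  by_contra hne
  have hlt := (inner_lt_one_iff_real_of_norm_eq_one hg1 hk1).2 hne
  set ν := ‖g‖⁻¹ • g with hνdef
  set μ := ‖k‖⁻¹ • k with hμdef
  have hgν : g = ‖g‖ • ν := by rw [hνdef, smul_smul, mul_inv_cancel₀ hg.ne', one_smul]
  have hkμ : k = ‖k‖ • μ := by rw [hμdef, smul_smul, mul_inv_cancel₀ hk.ne', one_smul]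
  have e1 : 0 < inner ℝ g (ν - μ) := by
    rw [hgν, real_inner_smul_left, inner_sub_right, real_inner_self_eq_norm_sq, hg1]
    exact mul_pos hg (by linarith)
  have e2 : inner ℝ k (ν - μ) < 0 := by
    rw [hkμ, real_inner_smul_left, inner_sub_right, real_inner_self_eq_norm_sq, hk1,
      real_inner_comm]
    exact mul_neg_of_pos_of_neg hk (by linarith)
  have f1 := (hφ.eventually_sign hx hxU (ν - μ)).1 e1
  have f2 := (hψ.eventually_sign hx hxV (ν - μ)).2 e2
  obtain ⟨ε, h1, h2⟩ := (f1.and f2).exists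
  exact h2 h1

open Classical in
/-- The interior unit normal vector of `Ω` at a boundary point `x`
(and `0` if there is none). See `innerNormal_eq` for its uniqueness. -/
def innerNormal {n : ℕ} (Ω : Set (Space n)) (x : Space n) : Space n :=
  if h : ∃ ν, IsInnerUnitNormal Ω x ν then h.choose else 0

/-- At the boundary points, `innerNormal` is the normalized gradient of any `C¹` defining
function. -/
theorem innerNormal_eq {n : ℕ} {Ω U : Set (Space n)} {φ : Space n → ℝ} {x : Space n}
    (hx : x ∈ frontier Ω) (hxU : x ∈ U) (h : IsC1DefiningFunction Ω U φ) :
    innerNormal Ω x = ‖gradient φ x‖⁻¹ • gradient φ x := by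
  have hex : ∃ ν, IsInnerUnitNormal Ω x ν := ⟨_, U, φ, hxU, h, rfl⟩
  rw [innerNormal, dif_pos hex]
  exact hex.choose_spec.unique hx ⟨U, φ, hxU, h, rfl⟩

/-- The conormal vector `A ν` (the spatial part of `(A ν, 0)`) at the boundary point `x` of `Ω`,
where `ν` is the interior unit normal. -/
def conormal {n : ℕ} (a : Matrix (Fin n) (Fin n) ℝ) (Ω : Set (Space n)) (x : Space n) : Space n :=
  Matrix.toEuclideanLin a (innerNormal Ω x)

/-! ### The cylinder and the surface measures -/

/-- The open cylinder `Ω_T = Ω × (0, T)`. -/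
def cylinder {n : ℕ} (Ω : Set (Space n)) (T : ℝ) : Set (Space n × ℝ) := Ω ×ˢ Ioo 0 T

/-- Surface measure on the lateral boundary `Σ₃ = ∂Ω × (0, T)`: the product of the
`(n-1)`-dimensional surface measure of `∂Ω` (the Hausdorff measure, normalized as Lebesgue measure
on `ℝⁿ⁻¹`) and of Lebesgue measure in time. -/
def lateralMeasure {n : ℕ} (Ω : Set (Space n)) (T : ℝ) : Measure (Space n × ℝ) :=
  (μHE[n - 1].restrict (frontier Ω)).prod (volume.restrict (Ioo 0 T))

/-- Surface measure on the horizontal section `Ω × {τ}`, that is, Lebesgue measure of `Ω`.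
The section is `Σ₁` for `τ = T` and `Σ₂` for `τ = 0`. -/
def sectionMeasure {n : ℕ} (Ω : Set (Space n)) (τ : ℝ) : Measure (Space n × ℝ) :=
  (volume.restrict Ω).map fun x => (x, τ)

/-- Surface measure on `Σ = ∂Ω_T`, which is the union of `Σ₁`, `Σ₂`, `Σ₃` and of the null set
`∂Ω × {0, T}`. -/
def boundaryMeasure {n : ℕ} (Ω : Set (Space n)) (T : ℝ) : Measure (Space n × ℝ) :=
  lateralMeasure Ω T + sectionMeasure Ω T + sectionMeasure Ω 0

/-! ### The operators -/

/-- The partial derivative `∂v/∂x_k`. -/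
def partialX {n : ℕ} (k : Fin n) (v : Space n × ℝ → ℝ) (z : Space n × ℝ) : ℝ :=
  fderiv ℝ (fun x => v (x, z.2)) z.1 (EuclideanSpace.single k 1)

/-- The partial derivative `∂v/∂t`. -/
def partialT {n : ℕ} (v : Space n × ℝ → ℝ) (z : Space n × ℝ) : ℝ :=
  deriv (fun t => v (z.1, t)) z.2

/-- `E v = ∑ a_hk ∂²v/∂x_h∂x_k`. -/
def ellipticOp {n : ℕ} (a : Matrix (Fin n) (Fin n) ℝ) (v : Space n × ℝ → ℝ) (z : Space n × ℝ) :
    ℝ :=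
  ∑ h, ∑ k, a h k * partialX h (partialX k v) z

/-- `H v = E v - ∂v/∂t`. -/
def opH {n : ℕ} (a : Matrix (Fin n) (Fin n) ℝ) (v : Space n × ℝ → ℝ) (z : Space n × ℝ) : ℝ :=
  ellipticOp a v z - partialT v z

/-- `H* v = E v + ∂v/∂t`. -/
def opHstar {n : ℕ} (a : Matrix (Fin n) (Fin n) ℝ) (v : Space n × ℝ → ℝ) (z : Space n × ℝ) : ℝ :=
  ellipticOp a v z + partialT v z

/-- The conormal derivative `∂v/∂ν̄` at a point `z` of the lateral boundary. -/
def conormalDeriv {n : ℕ} (a : Matrix (Fin n) (Fin n) ℝ) (Ω : Set (Space n))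
    (v : Space n × ℝ → ℝ) (z : Space n × ℝ) : ℝ :=
  fderiv ℝ (fun x => v (x, z.2)) z.1 (conormal a Ω z.1)

/-- The fundamental solution `G(x, t)`, equal to
`(4πt)^(-n/2) |A|^(-1/2) exp(-⟨A⁻¹x, x⟩ / (4t))` for `t > 0` and to `0` for `t ≤ 0`. -/
def fundSol {n : ℕ} (a : Matrix (Fin n) (Fin n) ℝ) (x : Space n) (t : ℝ) : ℝ :=
  if 0 < t then
    1 / ((4 * Real.pi * t) ^ ((n : ℝ) / 2) * Real.sqrt a.det) *
      Real.exp (-(inner ℝ (Matrix.toEuclideanLin a⁻¹ x) x) / (4 * t))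
  else 0

/-! ### The classes defined by the weak Green formula

All classes are sets of real functions on `ℝⁿ⁺¹` in which only the restriction to `Ω_T` matters,
up to almost everywhere equality, as is usual for `Lᵖ` functions. -/

/-- The class `𝒜ᵖ(Ω_T)`. -/
def classA {n : ℕ} (a : Matrix (Fin n) (Fin n) ℝ) (Ω : Set (Space n)) (T : ℝ) (p : ℝ≥0∞) :
    Set (Space n × ℝ → ℝ) :=
  {u | MemLp u p (volume.restrict (cylinder Ω T)) ∧
    ∃ A B : Space n × ℝ → ℝ,
      MemLp A p (boundaryMeasure Ω T) ∧ MemLp B p (lateralMeasure Ω T) ∧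
      ∀ v : Space n × ℝ → ℝ, ContDiff ℝ ∞ v →
        ∫ z in cylinder Ω T, u z * opHstar a v z =
          (∫ z, (B z * v z - A z * conormalDeriv a Ω v z) ∂(lateralMeasure Ω T))
            + (∫ z, A z * v z ∂(sectionMeasure Ω T)) - ∫ z, A z * v z ∂(sectionMeasure Ω 0)}

/-- The class `𝒜ᵖ_*(Ω_T)`. -/
def classAstar {n : ℕ} (a : Matrix (Fin n) (Fin n) ℝ) (Ω : Set (Space n)) (T : ℝ) (p : ℝ≥0∞) :
    Set (Space n × ℝ → ℝ) :=
  {u | MemLp u p (volume.restrict (cylinder Ω T)) ∧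
    ∃ A B : Space n × ℝ → ℝ,
      MemLp A p (boundaryMeasure Ω T) ∧ MemLp B p (lateralMeasure Ω T) ∧
      ∀ v : Space n × ℝ → ℝ, ContDiff ℝ ∞ v →
        ∫ z in cylinder Ω T, u z * opH a v z =
          (∫ z, (B z * v z - A z * conormalDeriv a Ω v z) ∂(lateralMeasure Ω T))
            - (∫ z, A z * v z ∂(sectionMeasure Ω T)) + ∫ z, A z * v z ∂(sectionMeasure Ω 0)}

/-! ### The classes defined by the Stokes representation formula -/

/-- The Stokes potential of the data `(A, B)` for the operator `H`, at the point `z = (x, t)`.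
The variable of integration is `q = (y, s)` on `Σ₃`, and `y` on `Σ₁` and `Σ₂`. -/
def stokesPotential {n : ℕ} (a : Matrix (Fin n) (Fin n) ℝ) (Ω : Set (Space n)) (T : ℝ)
    (A B : Space n × ℝ → ℝ) (z : Space n × ℝ) : ℝ :=
  (∫ q, (A q * conormalDeriv a Ω (fun r => fundSol a (z.1 - r.1) (z.2 - r.2)) q
      - B q * fundSol a (z.1 - q.1) (z.2 - q.2)) ∂(lateralMeasure Ω T))
    - (∫ y in Ω, A (y, T) * fundSol a (z.1 - y) (z.2 - T))
    + ∫ y in Ω, A (y, 0) * fundSol a (z.1 - y) z.2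

/-- The Stokes potential of the data `(A, B)` for the operator `H*`, at the point `z = (y, s)`.
The variable of integration is `q = (x, t)` on `Σ₃`, and `x` on `Σ₁` and `Σ₂`. -/
def stokesPotentialStar {n : ℕ} (a : Matrix (Fin n) (Fin n) ℝ) (Ω : Set (Space n)) (T : ℝ)
    (A B : Space n × ℝ → ℝ) (z : Space n × ℝ) : ℝ :=
  (∫ q, (A q * conormalDeriv a Ω (fun r => fundSol a (r.1 - z.1) (r.2 - z.2)) q
      - B q * fundSol a (q.1 - z.1) (q.2 - z.2)) ∂(lateralMeasure Ω T))
    + (∫ x in Ω, A (x, T) * fundSol a (x - z.1) (T - z.2))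
    - ∫ x in Ω, A (x, 0) * fundSol a (x - z.1) (-z.2)

/-- The class `ℬᵖ(Ω_T)`: the functions `u` which have a representative `w` (equal to `u` almost
everywhere in `Ω_T`) given at every point of `Ω_T` by the Stokes potential of `Lᵖ` data `(A, B)`,
a potential that vanishes at every point outside the closure of `Ω_T`. -/
def classB {n : ℕ} (a : Matrix (Fin n) (Fin n) ℝ) (Ω : Set (Space n)) (T : ℝ) (p : ℝ≥0∞) :
    Set (Space n × ℝ → ℝ) :=
  {u | ∃ w A B : Space n × ℝ → ℝ, u =ᵐ[volume.restrict (cylinder Ω T)] w ∧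
    MemLp A p (boundaryMeasure Ω T) ∧ MemLp B p (lateralMeasure Ω T) ∧
    (∀ z ∈ cylinder Ω T, stokesPotential a Ω T A B z = w z) ∧
    ∀ z ∉ closure (cylinder Ω T), stokesPotential a Ω T A B z = 0}

/-- The class `ℬᵖ_*(Ω_T)`, defined as `ℬᵖ(Ω_T)` with the Stokes potential for `H*`. -/
def classBstar {n : ℕ} (a : Matrix (Fin n) (Fin n) ℝ) (Ω : Set (Space n)) (T : ℝ) (p : ℝ≥0∞) :
    Set (Space n × ℝ → ℝ) :=
  {u | ∃ w A B : Space n × ℝ → ℝ, u =ᵐ[volume.restrict (cylinder Ω T)] w ∧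
    MemLp A p (boundaryMeasure Ω T) ∧ MemLp B p (lateralMeasure Ω T) ∧
    (∀ z ∈ cylinder Ω T, stokesPotentialStar a Ω T A B z = w z) ∧
    ∀ z ∉ closure (cylinder Ω T), stokesPotentialStar a Ω T A B z = 0}

end Parabolic

end

namespace Parabolic

open Filter Topology

/-! Everything rests on one duality. For a test function ψ, put Nψ(q) = ∫ G(ζ) ψ(q + ζ) dζ
(`heatPotential`). This function is smooth, N commutes with H*, and N(H*ψ) = -ψ
(`heatPotential_opHstar`). If v = -Nψ is inserted into the boundary terms of the Green formula with
data (A, B), an exchange of integrals turns them into ∫ ψ P, where P is the Stokes potential of the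
same data (`integral_mul_stokesPotential`).

From 𝒜 to ℬ: v = -Nψ satisfies H*v = ψ, and it is an admissible test function because smoothness
alone is required. Green's formula then reads ∫ u ψ = ∫ P ψ, with u extended by zero, so P agrees
almost everywhere with that extension. Outside the closed cylinder P is continuous, hence it
vanishes at every point there.

From ℬ to 𝒜: after a cutoff away from the cylinder, v has compact support and v = -N(H*v). With ψ =
H*v the duality is Green's formula, since P equals u inside, is zero outside, and the boundary of
the cylinder is a null set. The data (A, B) are the same in both directions.

The analytic work is to justify the exchange of integrals for data merely in Lᵖ, including p = 1.
Gaussian decay gives |G| ≤ C t^(-α) |x|^(-(n-2α)), and the conormal kernel satisfies the same bound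
with n + 1 - 2α. Integrability in time needs α < 1, and then the conormal bound is too singular to
be integrated over the (n-1)-dimensional boundary alone. Schur's test with a split kernel
(`lintegral_schur`) shifts part of the singularity to the n-dimensional space variable of the target
point. Only the growth of surface measure on balls is used, never cancellation.

The starred classes reduce to the others by the reflection t ↦ T - t. -/

/-! ### Surface measure of a compact `C¹` boundary. -/

theorem hausdorffMeasure_le_of_antilipschitzOn {X Y : Type*} [MetricSpace X] [MeasurableSpace X]
    [BorelSpace X] [MetricSpace Y] [MeasurableSpace Y] [BorelSpace Y] {d : ℝ} (hd : 0 ≤ d)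
    {S : Set X} {f : X → Y} {K : NNReal}
    (h : ∀ x ∈ S, ∀ y ∈ S, dist x y ≤ K * dist (f x) (f y)) :
    μH[d] S ≤ (K : ℝ≥0∞) ^ d * μH[d] (f '' S) := by
  have h1 : AntilipschitzWith K (fun x : S => f x) :=
    AntilipschitzWith.of_le_mul_dist fun x y => h x x.2 y y.2
  have h2 := h1.le_hausdorffMeasure_image hd univ
  have h3 := (isometry_subtype_coe (s := S)).hausdorffMeasure_image (Or.inl hd) univ
  rw [image_univ, Subtype.range_coe] at h3
  rw [← h3] at h2
  rwa [image_univ, ← Set.image_eq_range f S] at h2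

/-- Two nearby boundary points differ by an almost tangential vector, so orthogonal projection onto
the tangent hyperplane shrinks distances by a bounded factor. This replaces a graph parametrization
of the boundary. -/
theorem IsC1DefiningFunction.exists_antilipschitz {n : ℕ} {Ω U : Set (Space n)}
    {φ : Space n → ℝ} (h : IsC1DefiningFunction Ω U φ) {x : Space n} (hx : x ∈ U) :
    ∃ V ∈ 𝓝 x, ∀ y ∈ V ∩ frontier Ω, ∀ z ∈ V ∩ frontier Ω,
      dist y z ≤ (2 : NNReal) * dist ((ℝ ∙ gradient φ x)ᗮ.orthogonalProjectionOnto y)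
        ((ℝ ∙ gradient φ x)ᗮ.orthogonalProjectionOnto z) := by
  set g := gradient φ x with hg
  have hg0 : 0 < ‖g‖ := norm_pos_iff.2 (h.gradient_ne_zero x hx)
  have hU := h.isOpen.mem_nhds hx
  have hd : HasStrictFDerivAt φ (fderiv ℝ φ x) x :=
    (h.contDiffOn.contDiffAt hU).hasStrictFDerivAt (by norm_num)
  -- Since `φ` vanishes at both points, the tolerance `‖g‖ / 2` bounds the normal component of `y -
  -- z` by `‖y - z‖ / 2`. By Pythagoras the tangential component is then at least `(√3 / 2) ‖y -
  -- z‖`.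
  obtain ⟨s, hs, hl⟩ := hd.approximates_deriv_on_nhds (c := ‖g‖₊ / 2)
    (Or.inr (half_pos hg0))
  refine ⟨s ∩ U, inter_mem hs hU, ?_⟩
  rintro y ⟨⟨hys, hyU⟩, hy⟩ z ⟨⟨hzs, hzU⟩, hz⟩
  have h1 := hl y hys z hzs
  rw [h.eq_zero hy hyU, h.eq_zero hz hzU] at h1
  have h2 : fderiv ℝ φ x (y - z) = inner ℝ g (y - z) := by simp [hg, gradient]
  rw [h2, sub_zero, zero_sub, norm_neg, Real.norm_eq_abs] at h1
  rw [NNReal.coe_div, coe_nnnorm, NNReal.coe_ofNat] at h1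
  set w := y - z with hw
  have h3 := (ℝ ∙ g).norm_sq_eq_add_norm_sq_projection w
  have h4 : ‖(ℝ ∙ g).orthogonalProjectionOnto w‖ ≤ ‖w‖ / 2 := by
    rw [Submodule.coe_norm, Submodule.coe_orthogonalProjectionOnto_apply,
      Submodule.starProjection_singleton, norm_smul, norm_div, Real.norm_eq_abs]
    simp only [RCLike.ofReal_real_eq_id, id, norm_pow, norm_norm]
    rw [div_mul_eq_mul_div, div_le_iff₀ (by positivity)]
    nlinarith
  rw [dist_eq_norm, dist_eq_norm, ← map_sub, ← hw]
  have h5 := norm_nonneg ((ℝ ∙ g)ᗮ.orthogonalProjectionOnto w)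
  have h6 := norm_nonneg ((ℝ ∙ g).orthogonalProjectionOnto w)
  simp only [NNReal.coe_ofNat]
  have h7 := norm_nonneg w
  nlinarith

/-- The projection to the tangent hyperplane `W` is 1-Lipschitz, so it maps the piece into a ball of
radius `r` in `W`, where Hausdorff measure is Lebesgue measure. The antilipschitz bound brings the
estimate back to the boundary. -/
theorem exists_surface_closedBall_le_local {n : ℕ} (hn : 1 ≤ n) {Ω : Set (Space n)}
    (hΩ : HasC1Boundary Ω) {x : Space n} (hx : x ∈ frontier Ω) :
    ∃ V ∈ 𝓝 x, ∃ C : ℝ≥0∞, C ≠ ⊤ ∧ ∀ y : Space n, ∀ r : ℝ, 0 < r →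
      μHE[n - 1] (V ∩ frontier Ω ∩ Metric.closedBall y r) ≤ C * ENNReal.ofReal r ^ (n - 1) := by
  obtain ⟨U, φ, hxU, h⟩ := hΩ x hx
  obtain ⟨V, hV, hanti⟩ := h.exists_antilipschitz hxU
  set W := (ℝ ∙ gradient φ x)ᗮ with hW
  have hfr : Module.finrank ℝ W = n - 1 := by
    have h1 := (ℝ ∙ gradient φ x).finrank_add_finrank_orthogonal
    rw [finrank_span_singleton (h.gradient_ne_zero x hxU), ← hW] at h1
    have h2 : Module.finrank ℝ (Space n) = n := by simp
    omega
  have hHE : (μHE[n - 1] : Measure W) = volume := by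
    rw [← hfr]; exact InnerProductSpace.euclideanHausdorffMeasure_eq_volume
  refine ⟨V, hV, 2 ^ (n - 1) * volume (Metric.ball (0 : W) 1),
    ENNReal.mul_ne_top (by simp) measure_ball_lt_top.ne, fun y r hr => ?_⟩
  have key := hausdorffMeasure_le_of_antilipschitzOn (d := ((n - 1 : ℕ) : ℝ)) (by positivity)
    (S := V ∩ frontier Ω ∩ Metric.closedBall y r) (f := W.orthogonalProjectionOnto) (K := 2)
    (fun p hp q hq => hanti p hp.1 q hq.1)
  have himg : W.orthogonalProjectionOnto '' (V ∩ frontier Ω ∩ Metric.closedBall y r) ⊆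
      Metric.closedBall (W.orthogonalProjectionOnto y) r := by
    rintro _ ⟨p, hp, rfl⟩
    rw [Metric.mem_closedBall, dist_eq_norm, ← map_sub]
    exact (W.norm_orthogonalProjectionOnto_apply_le _).trans
      (by rw [← dist_eq_norm]; exact hp.2)
  have h2 : (μHE[n - 1] : Measure (Space n)) (V ∩ frontier Ω ∩ Metric.closedBall y r) ≤
      2 ^ (n - 1) * (μHE[n - 1] : Measure W)
        (W.orthogonalProjectionOnto '' (V ∩ frontier Ω ∩ Metric.closedBall y r)) := by
    rw [Measure.euclideanHausdorffMeasure_def, Measure.euclideanHausdorffMeasure_def,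
      Measure.smul_apply, Measure.smul_apply, ENNReal.smul_def, ENNReal.smul_def, smul_eq_mul,
      smul_eq_mul]
    calc _ ≤ _ := mul_le_mul_right key _
      _ = _ := by
        rw [ENNReal.rpow_natCast]
        push_cast
        ring
  refine h2.trans ?_
  rw [hHE]
  calc _ ≤ 2 ^ (n - 1) * volume (Metric.closedBall (W.orthogonalProjectionOnto y) r) := by
        gcongr
    _ = _ := by
        rw [Measure.addHaar_closedBall _ _ hr.le, hfr, ENNReal.ofReal_pow hr.le]
        ring

/-- A compact `C¹` boundary is upper Ahlfors regular. -/
theorem exists_surface_closedBall_le {n : ℕ} (hn : 1 ≤ n) {Ω : Set (Space n)}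
    (hΩ : HasC1Boundary Ω) (hb : Bornology.IsBounded Ω) :
    ∃ C : ℝ≥0∞, C ≠ ⊤ ∧ ∀ y : Space n, ∀ r : ℝ, 0 < r →
      μHE[n - 1] (frontier Ω ∩ Metric.closedBall y r) ≤ C * ENNReal.ofReal r ^ (n - 1) := by
  have hK : IsCompact (frontier Ω) :=
    Metric.isCompact_of_isClosed_isBounded isClosed_frontier
      (hb.closure.subset frontier_subset_closure)
  choose! V hV C hC hle using fun x (hx : x ∈ frontier Ω) =>
    exists_surface_closedBall_le_local hn hΩ hx
  obtain ⟨t, ht, hcov⟩ := hK.elim_nhds_subcover V hV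
  refine ⟨∑ x ∈ t, C x, by simpa using fun x hx => hC x (ht x hx), fun y r hr => ?_⟩
  calc _ ≤ μHE[n - 1] (⋃ x ∈ t, V x ∩ frontier Ω ∩ Metric.closedBall y r) := by
        refine measure_mono fun z hz => ?_
        obtain ⟨x, hx, hzx⟩ := mem_iUnion₂.1 (hcov hz.1)
        exact mem_iUnion₂.2 ⟨x, hx, ⟨hzx, hz.1⟩, hz.2⟩
    _ ≤ ∑ x ∈ t, μHE[n - 1] (V x ∩ frontier Ω ∩ Metric.closedBall y r) :=
        measure_biUnion_finset_le _ _
    _ ≤ ∑ x ∈ t, C x * ENNReal.ofReal r ^ (n - 1) :=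
        Finset.sum_le_sum fun x hx => hle x (ht x hx) y r hr
    _ = _ := by rw [Finset.sum_mul]

theorem surface_lt_top {n : ℕ} (hn : 1 ≤ n) {Ω : Set (Space n)}
    (hΩ : HasC1Boundary Ω) (hb : Bornology.IsBounded Ω) :
    μHE[n - 1] (frontier Ω) < ⊤ := by
  obtain ⟨C, hC, h⟩ := exists_surface_closedBall_le hn hΩ hb
  obtain ⟨r, hr⟩ := (hb.closure.subset frontier_subset_closure).subset_closedBall (0 : Space n)
  have h1 : frontier Ω ⊆ Metric.closedBall 0 (max r 1) :=
    hr.trans (Metric.closedBall_subset_closedBall (le_max_left _ _))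
  have h2 := h 0 (max r 1) (by positivity)
  rw [inter_eq_left.2 h1] at h2
  exact h2.trans_lt (ENNReal.mul_lt_top hC.lt_top (by finiteness))

/-- A set of finite (n-1)-dimensional measure is null in dimension n. -/
theorem volume_frontier_eq_zero {n : ℕ} (hn : 1 ≤ n) {Ω : Set (Space n)}
    (hΩ : HasC1Boundary Ω) (hb : Bornology.IsBounded Ω) :
    volume (frontier Ω) = 0 := by
  rw [← EuclideanSpace.euclideanHausdorffMeasure_eq_volume n]
  exact (Measure.euclideanHausdorffMeasure_zero_or_top (show n - 1 < n by omega) _).resolve_right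
    (surface_lt_top hn hΩ hb).ne

/-- Provides the measurability of the double layer kernel on the lateral boundary. -/
theorem continuousOn_innerNormal {n : ℕ} {Ω : Set (Space n)} (hΩ : HasC1Boundary Ω) :
    ContinuousOn (innerNormal Ω) (frontier Ω) := by
  intro x hx
  obtain ⟨U, φ, hxU, h⟩ := hΩ x hx
  have hg : ContinuousAt (gradient φ) x := by
    have h1 : ContinuousAt (fderiv ℝ φ) x :=
      ((h.contDiffOn.contDiffAt (h.isOpen.mem_nhds hxU)).fderiv_right (m := 0)
        (by norm_num)).continuousAt
    exact (LinearIsometryEquiv.continuous _).continuousAt.comp h1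
  have h2 : ContinuousWithinAt (fun y => ‖gradient φ y‖⁻¹ • gradient φ y) (frontier Ω) x :=
    ((hg.norm.inv₀ (norm_ne_zero_iff.2 (h.gradient_ne_zero x hxU))).smul hg).continuousWithinAt
  refine h2.congr_of_eventuallyEq ?_ (innerNormal_eq hx hxU h)
  filter_upwards [self_mem_nhdsWithin, mem_nhdsWithin_of_mem_nhds (h.isOpen.mem_nhds hxU)]
    with y hy hyU
  exact innerNormal_eq hy hyU h

theorem norm_innerNormal_le {n : ℕ} {Ω : Set (Space n)} (hΩ : HasC1Boundary Ω) {x : Space n}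
    (hx : x ∈ frontier Ω) : ‖innerNormal Ω x‖ ≤ 1 := by
  obtain ⟨U, φ, hxU, h⟩ := hΩ x hx
  rw [innerNormal_eq hx hxU h, norm_smul, norm_inv, norm_norm]
  exact inv_mul_le_one

/-! ### Potential estimates and Schur's test. -/

/-- A finite measure of growth `m` has bounded potentials of order `s < m`. -/
theorem exists_lintegral_inv_rpow_le {E : Type*} [NormedAddCommGroup E] [MeasurableSpace E]
    [BorelSpace E] (ν : Measure E) {m s : ℝ} (hs : 0 ≤ s) (hsm : s < m) {C : ℝ≥0∞}
    (hC : C ≠ ⊤) (hν : ν univ ≠ ⊤)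
    (h : ∀ x r, 0 < r → ν (Metric.closedBall x r) ≤ C * ENNReal.ofReal (r ^ m)) :
    ∃ M : ℝ≥0∞, M ≠ ⊤ ∧ ∀ x, ∫⁻ y, (‖x - y‖ₑ⁻¹) ^ s ∂ν ≤ M := by
  rcases hs.eq_or_lt with rfl | hs
  · exact ⟨ν univ, hν, fun x => by simp⟩
  have hm : 0 < m := hs.trans hsm
  have hint : ∫⁻ t in Ioi (1 : ℝ), ENNReal.ofReal (t ^ (-(m / s))) < ⊤ := by
    have h1 := integrableOn_Ioi_rpow_of_lt (a := -(m / s)) (c := 1)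
      (by rw [neg_lt_neg_iff, lt_div_iff₀ hs]; linarith) one_pos
    exact h1.lintegral_lt_top
  refine ⟨ν univ + C * ∫⁻ t in Ioi (1 : ℝ), ENNReal.ofReal (t ^ (-(m / s))),
    by finiteness, fun x => ?_⟩
  -- The centre must be a null set: there the extended inverse power is `⊤`, while the real power `0
  -- ^ (-s)` is `0`.
  have hx : ν {x} = 0 := by
    have h1 : Tendsto (fun r : ℝ => C * ENNReal.ofReal (r ^ m)) (𝓝[>] 0) (𝓝 0) := by
      have h2 : Tendsto (fun r : ℝ => r ^ m) (𝓝[>] 0) (𝓝 0) := by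
        have h3 : Tendsto (fun r : ℝ => r ^ m) (𝓝 0) (𝓝 (0 ^ m)) :=
          (Real.continuousAt_rpow_const 0 m (Or.inr hm.le)).tendsto
        rw [Real.zero_rpow hm.ne'] at h3
        exact h3.mono_left nhdsWithin_le_nhds
      have h4 := ENNReal.Tendsto.const_mul (a := C) (ENNReal.tendsto_ofReal h2) (Or.inr hC)
      simpa using h4
    refine le_antisymm (ge_of_tendsto h1 ?_) bot_le
    filter_upwards [self_mem_nhdsWithin] with r hr
    exact (measure_mono (singleton_subset_iff.2
      (Metric.mem_closedBall_self (le_of_lt hr)))).trans (h x r hr)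
  have hae : ∀ᵐ y ∂ν, (‖x - y‖ₑ⁻¹) ^ s = ENNReal.ofReal (‖x - y‖ ^ (-s)) := by
    have : ∀ᵐ y ∂ν, y ≠ x := by
      rw [ae_iff]; simpa using hx
    filter_upwards [this] with y hy
    have hpos : 0 < ‖x - y‖ := norm_pos_iff.2 (sub_ne_zero.2 hy.symm)
    rw [← ENNReal.ofReal_rpow_of_pos hpos, ofReal_norm, ENNReal.inv_rpow, ENNReal.rpow_neg]
  rw [lintegral_congr_ae hae]
  have hmeas : Measurable fun y : E => ‖x - y‖ ^ (-s) := by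
    have h1 : Continuous fun y : E => ‖x - y‖ := by fun_prop
    exact h1.measurable.pow_const _
  -- Layer cake formula, split at height 1. Below, superlevel sets are bounded by the total mass.
  -- Above, they lie in balls of radius `t ^ (-1/s)`, of mass at most `C t ^ (-m/s)`, which is
  -- integrable because `m / s > 1`.
  rw [lintegral_eq_lintegral_meas_lt ν (ae_of_all _ fun y => by positivity) hmeas.aemeasurable,
    ← Ioc_union_Ioi_eq_Ioi zero_le_one, lintegral_union measurableSet_Ioi
      (Ioc_disjoint_Ioi le_rfl)]
  refine add_le_add ?_ ?_
  · calc _ ≤ ∫⁻ t in Ioc (0 : ℝ) 1, ν univ := lintegral_mono fun t => measure_mono (subset_univ _)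
      _ = _ := by simp
  · rw [← lintegral_const_mul' _ _ hC]
    refine setLIntegral_mono' measurableSet_Ioi fun t ht => ?_
    have ht0 : (0 : ℝ) < t := one_pos.trans ht
    have h1 : {y | t < ‖x - y‖ ^ (-s)} ⊆ Metric.closedBall x (t ^ (-(1 / s))) := by
      intro y hy
      have hy : t < ‖x - y‖ ^ (-s) := hy
      rw [Metric.mem_closedBall, dist_comm, dist_eq_norm]
      rcases (norm_nonneg (x - y)).eq_or_lt with h0 | h0
      · rw [← h0]; positivity
      · have h2 := Real.rpow_le_rpow_of_nonpos ht0 hy.le (z := -(1 / s))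
          (by rw [neg_nonpos]; positivity)
        rwa [← Real.rpow_mul h0.le, show -s * -(1 / s) = 1 by field_simp, Real.rpow_one] at h2
    refine (measure_mono h1).trans ((h x _ (by positivity)).trans_eq ?_)
    rw [← Real.rpow_mul ht0.le]
    congr 3
    ring

/-- Schur's test on `Lᵖ`, with the kernel split into two factors. -/
theorem lintegral_schur {α β : Type*} [MeasurableSpace α] [MeasurableSpace β] (μ : Measure α)
    (ν : Measure β) [SFinite μ] [SFinite ν] {K K1 K2 : α → β → ℝ≥0∞}
    (hK1 : Measurable (Function.uncurry K1)) (hK2 : Measurable (Function.uncurry K2))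
    {p : ℝ} (hp : 1 ≤ p) (hK : ∀ a b, K a b ≤ K1 a b ^ (1 - 1 / p) * K2 a b ^ (1 / p))
    {M1 M2 : ℝ≥0∞} (h1 : ∀ a, ∫⁻ b, K1 a b ∂ν ≤ M1) (h2 : ∀ b, ∫⁻ a, K2 a b ∂μ ≤ M2)
    {h : β → ℝ≥0∞} (hh : AEMeasurable h ν) :
    ∫⁻ a, (∫⁻ b, K a b * h b ∂ν) ^ p ∂μ ≤ M1 ^ (p - 1) * M2 * ∫⁻ b, h b ^ p ∂ν := by
  have hp0 : 0 < p := by linarith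
  have hq : 0 ≤ 1 - 1 / p := by rw [sub_nonneg, div_le_one hp0]; exact hp
  have step : ∀ a, (∫⁻ b, K a b * h b ∂ν) ^ p ≤ M1 ^ (p - 1) * ∫⁻ b, K2 a b * h b ^ p ∂ν := by
    intro a
    have hm1 : Measurable (K1 a) := hK1.comp measurable_prodMk_left
    have hm2 : Measurable (K2 a) := hK2.comp measurable_prodMk_left
    have e1 : ∫⁻ b, K a b * h b ∂ν ≤
        ∫⁻ b, K1 a b ^ (1 - 1 / p) * (K2 a b * h b ^ p) ^ (1 / p) ∂ν := by
      refine lintegral_mono fun b => ?_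
      rw [ENNReal.mul_rpow_of_nonneg _ _ (by positivity), ← ENNReal.rpow_mul,
        mul_one_div_cancel hp0.ne', ENNReal.rpow_one, ← mul_assoc]
      exact mul_le_mul_left (hK a b) _
    -- Hölder's inequality with weights `1 - 1/p` and `1/p`; this form remains valid for `p = 1`,
    -- where the first weight is zero.
    have e2 := ENNReal.lintegral_mul_norm_pow_le (μ := ν) (f := K1 a)
      (g := fun b => K2 a b * h b ^ p) hm1.aemeasurable
      (hm2.aemeasurable.mul (hh.pow_const p)) hq (by positivity : 0 ≤ 1 / p) (by ring)
    calc _ ≤ ((∫⁻ b, K1 a b ∂ν) ^ (1 - 1 / p) *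
          (∫⁻ b, K2 a b * h b ^ p ∂ν) ^ (1 / p)) ^ p :=
          ENNReal.rpow_le_rpow (e1.trans e2) hp0.le
      _ = (∫⁻ b, K1 a b ∂ν) ^ (p - 1) * ∫⁻ b, K2 a b * h b ^ p ∂ν := by
          rw [ENNReal.mul_rpow_of_nonneg _ _ hp0.le, ← ENNReal.rpow_mul, ← ENNReal.rpow_mul,
            one_div_mul_cancel hp0.ne', ENNReal.rpow_one]
          congr 2
          field_simp
      _ ≤ _ := by gcongr; exact h1 a
  have hm : AEMeasurable (Function.uncurry fun a b => K2 a b * h b ^ p) (μ.prod ν) :=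
    hK2.aemeasurable.mul ((hh.pow_const p).comp_quasiMeasurePreserving
      Measure.quasiMeasurePreserving_snd)
  calc _ ≤ ∫⁻ a, M1 ^ (p - 1) * ∫⁻ b, K2 a b * h b ^ p ∂ν ∂μ := lintegral_mono step
    _ = M1 ^ (p - 1) * ∫⁻ b, ∫⁻ a, K2 a b * h b ^ p ∂μ ∂ν := by
        rw [lintegral_const_mul'', lintegral_lintegral_swap hm]
        exact hm.lintegral_prod_right'
    _ = M1 ^ (p - 1) * ∫⁻ b, (∫⁻ a, K2 a b ∂μ) * h b ^ p ∂ν := by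
        congr 1
        refine lintegral_congr fun b => ?_
        have hm2 : Measurable fun a => K2 a b := hK2.comp measurable_prodMk_right
        rw [lintegral_mul_const _ hm2]
    _ ≤ M1 ^ (p - 1) * ∫⁻ b, M2 * h b ^ p ∂ν := by
        gcongr with b
        exact h2 b
    _ = _ := by rw [lintegral_const_mul'' _ (hh.pow_const p), mul_assoc]

theorem inv_rpow_mul_inv_rpow (x : ℝ≥0∞) {s1 s2 a b : ℝ} (h1 : 0 ≤ s1) (h2 : 0 ≤ s2)
    (ha : 0 ≤ a) (hb : 0 ≤ b) :
    ((x⁻¹) ^ s1) ^ a * ((x⁻¹) ^ s2) ^ b = (x⁻¹) ^ (s1 * a + s2 * b) := by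
  rw [ENNReal.rpow_add_of_nonneg _ _ (by positivity) (by positivity), ENNReal.rpow_mul,
    ENNReal.rpow_mul]

/-- On a finite measure space `t ≤ 1 + t ^ p` turns the `Lᵖ` bound of the inner integral into joint
absolute integrability, which is what Fubini needs. -/
theorem integrable_memLp_of_lintegral_rpow_lt_top {α β : Type*} [MeasurableSpace α]
    [MeasurableSpace β] {μ : Measure α} {ν : Measure β} [IsFiniteMeasure μ] [SFinite ν]
    {F : α × β → ℝ} (hF : AEStronglyMeasurable F (μ.prod ν)) {p : ℝ≥0∞} (hp : 1 ≤ p)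
    (hp' : p ≠ ⊤) (hfin : ∫⁻ a, (∫⁻ b, ‖F (a, b)‖ₑ ∂ν) ^ p.toReal ∂μ < ⊤) :
    Integrable F (μ.prod ν) ∧ MemLp (fun a => ∫ b, F (a, b) ∂ν) p μ := by
  have hp0 : p ≠ 0 := (one_pos.trans_le hp).ne'
  have hg : AEMeasurable (fun a => ∫⁻ b, ‖F (a, b)‖ₑ ∂ν) μ := hF.enorm.lintegral_prod_right'
  have hp1 : 1 ≤ p.toReal := by
    rw [← ENNReal.toReal_one]; exact ENNReal.toReal_mono hp' hp
  constructor
  · refine ⟨hF, ?_⟩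
    rw [hasFiniteIntegral_iff_enorm, lintegral_prod _ hF.enorm]
    calc _ ≤ ∫⁻ a, (1 + (∫⁻ b, ‖F (a, b)‖ₑ ∂ν) ^ p.toReal) ∂μ := by
          refine lintegral_mono fun a => ?_
          rcases le_total (∫⁻ b, ‖F (a, b)‖ₑ ∂ν) 1 with h | h
          · exact h.trans le_self_add
          · refine le_trans ?_ le_add_self
            simpa using ENNReal.rpow_le_rpow_of_exponent_le h hp1
      _ = μ univ + ∫⁻ a, (∫⁻ b, ‖F (a, b)‖ₑ ∂ν) ^ p.toReal ∂μ := by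
          rw [lintegral_add_left measurable_const]; simp
      _ < ⊤ := ENNReal.add_lt_top.2 ⟨measure_lt_top _ _, hfin⟩
  · refine ⟨hF.integral_prod_right', ?_⟩
    rw [eLpNorm_lt_top_iff_lintegral_rpow_enorm_lt_top hp0 hp']
    refine lt_of_le_of_lt (lintegral_mono fun a => ?_) hfin
    exact ENNReal.rpow_le_rpow (enorm_integral_le_lintegral_enorm _) (by positivity)

theorem isFiniteMeasure_surface {n : ℕ} (hn : 1 ≤ n) {Ω : Set (Space n)}
    (hΩ : HasC1Boundary Ω) (hb : Bornology.IsBounded Ω) :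
    IsFiniteMeasure ((μHE[n - 1] : Measure (Space n)).restrict (frontier Ω)) :=
  ⟨by rw [Measure.restrict_apply_univ]; exact surface_lt_top hn hΩ hb⟩

theorem isFiniteMeasure_lateralMeasure {n : ℕ} (hn : 1 ≤ n) {Ω : Set (Space n)}
    (hΩ : HasC1Boundary Ω) (hb : Bornology.IsBounded Ω) (T : ℝ) :
    IsFiniteMeasure (lateralMeasure Ω T) := by
  have := isFiniteMeasure_surface hn hΩ hb
  unfold lateralMeasure
  infer_instance

theorem exists_lintegral_surface_le {n : ℕ} (hn : 1 ≤ n) {Ω : Set (Space n)}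
    (hΩ : HasC1Boundary Ω) (hb : Bornology.IsBounded Ω) {s : ℝ} (hs : 0 ≤ s)
    (hsn : s < (n : ℝ) - 1) :
    ∃ M : ℝ≥0∞, M ≠ ⊤ ∧ ∀ x : Space n,
      ∫⁻ y, (‖x - y‖ₑ⁻¹) ^ s ∂((μHE[n - 1] : Measure (Space n)).restrict (frontier Ω)) ≤ M := by
  obtain ⟨C, hC, h⟩ := exists_surface_closedBall_le hn hΩ hb
  refine exists_lintegral_inv_rpow_le (m := (n : ℝ) - 1) _ hs hsn hC ?_ fun x r hr => ?_
  · rw [Measure.restrict_apply_univ]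
    exact (surface_lt_top hn hΩ hb).ne
  · rw [Measure.restrict_apply Metric.isClosed_closedBall.measurableSet, inter_comm,
      show (n : ℝ) - 1 = ((n - 1 : ℕ) : ℝ) by push_cast [hn]; ring, Real.rpow_natCast,
      ENNReal.ofReal_pow hr.le]
    exact h x r hr

theorem exists_lintegral_volume_le {E : Type*} [NormedAddCommGroup E] [NormedSpace ℝ E]
    [FiniteDimensional ℝ E] [MeasureSpace E] [BorelSpace E]
    [(volume : Measure E).IsAddHaarMeasure] {S : Set E}
    (hS : volume S ≠ ⊤) {s : ℝ} (hs : 0 ≤ s) (hsn : s < Module.finrank ℝ E) :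
    ∃ M : ℝ≥0∞, M ≠ ⊤ ∧ ∀ x : E, ∫⁻ y in S, (‖x - y‖ₑ⁻¹) ^ s ≤ M := by
  refine exists_lintegral_inv_rpow_le (m := Module.finrank ℝ E) _ hs hsn
    (C := volume (Metric.ball (0 : E) 1)) measure_ball_lt_top.ne ?_ fun x r hr => ?_
  · rwa [Measure.restrict_apply_univ]
  · refine (Measure.restrict_apply_le _ _).trans ?_
    rw [Measure.addHaar_closedBall _ _ hr.le, mul_comm, Real.rpow_natCast]

/-- The product of a power of the time variable and of a power of the space variable. -/
noncomputable def powerKernel {n : ℕ} (α s : ℝ) (z : Space n × ℝ) : ℝ≥0∞ :=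
  (‖z.2‖ₑ⁻¹) ^ α * (‖z.1‖ₑ⁻¹) ^ s

@[fun_prop]
theorem measurable_powerKernel {n : ℕ} (α s : ℝ) :
    Measurable (powerKernel α s : Space n × ℝ → ℝ≥0∞) := by
  unfold powerKernel
  fun_prop

theorem lintegral_powerKernel_prod {n : ℕ} (α s : ℝ) (μ : Measure (Space n)) (ν : Measure ℝ)
    [SFinite μ] [SFinite ν] (z : Space n × ℝ) :
    ∫⁻ q, powerKernel α s (z - q) ∂(μ.prod ν) =
      (∫⁻ t, (‖z.2 - t‖ₑ⁻¹) ^ α ∂ν) * ∫⁻ x, (‖z.1 - x‖ₑ⁻¹) ^ s ∂μ := by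
  simp only [powerKernel, Prod.fst_sub, Prod.snd_sub]
  rw [mul_comm, ← lintegral_prod_mul (by fun_prop) (by fun_prop)]
  simp only [mul_comm]

theorem powerKernel_neg {n : ℕ} (α s : ℝ) (z : Space n × ℝ) :
    powerKernel α s (-z) = powerKernel α s z := by
  simp [powerKernel]

theorem exists_lintegral_powerKernel_le {n : ℕ} {α s : ℝ} (hα : 0 ≤ α) (hα' : α < 1)
    (hs : 0 ≤ s) (hs' : s < n) (R : ℝ) :
    ∃ M : ℝ≥0∞, M ≠ ⊤ ∧ ∀ q : Space n × ℝ,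
      ∫⁻ z in Metric.closedBall 0 R, powerKernel α s (z - q) ≤ M := by
  obtain ⟨M, hM, h⟩ := exists_lintegral_volume_le (E := Space n) (S := Metric.closedBall 0 R)
    measure_closedBall_lt_top.ne hs (by simpa using hs')
  obtain ⟨N, hN, h'⟩ := exists_lintegral_volume_le (E := ℝ) (S := Metric.closedBall 0 R)
    measure_closedBall_lt_top.ne hα (by simpa using hα')
  refine ⟨N * M, by finiteness, fun q => ?_⟩
  simp_rw [← neg_sub q, powerKernel_neg]
  rw [show (0 : Space n × ℝ) = (0, 0) from rfl, ← closedBall_prod_same, Measure.volume_eq_prod,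
    ← Measure.prod_restrict, lintegral_powerKernel_prod]
  exact mul_le_mul' (h' _) (h _)

theorem exists_lintegral_powerKernel_lateral_le {n : ℕ} (hn : 1 ≤ n) {Ω : Set (Space n)}
    (hΩ : HasC1Boundary Ω) (hb : Bornology.IsBounded Ω) (T : ℝ) {α s : ℝ} (hα : 0 ≤ α)
    (hα' : α < 1) (hs : 0 ≤ s) (hs' : s < (n : ℝ) - 1) :
    ∃ M : ℝ≥0∞, M ≠ ⊤ ∧ ∀ z : Space n × ℝ,
      ∫⁻ q, powerKernel α s (z - q) ∂(lateralMeasure Ω T) ≤ M := by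
  have := isFiniteMeasure_surface hn hΩ hb
  obtain ⟨M, hM, h⟩ := exists_lintegral_surface_le hn hΩ hb hs hs'
  obtain ⟨N, hN, h'⟩ := exists_lintegral_volume_le (E := ℝ) (S := Ioo 0 T)
    measure_Ioo_lt_top.ne hα (by simpa using hα')
  refine ⟨N * M, by finiteness, fun z => ?_⟩
  rw [lateralMeasure, lintegral_powerKernel_prod]
  exact mul_le_mul' (h' _) (h _)

/-- `Lᵖ` bound of the layer potentials. -/
theorem exists_lateral_schur {n : ℕ} (hn : 3 ≤ n) {Ω : Set (Space n)}
    (hΩ : HasC1Boundary Ω) (hb : Bornology.IsBounded Ω) (T : ℝ) {p : ℝ} (hp : 1 ≤ p) :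
    ∃ θ : ℝ, 0 < θ ∧ θ < 1 / 2 ∧ ∀ α : ℝ, 0 ≤ α → α < 1 → ∀ R : ℝ,
      ∃ M : ℝ≥0∞, M ≠ ⊤ ∧ ∀ h : Space n × ℝ → ℝ≥0∞, AEMeasurable h (lateralMeasure Ω T) →
        ∫⁻ z in Metric.closedBall 0 R, (∫⁻ q, powerKernel α (n - 1 + 2 * θ) (z - q) * h q
          ∂(lateralMeasure Ω T)) ^ p ≤ M * ∫⁻ q, h q ^ p ∂(lateralMeasure Ω T) := by
  have hn1 : 1 ≤ n := by omega
  have hn3 : (3 : ℝ) ≤ n := by exact_mod_cast hn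
  have := isFiniteMeasure_lateralMeasure hn1 hΩ hb T
  have hp0 : 0 < p := by linarith
  set e := 1 / p with he
  have he0 : 0 < e := by positivity
  have he1 : e ≤ 1 := by rw [he, div_le_one hp0]; exact hp
  -- `s1` lies below the surface dimension `n - 1` and `s2` below the space dimension `n`. Their
  -- mean with weights `1 - 1/p`, `1/p` is `n - 1 + 2θ` with `θ > 0`, beyond what surface
  -- integration alone allows. `θ` does not depend on `α`, so that it serves the single and the
  -- double layer.
  set s1 : ℝ := n - 1 - e / 4 with hs1
  set s2 : ℝ := n - 1 / 4 with hs2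
  set θ : ℝ := (s1 * (1 - e) + s2 * e - (n - 1)) / 2 with hθ
  have hθe : θ = (e / 2 + e ^ 2 / 4) / 2 := by rw [hθ, hs1, hs2]; ring
  have hθ0 : 0 < θ := by rw [hθe]; positivity
  have hθ1 : θ < 1 / 2 := by rw [hθe]; nlinarith
  refine ⟨θ, hθ0, hθ1, fun α hα0 hα1 R => ?_⟩
  obtain ⟨M1, hM1, h1⟩ := exists_lintegral_powerKernel_lateral_le hn1 hΩ hb T
    (α := α) (s := s1) (by linarith) (by linarith) (by linarith) (by linarith)
  obtain ⟨M2, hM2, h2⟩ := exists_lintegral_powerKernel_le (n := n)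
    (α := α) (s := s2) (by linarith) (by linarith) (by linarith) (by linarith) R
  refine ⟨M1 ^ (p - 1) * M2,
    ENNReal.mul_ne_top (ENNReal.rpow_ne_top_of_nonneg (by linarith) hM1) hM2, fun h hh => ?_⟩
  refine lintegral_schur _ _ (K1 := fun z q => powerKernel α s1 (z - q))
    (K2 := fun z q => powerKernel α s2 (z - q)) ?_ ?_ hp (fun z q => le_of_eq ?_) h1 h2 hh
  · exact (measurable_powerKernel _ _).comp (measurable_fst.sub measurable_snd)
  · exact (measurable_powerKernel _ _).comp (measurable_fst.sub measurable_snd)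
  · rw [← he]
    simp only [powerKernel]
    rw [ENNReal.mul_rpow_of_nonneg _ _ (by linarith), ENNReal.mul_rpow_of_nonneg _ _ he0.le,
      mul_mul_mul_comm, inv_rpow_mul_inv_rpow _ (by linarith) (by linarith) (by linarith) he0.le,
      inv_rpow_mul_inv_rpow _ (by linarith) (by linarith) (by linarith) he0.le]
    congr 2
    · ring
    · rw [hθ]; ring

/-- `Lᵖ` bound of the volume potentials. -/
theorem exists_section_schur {n : ℕ} (hn : 3 ≤ n) {Ω : Set (Space n)}
    (hb : Bornology.IsBounded Ω) (τ : ℝ) {p : ℝ} (hp : 1 ≤ p) :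
    ∃ α : ℝ, 0 < α ∧ α ≤ 1 / 2 ∧ ∀ R : ℝ, ∃ M : ℝ≥0∞, M ≠ ⊤ ∧
      ∀ h : Space n → ℝ≥0∞, AEMeasurable h (volume.restrict Ω) →
        ∫⁻ z in Metric.closedBall 0 R, (∫⁻ y in Ω, powerKernel α (n - 2 * α) (z - (y, τ)) * h y)
          ^ p ≤ M * ∫⁻ y in Ω, h y ^ p := by
  have hn3 : (3 : ℝ) ≤ n := by exact_mod_cast hn
  have hp0 : 0 < p := by linarith
  set e := 1 / p with he
  have he0 : 0 < e := by positivity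
  have he1 : e ≤ 1 := by rw [he, div_le_one hp0]; exact hp
  -- The source lives at one fixed time, so `K1` must carry no time singularity, while `K2`,
  -- integrated over the target point, may carry the exponent `1/2`. The weighted mean of `0` and
  -- `1/2` is `1/(2p)`.
  refine ⟨e / 2, by positivity, by linarith, fun R => ?_⟩
  obtain ⟨M1, hM1, h1⟩ := exists_lintegral_volume_le (E := Space n) (S := Ω)
    hb.measure_lt_top.ne (s := n - 2 * (e / 2)) (by linarith) (by simp; linarith)
  obtain ⟨M2, hM2, h2⟩ := exists_lintegral_powerKernel_le (n := n)
    (α := 1 / 2) (s := n - 2 * (e / 2)) (by linarith) (by linarith) (by linarith) (by linarith) R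
  refine ⟨M1 ^ (p - 1) * M2,
    ENNReal.mul_ne_top (ENNReal.rpow_ne_top_of_nonneg (by linarith) hM1) hM2, fun h hh => ?_⟩
  refine lintegral_schur _ _ (K1 := fun z y => powerKernel 0 (n - 2 * (e / 2)) (z - (y, τ)))
    (K2 := fun z y => powerKernel (1 / 2) (n - 2 * (e / 2)) (z - (y, τ))) ?_ ?_ hp
    (fun z q => le_of_eq ?_) ?_ (fun y => h2 (y, τ)) hh
  · exact (measurable_powerKernel _ _).comp (by fun_prop)
  · exact (measurable_powerKernel _ _).comp (by fun_prop)
  · rw [← he]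
    simp only [powerKernel]
    rw [ENNReal.mul_rpow_of_nonneg _ _ (by linarith), ENNReal.mul_rpow_of_nonneg _ _ he0.le,
      mul_mul_mul_comm, inv_rpow_mul_inv_rpow _ (by linarith) (by linarith) (by linarith) he0.le,
      inv_rpow_mul_inv_rpow _ (by linarith) (by linarith) (by linarith) he0.le]
    congr 2 <;> ring
  · intro z
    simpa [powerKernel] using h1 z.1

/-! ### The fundamental solution and its bounds by powers. -/

open scoped MatrixOrder in
/-- The quadratic form of `a⁻¹` is the square of the norm of a linear isomorphism. -/
theorem exists_linearMap_norm_sq {n : ℕ} {a : Matrix (Fin n) (Fin n) ℝ} (ha : a.PosDef) :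
    ∃ S : Space n →ₗ[ℝ] Space n, |LinearMap.det S| = (√a.det)⁻¹ ∧
      ∀ ξ, inner ℝ (Matrix.toEuclideanLin a⁻¹ ξ) ξ = ‖S ξ‖ ^ 2 := by
  have h1 : (0 : Matrix (Fin n) (Fin n) ℝ) ≤ a⁻¹ :=
    Matrix.nonneg_iff_posSemidef.2 ha.inv.posSemidef
  -- Factor `a⁻¹ = b* b`; then `(det b)² = 1 / det a`.
  obtain ⟨b, hb⟩ := CStarAlgebra.nonneg_iff_eq_star_mul_self.1 h1
  refine ⟨Matrix.toEuclideanLin b, ?_, fun ξ => ?_⟩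
  · have h2 : b.det * b.det = (a.det)⁻¹ := by
      rw [← Ring.inverse_eq_inv', ← Matrix.det_nonsing_inv, hb, Matrix.det_mul,
        Matrix.star_eq_conjTranspose, Matrix.det_conjTranspose]
      simp
    rw [show LinearMap.det (Matrix.toLpLin 2 2 b) = b.det by
      rw [Matrix.toLpLin_eq_toLin, LinearMap.det_toLin], ← Real.sqrt_inv, ← h2,
      Real.sqrt_mul_self_eq_abs]
  · rw [hb, Matrix.toLpLin_mul_same, Matrix.star_eq_conjTranspose,
      Matrix.toEuclideanLin_conjTranspose_eq_adjoint, LinearMap.comp_apply,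
      LinearMap.adjoint_inner_left, real_inner_self_eq_norm_sq]

theorem exists_le_quadratic {n : ℕ} {a : Matrix (Fin n) (Fin n) ℝ} (ha : a.PosDef) :
    ∃ c : ℝ, 0 < c ∧ ∀ ξ : Space n, c * ‖ξ‖ ^ 2 ≤ inner ℝ (Matrix.toEuclideanLin a⁻¹ ξ) ξ := by
  obtain ⟨S, hS, h⟩ := exists_linearMap_norm_sq ha
  have hdet : LinearMap.det S ≠ 0 := by
    rw [← abs_pos, hS]
    have := ha.det_pos
    positivity
  set e := (S.equivOfDetNeZero hdet).toContinuousLinearEquiv with he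
  obtain ⟨K, hK, hle⟩ := e.symm.toContinuousLinearMap.bound
  refine ⟨(K ^ 2)⁻¹, by positivity, fun ξ => ?_⟩
  rw [h, inv_mul_le_iff₀ (by positivity), ← mul_pow]
  have h1 := hle (e ξ)
  have h2 : e ξ = S ξ := rfl
  rw [ContinuousLinearEquiv.coe_coe, e.symm_apply_apply, h2] at h1
  gcongr

/-- The linear change of variables `η = S ξ` reduces to the standard Gaussian, and the Jacobian
produces `√a.det`. -/
theorem integral_exp_neg_quadratic {n : ℕ} {a : Matrix (Fin n) (Fin n) ℝ} (ha : a.PosDef) :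
    ∫ ξ : Space n, Real.exp (-(inner ℝ (Matrix.toEuclideanLin a⁻¹ ξ) ξ) / 4) =
      (4 * Real.pi) ^ ((n : ℝ) / 2) * √a.det := by
  obtain ⟨S, hS, h⟩ := exists_linearMap_norm_sq ha
  have hdet : LinearMap.det S ≠ 0 := by
    rw [← abs_pos, hS]
    have := ha.det_pos
    positivity
  set e := (S.equivOfDetNeZero hdet).toContinuousLinearEquiv with he
  have hmap := Measure.map_linearMap_addHaar_eq_smul_addHaar (volume : Measure (Space n)) hdet
  have h1 := e.toHomeomorph.measurableEmbedding.integral_map (μ := volume)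
    (fun η : Space n => Real.exp (-(1 / 4) * ‖η‖ ^ 2))
  have h2 : (e.toHomeomorph : Space n → Space n) = S := rfl
  rw [h2, hmap, integral_smul_measure,
    GaussianFourier.integral_rexp_neg_mul_sq_norm (by norm_num)] at h1
  rw [abs_inv, hS, inv_inv, ENNReal.toReal_ofReal (by positivity)] at h1
  simp only [finrank_euclideanSpace, Fintype.card_fin, smul_eq_mul] at h1
  calc _ = ∫ ξ : Space n, Real.exp (-(1 / 4) * ‖S ξ‖ ^ 2) := by
        congr with ξ
        rw [h]
        congr 1
        ring
    _ = _ := by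
        rw [← h1]
        ring_nf

theorem inner_toEuclideanLin_inv_comm {n : ℕ} {a : Matrix (Fin n) (Fin n) ℝ} (ha : a.PosDef)
    (x y : Space n) :
    inner ℝ (Matrix.toEuclideanLin a⁻¹ x) y = inner ℝ x (Matrix.toEuclideanLin a⁻¹ y) :=
  Matrix.isSymmetric_toEuclideanLin_iff.2 ha.inv.isHermitian x y

theorem inner_toEuclideanLin_inv_toEuclideanLin {n : ℕ} {a : Matrix (Fin n) (Fin n) ℝ}
    (ha : a.PosDef) (x y : Space n) :
    inner ℝ (Matrix.toEuclideanLin a⁻¹ x) (Matrix.toEuclideanLin a y) = inner ℝ x y := by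
  rw [inner_toEuclideanLin_inv_comm ha, ← LinearMap.comp_apply, ← Matrix.toLpLin_mul_same,
    Matrix.nonsing_inv_mul _ (ha.isUnit.map Matrix.detMonoidHom)]
  simp

theorem fundSol_of_pos {n : ℕ} (a : Matrix (Fin n) (Fin n) ℝ) (x : Space n) {t : ℝ}
    (ht : 0 < t) : fundSol a x t = 1 / ((4 * Real.pi * t) ^ ((n : ℝ) / 2) * √a.det) *
      Real.exp (-(inner ℝ (Matrix.toEuclideanLin a⁻¹ x) x) / (4 * t)) := if_pos ht

theorem fundSol_of_nonpos {n : ℕ} (a : Matrix (Fin n) (Fin n) ℝ) (x : Space n) {t : ℝ}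
    (ht : t ≤ 0) : fundSol a x t = 0 := if_neg ht.not_gt

theorem fundSol_neg {n : ℕ} (a : Matrix (Fin n) (Fin n) ℝ) (x : Space n) (t : ℝ) :
    fundSol a (-x) t = fundSol a x t := by
  simp [fundSol]

theorem continuous_toEuclideanLin {n : ℕ} (a : Matrix (Fin n) (Fin n) ℝ) :
    Continuous (Matrix.toEuclideanLin a) := LinearMap.continuous_of_finiteDimensional _

theorem continuous_quadratic {n : ℕ} (a : Matrix (Fin n) (Fin n) ℝ) :
    Continuous fun x : Space n => (inner ℝ (Matrix.toEuclideanLin a x) x : ℝ) :=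
  (continuous_toEuclideanLin a).inner continuous_id

/-- The fundamental solution as a function on space-time. -/
noncomputable def heatKernel {n : ℕ} (a : Matrix (Fin n) (Fin n) ℝ) (z : Space n × ℝ) : ℝ :=
  fundSol a z.1 z.2

@[fun_prop]
theorem measurable_heatKernel {n : ℕ} (a : Matrix (Fin n) (Fin n) ℝ) :
    Measurable (heatKernel a) := by
  have h1 : Measurable fun z : Space n × ℝ =>
      (inner ℝ (Matrix.toEuclideanLin a⁻¹ z.1) z.1 : ℝ) :=
    (continuous_quadratic a⁻¹).measurable.comp measurable_fst
  unfold heatKernel fundSol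
  refine Measurable.ite (measurableSet_lt measurable_const measurable_snd) ?_ measurable_const
  fun_prop

theorem continuousAt_heatKernel {n : ℕ} {a : Matrix (Fin n) (Fin n) ℝ} (ha : a.PosDef)
    {z : Space n × ℝ} (hz : z.2 ≠ 0) : ContinuousAt (heatKernel a) z := by
  rcases hz.lt_or_gt with hz | hz
  · have h1 : heatKernel a =ᶠ[𝓝 z] fun _ => 0 := by
      filter_upwards [continuous_snd.continuousAt.eventually_lt continuousAt_const hz] with y hy
      exact fundSol_of_nonpos a _ hy.le
    exact (continuousAt_const (y := (0 : ℝ))).congr h1.symm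
  · have h1 : heatKernel a =ᶠ[𝓝 z] fun y => 1 / ((4 * Real.pi * y.2) ^ ((n : ℝ) / 2) * √a.det) *
        Real.exp (-(inner ℝ (Matrix.toEuclideanLin a⁻¹ y.1) y.1) / (4 * y.2)) := by
      filter_upwards [continuousAt_const.eventually_lt continuous_snd.continuousAt hz] with y hy
      exact fundSol_of_pos a _ hy
    refine ContinuousAt.congr ?_ h1.symm
    have h2 : ContinuousAt (fun z : Space n × ℝ =>
        (inner ℝ (Matrix.toEuclideanLin a⁻¹ z.1) z.1 : ℝ)) z :=
      ((continuous_quadratic a⁻¹).comp continuous_fst).continuousAt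
    have h3 : (4 * Real.pi * z.2) ^ ((n : ℝ) / 2) * √a.det ≠ 0 := by
      have := ha.det_pos
      positivity
    have h4 : ContinuousAt (fun y : Space n × ℝ => (4 * Real.pi * y.2) ^ ((n : ℝ) / 2)) z :=
      ContinuousAt.rpow_const (by fun_prop) (Or.inl (by positivity))
    exact (continuousAt_const.div (h4.mul continuousAt_const) h3).mul
      (Real.continuous_exp.continuousAt.comp (h2.neg.div (by fun_prop) (by positivity)))

/-- The spatial derivative of the fundamental solution in the direction `w`. -/
theorem hasFDerivAt_fundSol {n : ℕ} {a : Matrix (Fin n) (Fin n) ℝ} (ha : a.PosDef)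
    (x : Space n) (t : ℝ) :
    HasFDerivAt (fun x => fundSol a x t)
      ((-(2 * t)⁻¹ * fundSol a x t) • innerSL ℝ (Matrix.toEuclideanLin a⁻¹ x)) x := by
  rcases le_or_gt t 0 with ht | ht
  · have h1 : (fun x : Space n => fundSol a x t) = fun _ => 0 :=
      funext fun x => fundSol_of_nonpos a x ht
    rw [h1, fundSol_of_nonpos a x ht, mul_zero, zero_smul]
    exact hasFDerivAt_const _ _
  · have h1 : (fun x : Space n => fundSol a x t) = fun x =>
        1 / ((4 * Real.pi * t) ^ ((n : ℝ) / 2) * √a.det) *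
        Real.exp (-(inner ℝ (Matrix.toEuclideanLin a⁻¹ x) x) / (4 * t)) :=
      funext fun x => fundSol_of_pos a x ht
    have h2 : HasFDerivAt (fun x : Space n => (inner ℝ (Matrix.toEuclideanLin a⁻¹ x) x : ℝ))
        ((2 : ℝ) • innerSL ℝ (Matrix.toEuclideanLin a⁻¹ x)) x := by
      have h3 := ((Matrix.toEuclideanLin a⁻¹).toContinuousLinearMap.hasFDerivAt (x := x)).inner ℝ
        (hasFDerivAt_id x)
      convert! h3 using 1
      ext w
      simp [← inner_toEuclideanLin_inv_comm ha, two_mul, real_inner_comm w]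
    rw [h1, fundSol_of_pos a x ht]
    have h4 := ((h2.fun_neg.mul_const (4 * t)⁻¹).exp).const_mul
      (1 / ((4 * Real.pi * t) ^ ((n : ℝ) / 2) * √a.det))
    refine h4.congr_fderiv ?_
    ext w
    simp only [div_eq_mul_inv, _root_.smul_apply, smul_eq_mul,
      _root_.neg_apply]
    field_simp
    ring

theorem fderiv_fundSol {n : ℕ} {a : Matrix (Fin n) (Fin n) ℝ} (ha : a.PosDef)
    (x w : Space n) (t : ℝ) :
    fderiv ℝ (fun x => fundSol a x t) x w =
      -(inner ℝ (Matrix.toEuclideanLin a⁻¹ x) w) / (2 * t) * fundSol a x t := by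
  rw [(hasFDerivAt_fundSol ha x t).fderiv]
  simp
  ring

theorem differentiable_fundSol {n : ℕ} {a : Matrix (Fin n) (Fin n) ℝ} (ha : a.PosDef) (t : ℝ) :
    Differentiable ℝ (fun x : Space n => fundSol a x t) :=
  fun x => (hasFDerivAt_fundSol ha x t).differentiableAt

/-- The kernel of the double layer potential. -/
noncomputable def conormalKernel {n : ℕ} (a : Matrix (Fin n) (Fin n) ℝ) (ν : Space n)
    (z : Space n × ℝ) : ℝ :=
  inner ℝ z.1 ν / (2 * z.2) * heatKernel a z

/-- The gradient of `G` carries `a⁻¹` and the conormal carries `a`. They cancel, which leaves the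
scalar factor `⟨x, ν⟩ / (2t)`. -/
theorem fderiv_fundSol_conormal {n : ℕ} {a : Matrix (Fin n) (Fin n) ℝ} (ha : a.PosDef)
    (ν : Space n) (z : Space n × ℝ) :
    fderiv ℝ (fun x => fundSol a x z.2) z.1 (Matrix.toEuclideanLin a ν) =
      -conormalKernel a ν z := by
  rw [fderiv_fundSol ha, inner_toEuclideanLin_inv_toEuclideanLin ha, conormalKernel, heatKernel]
  ring

/-- Differentiation in the source variable reverses the sign. -/
theorem conormalDeriv_fundSol {n : ℕ} {a : Matrix (Fin n) (Fin n) ℝ} (ha : a.PosDef)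
    (Ω : Set (Space n)) (z q : Space n × ℝ) :
    conormalDeriv a Ω (fun r => fundSol a (z.1 - r.1) (z.2 - r.2)) q =
      conormalKernel a (innerNormal Ω q.1) (z - q) := by
  unfold conormalDeriv conormal
  have h1 : HasFDerivAt (fun x : Space n => z.1 - x) (-ContinuousLinearMap.id ℝ (Space n)) q.1 :=
    (hasFDerivAt_id q.1).const_sub z.1
  have h2 := (hasFDerivAt_fundSol ha (z.1 - q.1) (z.2 - q.2)).comp q.1 h1
  have h3 := fderiv_fundSol_conormal ha (innerNormal Ω q.1) (z - q)
  rw [Prod.fst_sub, Prod.snd_sub, (hasFDerivAt_fundSol ha _ _).fderiv] at h3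
  have h4 := h2.fderiv
  simp only [Function.comp_def] at h4
  simp only
  rw [h4]
  simp only [ContinuousLinearMap.comp_apply, _root_.neg_apply, map_neg,
    ContinuousLinearMap.id_apply, h3, neg_neg]

/-- Raise `x / k ≤ exp (x / k)` to the power `k`. -/
theorem exp_neg_le_rpow {k x : ℝ} (hk : 0 < k) (hx : 0 < x) :
    Real.exp (-x) ≤ k ^ k * x ^ (-k) := by
  have h1 : x / k ≤ Real.exp (x / k) := by linarith [Real.add_one_le_exp (x / k)]
  have h2 := Real.rpow_le_rpow (by positivity) h1 hk.le
  rw [← Real.exp_mul, div_mul_cancel₀ _ hk.ne', Real.div_rpow hx.le hk.le] at h2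
  rw [Real.exp_neg, Real.rpow_neg hx.le, inv_eq_one_div, ← div_eq_mul_inv,
    div_le_div_iff₀ (Real.exp_pos _) (by positivity), one_mul]
  rwa [div_le_iff₀ (by positivity), mul_comm] at h2

/-- Gaussian decay is traded for powers: `exp (-c|x|²/4t)` is at most a constant times `(t / |x|²) ^
k`, with `k` chosen to leave `t ^ (-α)`. The value `j = 1` accounts for the extra `1/t` of the
conormal kernel; negative `α` is allowed and gives decay as `t → 0` away from `x = 0`. -/
theorem exists_fundSol_le {n : ℕ} {a : Matrix (Fin n) (Fin n) ℝ} (ha : a.PosDef)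
    {α j : ℝ} (hα : α < n / 2 + j) :
    ∃ C : ℝ, 0 ≤ C ∧ ∀ x : Space n, x ≠ 0 → ∀ t : ℝ, 0 < t →
      t ^ (-j) * fundSol a x t ≤ C * (t ^ (-α) * ‖x‖ ^ (-(n + 2 * j - 2 * α))) := by
  obtain ⟨c, hc, hle⟩ := exists_le_quadratic ha
  have hdet := ha.det_pos
  set k := n / 2 + j - α with hk
  have hk0 : 0 < k := by linarith
  refine ⟨1 / ((4 * Real.pi) ^ ((n : ℝ) / 2) * √a.det) * (k ^ k * (c / 4) ^ (-k)),
    by positivity, fun x hx t ht => ?_⟩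
  have hx0 : 0 < ‖x‖ := norm_pos_iff.2 hx
  rw [fundSol_of_pos a x ht]
  have h1 : Real.exp (-(inner ℝ (Matrix.toEuclideanLin a⁻¹ x) x) / (4 * t)) ≤
      k ^ k * ((c / 4) ^ (-k) * t ^ k * ‖x‖ ^ (-(2 * k))) := by
    calc _ ≤ Real.exp (-(c / 4 * t⁻¹ * ‖x‖ ^ 2)) := by
          rw [Real.exp_le_exp, neg_div, neg_le_neg_iff, le_div_iff₀ (by positivity)]
          refine le_trans (le_of_eq ?_) (hle x)
          field_simp
      _ ≤ k ^ k * (c / 4 * t⁻¹ * ‖x‖ ^ 2) ^ (-k) := exp_neg_le_rpow hk0 (by positivity)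
      _ = _ := by
          rw [Real.mul_rpow (by positivity) (by positivity),
            Real.mul_rpow (by positivity) (by positivity), Real.inv_rpow ht.le,
            Real.rpow_neg ht.le, inv_inv, ← Real.rpow_natCast ‖x‖ 2, ← Real.rpow_mul hx0.le]
          congr 3
          push_cast
          ring
  calc _ ≤ t ^ (-j) * (1 / ((4 * Real.pi * t) ^ ((n : ℝ) / 2) * √a.det) *
        (k ^ k * ((c / 4) ^ (-k) * t ^ k * ‖x‖ ^ (-(2 * k))))) := by gcongr
    _ = _ := by
      rw [show -α = k + -(n / 2) + -j by rw [hk]; ring, Real.rpow_add ht, Real.rpow_add ht,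
        Real.mul_rpow (by positivity) ht.le, Real.rpow_neg ht.le (n / 2),
        show (n : ℝ) + 2 * j - 2 * α = 2 * k by rw [hk]; ring]
      ring

theorem powerKernel_of_pos {n : ℕ} (α s : ℝ) {x : Space n} {t : ℝ} (hx : x ≠ 0) (ht : 0 < t) :
    powerKernel α s (x, t) = ENNReal.ofReal (t ^ (-α) * ‖x‖ ^ (-s)) := by
  rw [ENNReal.ofReal_mul (by positivity), ← ENNReal.ofReal_rpow_of_pos ht,
    ← ENNReal.ofReal_rpow_of_pos (norm_pos_iff.2 hx), ofReal_norm, ENNReal.rpow_neg,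
    ENNReal.rpow_neg, ← ENNReal.inv_rpow, ← ENNReal.inv_rpow, powerKernel,
    Real.enorm_of_nonneg ht.le]

theorem fundSol_nonneg {n : ℕ} (a : Matrix (Fin n) (Fin n) ℝ) (x : Space n) (t : ℝ) :
    0 ≤ fundSol a x t := by
  unfold fundSol
  split_ifs <;> positivity

theorem exists_heatKernel_le {n : ℕ} {a : Matrix (Fin n) (Fin n) ℝ} (ha : a.PosDef)
    {α : ℝ} (hα : α < n / 2) : ∃ C : ℝ≥0∞, C ≠ ⊤ ∧ ∀ z : Space n × ℝ,
      ‖heatKernel a z‖ₑ ≤ C * powerKernel α (n - 2 * α) z := by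
  obtain ⟨C, hC, h⟩ := exists_fundSol_le ha (α := α) (j := 0) (by linarith)
  -- The constant must be nonzero: at `x = 0` the power kernel is `⊤`, and `0 * ⊤ = 0` would not
  -- bound `G`. The conormal kernel vanishes at `x = 0` and needs no such correction.
  refine ⟨ENNReal.ofReal (C + 1), ENNReal.ofReal_ne_top, fun ⟨x, t⟩ => ?_⟩
  rcases le_or_gt t 0 with ht | ht
  · simp [heatKernel, fundSol_of_nonpos a x ht]
  rcases eq_or_ne x 0 with rfl | hx
  · have h1 : ENNReal.ofReal (C + 1) ≠ 0 := by simp; linarith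
    have h2 : (‖t‖ₑ⁻¹) ^ α ≠ 0 := by
      rw [ENNReal.inv_rpow]
      exact ENNReal.inv_ne_zero.2 (ENNReal.rpow_ne_top_of_ne_zero (by simp [ht.ne']) (by simp))
    have h3 : powerKernel α (n - 2 * α) ((0 : Space n), t) = ⊤ := by
      rw [powerKernel, enorm_zero, ENNReal.inv_zero, ENNReal.top_rpow_of_pos (by linarith),
        ENNReal.mul_top h2]
    rw [h3, ENNReal.mul_top h1]
    exact le_top
  · rw [powerKernel_of_pos _ _ hx ht, ← ENNReal.ofReal_mul (by linarith), heatKernel,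
      Real.enorm_of_nonneg (fundSol_nonneg a _ _)]
    refine ENNReal.ofReal_le_ofReal ?_
    have h1 := h x hx t ht
    rw [neg_zero, Real.rpow_zero, one_mul, mul_zero, add_zero] at h1
    refine h1.trans ?_
    gcongr
    linarith

theorem exists_conormalKernel_le {n : ℕ} {a : Matrix (Fin n) (Fin n) ℝ} (ha : a.PosDef)
    {α : ℝ} (hα : α < n / 2 + 1) : ∃ C : ℝ≥0∞, C ≠ ⊤ ∧ ∀ (ν : Space n) (z : Space n × ℝ),
      ‖conormalKernel a ν z‖ₑ ≤ C * ‖ν‖ₑ * powerKernel α (n + 1 - 2 * α) z := by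
  obtain ⟨C, hC, h⟩ := exists_fundSol_le ha (α := α) (j := 1) (by linarith)
  refine ⟨ENNReal.ofReal C, ENNReal.ofReal_ne_top, fun ν ⟨x, t⟩ => ?_⟩
  rcases le_or_gt t 0 with ht | ht
  · simp [conormalKernel, heatKernel, fundSol_of_nonpos a x ht]
  rcases eq_or_ne x 0 with rfl | hx
  · simp [conormalKernel]
  · rw [powerKernel_of_pos _ _ hx ht, ← ofReal_norm ν, ← ENNReal.ofReal_mul (by linarith),
      ← ENNReal.ofReal_mul (by positivity), ← ofReal_norm]
    refine ENNReal.ofReal_le_ofReal ?_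
    have hx0 : 0 < ‖x‖ := norm_pos_iff.2 hx
    have hG := fundSol_nonneg a x t
    have h1 := h x hx t ht
    rw [Real.rpow_neg_one] at h1
    have h2 := abs_real_inner_le_norm x ν
    rw [conormalKernel, heatKernel, norm_mul, norm_div, Real.norm_eq_abs, Real.norm_eq_abs,
      Real.norm_eq_abs, abs_of_nonneg hG, abs_of_pos (by linarith : 0 < 2 * t)]
    calc _ ≤ (‖x‖ * ‖ν‖) / t * fundSol a x t := by
          gcongr
          linarith
      _ = ‖x‖ * ‖ν‖ * (t⁻¹ * fundSol a x t) := by ring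
      _ ≤ ‖x‖ * ‖ν‖ * (C * (t ^ (-α) * ‖x‖ ^ (-(n + 2 * 1 - 2 * α)))) := by gcongr
      _ = _ := by
          rw [show -((n : ℝ) + 1 - 2 * α) = -(n + 2 * 1 - 2 * α) + 1 by ring,
            Real.rpow_add_one hx0.ne']
          ring

theorem locallyIntegrable_of_le_powerKernel {n : ℕ} {f : Space n × ℝ → ℝ} (hf : Measurable f)
    {α s : ℝ} (hα : 0 ≤ α) (hα' : α < 1) (hs : 0 ≤ s) (hs' : s < n) {C : ℝ≥0∞} (hC : C ≠ ⊤)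
    (h : ∀ z, ‖f z‖ₑ ≤ C * powerKernel α s z) : LocallyIntegrable f := by
  refine (locallyIntegrable_iff).2 fun k hk => ?_
  obtain ⟨R, hR⟩ := hk.isBounded.subset_closedBall 0
  obtain ⟨M, hM, h1⟩ := exists_lintegral_powerKernel_le (n := n) hα hα' hs hs' R
  refine IntegrableOn.mono_set ⟨hf.aestronglyMeasurable, ?_⟩ hR
  rw [hasFiniteIntegral_iff_enorm]
  calc _ ≤ ∫⁻ z in Metric.closedBall (0 : Space n × ℝ) R, C * powerKernel α s z :=
        lintegral_mono h
    _ = C * ∫⁻ z in Metric.closedBall (0 : Space n × ℝ) R, powerKernel α s (z - 0) := by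
        rw [lintegral_const_mul' _ _ hC]
        simp
    _ < ⊤ := ENNReal.mul_lt_top hC.lt_top ((h1 0).trans_lt hM.lt_top)

/-- The fundamental solution is locally integrable. -/
theorem locallyIntegrable_heatKernel {n : ℕ} (hn : 3 ≤ n) {a : Matrix (Fin n) (Fin n) ℝ}
    (ha : a.PosDef) : LocallyIntegrable (heatKernel a) := by
  have hn3 : (3 : ℝ) ≤ n := by exact_mod_cast hn
  obtain ⟨C, hC, h⟩ := exists_heatKernel_le ha (α := 1 / 2) (by linarith)
  exact locallyIntegrable_of_le_powerKernel (measurable_heatKernel a) (by norm_num)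
    (by norm_num) (by linarith) (by linarith) hC h

theorem measurable_conormalKernel {n : ℕ} (a : Matrix (Fin n) (Fin n) ℝ) :
    Measurable (fun p : Space n × (Space n × ℝ) => conormalKernel a p.1 p.2) := by
  have h1 : Measurable fun p : Space n × (Space n × ℝ) => (inner ℝ p.2.1 p.1 : ℝ) :=
    (measurable_fst.comp measurable_snd).inner measurable_fst
  have h2 : Measurable fun p : Space n × (Space n × ℝ) => 2 * p.2.2 :=
    (measurable_snd.comp measurable_snd).const_mul 2
  exact (h1.div h2).mul ((measurable_heatKernel a).comp measurable_snd)

theorem locallyIntegrable_conormalKernel {n : ℕ} (hn : 3 ≤ n) {a : Matrix (Fin n) (Fin n) ℝ}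
    (ha : a.PosDef) (ν : Space n) : LocallyIntegrable (conormalKernel a ν) := by
  have hn3 : (3 : ℝ) ≤ n := by exact_mod_cast hn
  -- The space exponent becomes `n + 1 - 3/2 = n - 1/2`, below `n`, while the time exponent stays
  -- below 1.
  obtain ⟨C, hC, h⟩ := exists_conormalKernel_le ha (α := 3 / 4) (by linarith)
  have hm : Measurable fun z => conormalKernel a ν z :=
    (measurable_conormalKernel a).comp
      (g := fun p : Space n × (Space n × ℝ) => conormalKernel a p.1 p.2) (f := fun z => (ν, z))
      (measurable_const.prodMk measurable_id)
  exact locallyIntegrable_of_le_powerKernel hm (by norm_num)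
    (by norm_num) (by linarith) (by linarith) (ENNReal.mul_ne_top hC enorm_ne_top) (h ν)

/-! ### The differential operators as iterated directional derivatives on space-time. -/

instance isAddHaarMeasure_volume_spaceTime {n : ℕ} :
    (volume : Measure (Space n × ℝ)).IsAddHaarMeasure := by
  rw [Measure.volume_eq_prod]
  infer_instance

/-- The directional derivative of a function on space-time. -/
noncomputable def dirDeriv {n : ℕ} (w : Space n × ℝ) (v : Space n × ℝ → ℝ) (z : Space n × ℝ) :
    ℝ := fderiv ℝ v z w

theorem contDiff_dirDeriv {n : ℕ} {v : Space n × ℝ → ℝ} (hv : ContDiff ℝ ∞ v)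
    (w : Space n × ℝ) : ContDiff ℝ ∞ (dirDeriv w v) :=
  (hv.fderiv_right (m := ∞) (by simp)).clm_apply contDiff_const

theorem hasCompactSupport_dirDeriv {n : ℕ} {v : Space n × ℝ → ℝ} (hv : HasCompactSupport v)
    (w : Space n × ℝ) : HasCompactSupport (dirDeriv w v) :=
  hv.fderiv_apply ℝ w

theorem fderiv_slice {n : ℕ} {v : Space n × ℝ → ℝ} {z : Space n × ℝ}
    (hv : DifferentiableAt ℝ v z) (w : Space n) :
    fderiv ℝ (fun x => v (x, z.2)) z.1 w = fderiv ℝ v z (w, 0) := by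
  have h1 : HasFDerivAt (fun x : Space n => (x, z.2))
      (ContinuousLinearMap.inl ℝ (Space n) ℝ) z.1 := hasFDerivAt_prodMk_left z.1 z.2
  have h2 := HasFDerivAt.comp z.1 (g := v) (f := fun x : Space n => (x, z.2))
    (hv.hasFDerivAt) h1
  have h3 : fderiv ℝ (fun x => v (x, z.2)) z.1 = _ := h2.fderiv
  rw [h3]
  simp

theorem partialX_eq {n : ℕ} {v : Space n × ℝ → ℝ} (hv : ContDiff ℝ ∞ v) (k : Fin n) :
    partialX k v = dirDeriv (EuclideanSpace.single k 1, 0) v :=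
  funext fun z => fderiv_slice (hv.differentiable (by simp) z) _

theorem partialT_eq {n : ℕ} {v : Space n × ℝ → ℝ} (hv : ContDiff ℝ ∞ v) :
    partialT v = dirDeriv (0, 1) v := by
  funext z
  have h1 : HasDerivAt (fun t : ℝ => (z.1, t)) ((0 : Space n), (1 : ℝ)) z.2 :=
    (hasDerivAt_const z.2 z.1).prodMk (hasDerivAt_id z.2)
  have h2 : HasFDerivAt v (fderiv ℝ v z) (z.1, z.2) :=
    (hv.differentiable (by simp) z).hasFDerivAt
  exact (h2.comp_hasDerivAt z.2 h1).deriv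

theorem conormalDeriv_eq {n : ℕ} {v : Space n × ℝ → ℝ} (hv : ContDiff ℝ ∞ v)
    (a : Matrix (Fin n) (Fin n) ℝ) (Ω : Set (Space n)) (q : Space n × ℝ) :
    conormalDeriv a Ω v q = dirDeriv (conormal a Ω q.1, 0) v q :=
  fderiv_slice (hv.differentiable (by simp) q) _

theorem opHstar_eq {n : ℕ} (a : Matrix (Fin n) (Fin n) ℝ) {v : Space n × ℝ → ℝ}
    (hv : ContDiff ℝ ∞ v) (z : Space n × ℝ) :
    opHstar a v z = ∑ h, ∑ k, a h k * dirDeriv (EuclideanSpace.single h 1, 0)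
      (dirDeriv (EuclideanSpace.single k 1, 0) v) z + dirDeriv (0, 1) v z := by
  rw [opHstar, partialT_eq hv, ellipticOp]
  simp only [partialX_eq hv, fun k => partialX_eq (contDiff_dirDeriv hv (EuclideanSpace.single k 1, 0))]

theorem contDiff_opHstar {n : ℕ} (a : Matrix (Fin n) (Fin n) ℝ) {v : Space n × ℝ → ℝ}
    (hv : ContDiff ℝ ∞ v) : ContDiff ℝ ∞ (opHstar a v) := by
  rw [funext (opHstar_eq a hv)]
  refine (ContDiff.sum fun h _ => ContDiff.sum fun k _ => ?_).add (contDiff_dirDeriv hv _)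
  exact contDiff_const.mul (contDiff_dirDeriv (contDiff_dirDeriv hv _) _)

theorem opHstar_eq_zero_of_notMem_tsupport {n : ℕ} (a : Matrix (Fin n) (Fin n) ℝ)
    {v : Space n × ℝ → ℝ} (hv : ContDiff ℝ ∞ v) {z : Space n × ℝ} (hz : z ∉ tsupport v) :
    opHstar a v z = 0 := by
  have h0 : ∀ (u : Space n × ℝ → ℝ) (w), tsupport (dirDeriv w u) ⊆ tsupport u :=
    fun u w => tsupport_fderiv_apply_subset ℝ w
  rw [opHstar_eq a hv, image_eq_zero_of_notMem_tsupport (fun h => hz (h0 _ _ h)), add_zero]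
  refine Finset.sum_eq_zero fun h _ => Finset.sum_eq_zero fun k _ => ?_
  rw [image_eq_zero_of_notMem_tsupport (fun h => hz (h0 _ _ (h0 _ _ h))), mul_zero]

theorem hasCompactSupport_opHstar {n : ℕ} (a : Matrix (Fin n) (Fin n) ℝ)
    {v : Space n × ℝ → ℝ} (hv : ContDiff ℝ ∞ v) (hc : HasCompactSupport v) :
    HasCompactSupport (opHstar a v) :=
  HasCompactSupport.intro hc fun _ hz => opHstar_eq_zero_of_notMem_tsupport a hv hz

/-! ### Heat potentials of test functions. -/

/-- The (adjoint) heat potential of a function on space-time. -/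
noncomputable def heatPotential {n : ℕ} (a : Matrix (Fin n) (Fin n) ℝ) (ψ : Space n × ℝ → ℝ)
    (q : Space n × ℝ) : ℝ := ∫ ζ, heatKernel a ζ * ψ (q + ζ)

section

variable {n : ℕ} (hn : 3 ≤ n) {a : Matrix (Fin n) (Fin n) ℝ} (ha : a.PosDef)
  {ψ : Space n × ℝ → ℝ}

theorem hasCompactSupport_comp_add_left (hc : HasCompactSupport ψ) (q : Space n × ℝ) :
    HasCompactSupport fun ζ => ψ (q + ζ) :=
  hc.comp_homeomorph (Homeomorph.addLeft q)

theorem integrable_mul_comp_add {f : Space n × ℝ → ℝ} (hf : LocallyIntegrable f)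
    (hψ : Continuous ψ) (hc : HasCompactSupport ψ) (q : Space n × ℝ) :
    Integrable fun ζ => f ζ * ψ (q + ζ) :=
  hf.integrable_smul_right_of_hasCompactSupport (hψ.comp (continuous_const.add continuous_id))
    (hasCompactSupport_comp_add_left hc q)

/-- In this form the kernel is `G (z - q)`, the one in the Stokes potential, but integrated over the
target `z` instead of the source `q`. -/
theorem heatPotential_eq_integral (a : Matrix (Fin n) (Fin n) ℝ) (ψ : Space n × ℝ → ℝ)
    (q : Space n × ℝ) : heatPotential a ψ q = ∫ z, ψ z * heatKernel a (z - q) := by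
  rw [heatPotential, ← integral_sub_right_eq_self _ q]
  simp only [add_sub_cancel, mul_comm]

/-- Convolution with the reflected kernel: all derivatives can fall on `ψ`, so local integrability
of the kernel suffices for smoothness. -/
theorem heatPotential_eq_convolution (a : Matrix (Fin n) (Fin n) ℝ) (ψ : Space n × ℝ → ℝ) :
    heatPotential a ψ =
      convolution (fun ζ => heatKernel a (-ζ)) ψ (ContinuousLinearMap.mul ℝ ℝ) volume := by
  funext q
  rw [heatPotential, convolution, ← integral_neg_eq_self]
  simp [sub_eq_add_neg]

include hn ha

theorem locallyIntegrable_heatKernel_neg : LocallyIntegrable fun ζ => heatKernel a (-ζ) := by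
  have hn3 : (3 : ℝ) ≤ n := by exact_mod_cast hn
  obtain ⟨C, hC, h⟩ := exists_heatKernel_le ha (α := 1 / 2) (by linarith)
  exact locallyIntegrable_of_le_powerKernel (α := 1 / 2) (s := n - 2 * (1 / 2))
    ((measurable_heatKernel a).comp measurable_neg)
    (by norm_num) (by norm_num) (by linarith) (by linarith) hC
    fun z => (h (-z)).trans_eq (by rw [powerKernel_neg])

theorem contDiff_heatPotential (hψ : ContDiff ℝ ∞ ψ) (hc : HasCompactSupport ψ) :
    ContDiff ℝ ∞ (heatPotential a ψ) := by
  rw [heatPotential_eq_convolution]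
  exact hc.contDiff_convolution_right _ (locallyIntegrable_heatKernel_neg hn ha) hψ

theorem dirDeriv_heatPotential (hψ : ContDiff ℝ ∞ ψ) (hc : HasCompactSupport ψ)
    (w : Space n × ℝ) :
    dirDeriv w (heatPotential a ψ) = heatPotential a (dirDeriv w ψ) := by
  funext q
  have hl := locallyIntegrable_heatKernel_neg hn ha
  have h1 := hc.hasFDerivAt_convolution_right (ContinuousLinearMap.mul ℝ ℝ) hl
    (hψ.of_le (by simp)) q
  rw [heatPotential_eq_convolution a (dirDeriv w ψ), dirDeriv,
    heatPotential_eq_convolution, h1.fderiv, convolution, convolution,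
    ContinuousLinearMap.integral_apply]
  · rfl
  · exact (hc.fderiv ℝ).convolutionExists_right _ hl (hψ.continuous_fderiv (by simp)) q

/-- Convolution commutes with an operator of constant coefficients. -/
theorem opHstar_heatPotential (hψ : ContDiff ℝ ∞ ψ) (hc : HasCompactSupport ψ)
    (q : Space n × ℝ) :
    opHstar a (heatPotential a ψ) q = heatPotential a (opHstar a ψ) q := by
  have hl := locallyIntegrable_heatKernel hn ha
  rw [opHstar_eq a (contDiff_heatPotential hn ha hψ hc)]
  have h1 : ∀ h k : Fin n, dirDeriv (EuclideanSpace.single h 1, 0)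
      (dirDeriv (EuclideanSpace.single k 1, 0) (heatPotential a ψ)) =
      heatPotential a (dirDeriv (EuclideanSpace.single h 1, 0)
        (dirDeriv (EuclideanSpace.single k 1, 0) ψ)) := fun h k => by
    rw [dirDeriv_heatPotential hn ha hψ hc, dirDeriv_heatPotential hn ha (contDiff_dirDeriv hψ _)
      (hasCompactSupport_dirDeriv hc _)]
  simp only [h1]
  rw [dirDeriv_heatPotential hn ha hψ hc]
  have hi : ∀ (w : Space n × ℝ) {φ : Space n × ℝ → ℝ}, ContDiff ℝ ∞ φ → HasCompactSupport φ →
      Integrable fun ζ => heatKernel a ζ * dirDeriv w φ (q + ζ) := fun w φ hφ hcφ =>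
    integrable_mul_comp_add hl (contDiff_dirDeriv hφ w).continuous (hasCompactSupport_dirDeriv hcφ w) q
  have hi2 : ∀ h k : Fin n, Integrable fun ζ => a h k * (heatKernel a ζ *
      dirDeriv (EuclideanSpace.single h 1, 0)
        (dirDeriv (EuclideanSpace.single k 1, 0) ψ) (q + ζ)) := fun h k =>
    (hi _ (contDiff_dirDeriv hψ _) (hasCompactSupport_dirDeriv hc _)).const_mul _
  simp only [heatPotential, opHstar_eq a hψ, mul_add, Finset.mul_sum, mul_left_comm _ (a _ _)]
  rw [integral_add (integrable_finsetSum _ fun h _ => integrable_finsetSum _ fun k _ =>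
    hi2 h k) (hi _ hψ hc), integral_finsetSum _ fun h _ => integrable_finsetSum _ fun k _ =>
    hi2 h k]
  congr 1
  refine Finset.sum_congr rfl fun h _ => ?_
  rw [integral_finsetSum _ fun k _ => hi2 h k]
  simp only [integral_const_mul]

/-- The conormal derivative of a heat potential, by integration by parts in the space variable. -/
theorem conormalDeriv_heatPotential (hψ : ContDiff ℝ ∞ ψ) (hc : HasCompactSupport ψ)
    (Ω : Set (Space n)) (q : Space n × ℝ) :
    conormalDeriv a Ω (heatPotential a ψ) q =
      ∫ z, ψ z * conormalKernel a (innerNormal Ω q.1) (z - q) := by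
  set ν := innerNormal Ω q.1 with hν
  rw [conormalDeriv_eq (contDiff_heatPotential hn ha hψ hc), dirDeriv_heatPotential hn ha hψ hc,
    ← integral_add_right_eq_self _ q, heatPotential]
  simp only [add_sub_cancel_right]
  simp only [add_comm _ q]
  have hi1 := integrable_mul_comp_add (locallyIntegrable_heatKernel hn ha)
    (contDiff_dirDeriv hψ (conormal a Ω q.1, 0)).continuous (hasCompactSupport_dirDeriv hc _) q
  have hi2 := integrable_mul_comp_add (locallyIntegrable_conormalKernel hn ha ν)
    hψ.continuous hc q
  simp only [mul_comm (ψ _)]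
  rw [Measure.volume_eq_prod] at hi1 hi2 ⊢
  -- Slicing at fixed time avoids the space-time singularity: on each slice `G` is differentiable in
  -- `x` (identically zero for `τ ≤ 0`), so the integration by parts has no boundary contribution.
  rw [integral_prod_symm _ hi1, integral_prod_symm _ hi2]
  refine integral_congr_ae (ae_of_all _ fun τ => ?_)
  simp only
  have hdiff := differentiable_fundSol ha τ
  have hψd : Differentiable ℝ fun ξ : Space n => ψ (q + (ξ, τ)) :=
    (hψ.differentiable (by simp)).comp (by fun_prop)
  have hfd : ∀ ξ : Space n, fderiv ℝ (fun ξ : Space n => ψ (q + (ξ, τ))) ξ (conormal a Ω q.1) =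
      dirDeriv (conormal a Ω q.1, 0) ψ (q + (ξ, τ)) := fun ξ => by
    have h1 : HasFDerivAt (fun ξ : Space n => q + (ξ, τ))
        (ContinuousLinearMap.inl ℝ (Space n) ℝ) ξ := (hasFDerivAt_prodMk_left ξ τ).const_add q
    have h2 := HasFDerivAt.comp ξ ((hψ.differentiable (by simp)) (q + (ξ, τ))).hasFDerivAt h1
    rw [show (fun ξ : Space n => ψ (q + (ξ, τ))) = ψ ∘ fun ξ => q + (ξ, τ) from rfl, h2.fderiv]
    simp [dirDeriv]
  have hfk : ∀ ξ : Space n, fderiv ℝ (fun ξ => fundSol a ξ τ) ξ (conormal a Ω q.1) =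
      -conormalKernel a ν (ξ, τ) := fun ξ => fderiv_fundSol_conormal ha ν (ξ, τ)
  have hcs : HasCompactSupport fun ξ : Space n => ψ (q + (ξ, τ)) := by
    have h1 : IsCompact (Prod.fst '' tsupport fun ζ => ψ (q + ζ)) :=
      (hasCompactSupport_comp_add_left hc q).image continuous_fst
    refine HasCompactSupport.intro h1 fun ξ hξ => ?_
    by_contra h
    exact hξ ⟨(ξ, τ), subset_tsupport _ h, rfl⟩
  have hck : Continuous fun ξ : Space n => conormalKernel a ν (ξ, τ) := by
    have h1 : Continuous fun ξ : Space n => (inner ℝ ξ ν : ℝ) :=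
      continuous_id.inner continuous_const
    exact (h1.div_const (2 * τ)).mul hdiff.continuous
  have hcd : Continuous fun ξ : Space n => dirDeriv (conormal a Ω q.1, 0) ψ (q + (ξ, τ)) :=
    (contDiff_dirDeriv hψ _).continuous.comp (by fun_prop)
  have hcsd : HasCompactSupport fun ξ : Space n =>
      dirDeriv (conormal a Ω q.1, 0) ψ (q + (ξ, τ)) := by
    simp only [← hfd]
    exact hcs.fderiv_apply ℝ _
  have key := integral_mul_fderiv_eq_neg_fderiv_mul_of_integrable (μ := (volume : Measure (Space n)))
    (f := fun ξ => fundSol a ξ τ) (g := fun ξ => ψ (q + (ξ, τ))) (v := conormal a Ω q.1) ?_ ?_ ?_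
    (fun ξ _ => hdiff ξ) (fun ξ _ => hψd ξ)
  · simp only [hfd, hfk, neg_mul, integral_neg, neg_neg] at key
    exact key
  · simp only [hfk]
    exact (hck.neg.mul hψd.continuous).integrable_of_hasCompactSupport hcs.mul_left
  · simp only [hfd]
    exact (hdiff.continuous.mul hcd).integrable_of_hasCompactSupport hcsd.mul_left
  · exact (hdiff.continuous.mul hψd.continuous).integrable_of_hasCompactSupport hcs.mul_left

end

/-! ### Gaussian means, and `G` as a fundamental solution. -/

/-- The known value of the integral is positive, while a non-integrable function has integral `0` by
convention. -/
theorem integrable_exp_neg_mul_sq_norm {n : ℕ} {b : ℝ} (hb : 0 < b) :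
    Integrable fun ξ : Space n => Real.exp (-b * ‖ξ‖ ^ 2) := by
  by_contra h
  have h1 := GaussianFourier.integral_rexp_neg_mul_sq_norm (V := Space n) hb
  rw [integral_undef h] at h1
  have h2 : 0 < (Real.pi / b) ^ ((Module.finrank ℝ (Space n) : ℝ) / 2) := by positivity
  linarith

section

variable {n : ℕ} {a : Matrix (Fin n) (Fin n) ℝ} (ha : a.PosDef)
include ha

theorem fundSol_one_le_exp : ∃ b C : ℝ, 0 < b ∧ 0 ≤ C ∧ ∀ ξ : Space n,
    fundSol a ξ 1 ≤ C * Real.exp (-b * ‖ξ‖ ^ 2) := by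
  obtain ⟨c, hc, h⟩ := exists_le_quadratic ha
  refine ⟨c / 4, 1 / ((4 * Real.pi * 1) ^ ((n : ℝ) / 2) * √a.det), by positivity, by positivity,
    fun ξ => ?_⟩
  rw [fundSol_of_pos a ξ one_pos]
  gcongr
  have := h ξ
  linarith

theorem integrable_fundSol_one : Integrable fun ξ : Space n => fundSol a ξ 1 := by
  obtain ⟨b, C, hb, hC, h⟩ := fundSol_one_le_exp ha
  have h1 := (integrable_exp_neg_mul_sq_norm (n := n) hb).const_mul C
  refine h1.mono' (differentiable_fundSol ha 1).continuous.aestronglyMeasurable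
    (ae_of_all _ fun ξ => ?_)
  rw [Real.norm_of_nonneg (fundSol_nonneg a ξ 1)]
  exact h ξ

theorem integrable_norm_mul_fundSol_one :
    Integrable fun ξ : Space n => ‖ξ‖ * fundSol a ξ 1 := by
  obtain ⟨b, C, hb, hC, h⟩ := fundSol_one_le_exp ha
  have h1 := (integrable_exp_neg_mul_sq_norm (n := n)
    (half_pos hb)).const_mul ((1 + 2 / b) * C)
  refine h1.mono' (continuous_norm.mul
    (differentiable_fundSol ha 1).continuous).aestronglyMeasurable (ae_of_all _ fun ξ => ?_)
  rw [norm_mul, norm_norm, Real.norm_of_nonneg (fundSol_nonneg a ξ 1)]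
  -- The linear factor is absorbed at the cost of half of the Gaussian exponent.
  have h2 : ‖ξ‖ ≤ (1 + 2 / b) * Real.exp (b / 2 * ‖ξ‖ ^ 2) := by
    have h3 := Real.add_one_le_exp (b / 2 * ‖ξ‖ ^ 2)
    have h4 : (1 + 2 / b) * (b / 2 * ‖ξ‖ ^ 2 + 1) =
        b / 2 * ‖ξ‖ ^ 2 + 1 + ‖ξ‖ ^ 2 + 2 / b := by
      field_simp
      ring
    have h5 : 0 ≤ b / 2 * ‖ξ‖ ^ 2 := by positivity
    have h6 : 0 ≤ 2 / b := by positivity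
    calc ‖ξ‖ ≤ (1 + 2 / b) * (b / 2 * ‖ξ‖ ^ 2 + 1) := by
          rw [h4]; nlinarith [sq_nonneg (‖ξ‖ - 1)]
      _ ≤ _ := by gcongr
  calc _ ≤ (1 + 2 / b) * Real.exp (b / 2 * ‖ξ‖ ^ 2) * (C * Real.exp (-b * ‖ξ‖ ^ 2)) := by
        gcongr
        · exact fundSol_nonneg a ξ 1
        · exact h ξ
    _ = (1 + 2 / b) * C * (Real.exp (b / 2 * ‖ξ‖ ^ 2) * Real.exp (-b * ‖ξ‖ ^ 2)) := by ring
    _ = _ := by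
        rw [← Real.exp_add]
        congr 2
        ring

theorem integral_fundSol_one : ∫ ξ : Space n, fundSol a ξ 1 = 1 := by
  simp only [fundSol_of_pos a _ one_pos, mul_one]
  rw [integral_const_mul, integral_exp_neg_quadratic ha]
  have := ha.det_pos
  have h1 : (4 * Real.pi) ^ ((n : ℝ) / 2) * √a.det ≠ 0 := by positivity
  exact one_div_mul_cancel h1

omit ha in
theorem fundSol_sqrt_smul (ξ : Space n) {τ : ℝ} (hτ : 0 < τ) :
    fundSol a (√τ • ξ) τ = (√τ ^ n)⁻¹ * fundSol a ξ 1 := by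
  rw [fundSol_of_pos a _ hτ, fundSol_of_pos a _ one_pos, map_smul, inner_smul_left,
    inner_smul_right, Real.mul_rpow (by positivity) hτ.le]
  have h1 : τ ^ ((n : ℝ) / 2) = √τ ^ n := by
    rw [Real.sqrt_eq_rpow, ← Real.rpow_natCast, ← Real.rpow_mul hτ.le]
    congr 1
    ring
  have h2 : √τ * (√τ * (inner ℝ (Matrix.toEuclideanLin a⁻¹ ξ) ξ : ℝ)) =
      τ * inner ℝ (Matrix.toEuclideanLin a⁻¹ ξ) ξ := by
    rw [← mul_assoc, Real.mul_self_sqrt hτ.le]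
  rw [h1, show (starRingEnd ℝ) √τ = √τ from rfl, h2, mul_one, mul_one,
    show -(τ * (inner ℝ (Matrix.toEuclideanLin a⁻¹ ξ) ξ : ℝ)) / (4 * τ) =
      -(inner ℝ (Matrix.toEuclideanLin a⁻¹ ξ) ξ : ℝ) / 4 by field_simp]
  ring

-- Parabolic scaling moves the time dependence from the singular kernel to the smooth function,
-- which is why the limit `τ → 0` is harmless below.
omit ha in
theorem integral_fundSol_mul (f : Space n → ℝ) {τ : ℝ} (hτ : 0 < τ) :
    ∫ ξ, fundSol a ξ τ * f ξ = ∫ ξ, fundSol a ξ 1 * f (√τ • ξ) := by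
  have h0 : 0 < √τ := Real.sqrt_pos.2 hτ
  have h1 := Measure.integral_comp_smul_of_nonneg (volume : Measure (Space n))
    (fun ξ => fundSol a ξ τ * f ξ) (√τ) (hR := h0.le)
  simp only [fundSol_sqrt_smul _ hτ, finrank_euclideanSpace, Fintype.card_fin, mul_assoc,
    integral_const_mul, smul_eq_mul] at h1
  exact (mul_left_cancel₀ (by positivity) h1).symm

theorem integrable_fundSol_one_mul {f : Space n → ℝ} (hf : Continuous f) {M : ℝ}
    (hM : ∀ ξ, ‖f ξ‖ ≤ M) : Integrable fun ξ => fundSol a ξ 1 * f ξ := by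
  refine ((integrable_fundSol_one ha).mul_const M).mono'
    ((differentiable_fundSol ha 1).continuous.mul hf).aestronglyMeasurable
    (ae_of_all _ fun ξ => ?_)
  rw [norm_mul, Real.norm_of_nonneg (fundSol_nonneg a ξ 1)]
  exact mul_le_mul_of_nonneg_left (hM ξ) (fundSol_nonneg a ξ 1)

/-- Integration by parts against the Gaussian. -/
theorem integral_fundSol_one_mul_coord {g : Space n → ℝ} (hg : ContDiff ℝ 1 g) {M N : ℝ}
    (hM : ∀ ξ, ‖g ξ‖ ≤ M) (w : Space n)
    (hN : ∀ ξ, ‖fderiv ℝ g ξ (Matrix.toEuclideanLin a w)‖ ≤ N) :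
    ∫ ξ, fundSol a ξ 1 * (inner ℝ ξ w * g ξ) =
      2 * ∫ ξ, fundSol a ξ 1 * fderiv ℝ g ξ (Matrix.toEuclideanLin a w) := by
  have hd := differentiable_fundSol ha 1 (n := n)
  have hfd : ∀ ξ : Space n, fderiv ℝ (fun ξ => fundSol a ξ 1) ξ (Matrix.toEuclideanLin a w) =
      -(inner ℝ ξ w / 2 * fundSol a ξ 1) := fun ξ => by
    have := fderiv_fundSol_conormal ha w (ξ, 1)
    simpa [conormalKernel, heatKernel] using this
  have h1 := integral_mul_fderiv_eq_neg_fderiv_mul_of_integrable (μ := (volume : Measure (Space n)))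
    (f := fun ξ => fundSol a ξ 1) (g := g) (v := Matrix.toEuclideanLin a w) ?_ ?_ ?_
    (fun ξ _ => hd ξ) (fun ξ _ => hg.differentiable (by simp) ξ)
  · rw [h1, ← integral_neg, ← integral_const_mul]
    refine integral_congr_ae (ae_of_all _ fun ξ => ?_)
    simp only [hfd]
    ring
  · simp only [hfd]
    refine ((integrable_norm_mul_fundSol_one ha).mul_const (‖w‖ * M)).mono' ?_
      (ae_of_all _ fun ξ => ?_)
    · have h2 : Continuous fun ξ : Space n => (inner ℝ ξ w : ℝ) :=
        continuous_id.inner continuous_const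
      exact ((((h2.div_const 2).mul hd.continuous).neg).mul hg.continuous).aestronglyMeasurable
    · have h2 := abs_real_inner_le_norm ξ w
      have h3 := fundSol_nonneg a ξ 1
      rw [norm_mul, norm_neg, norm_mul, norm_div, Real.norm_of_nonneg h3]
      simp only [Real.norm_eq_abs, Nat.abs_ofNat]
      have h4 : |g ξ| ≤ M := hM ξ
      have hM0 : 0 ≤ M := (abs_nonneg _).trans h4
      calc _ ≤ (‖ξ‖ * ‖w‖) / 1 * fundSol a ξ 1 * M := by
            gcongr
            norm_num
        _ = _ := by ring
  · exact integrable_fundSol_one_mul ha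
      ((hg.continuous_fderiv (by simp)).clm_apply continuous_const) hN
  · exact integrable_fundSol_one_mul ha hg.continuous hM

end

section

variable {n : ℕ} {a : Matrix (Fin n) (Fin n) ℝ} (ha : a.PosDef) {ψ : Space n × ℝ → ℝ}
  (hψ : ContDiff ℝ ∞ ψ) (hc : HasCompactSupport ψ) (q : Space n × ℝ)
include ha hψ hc

/-- For `τ > 0` this is the mean of `ψ` against `G (·, τ)`. The rescaled form extends continuously
to `τ = 0`, where it takes the value `ψ q`. -/
theorem continuous_gaussianMean :
    Continuous fun τ : ℝ => ∫ ξ : Space n, fundSol a ξ 1 * ψ (q + (√τ • ξ, τ)) := by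
  obtain ⟨M, hM⟩ := hc.exists_bound_of_continuous hψ.continuous
  have hψc := hψ.continuous
  refine continuous_of_dominated (bound := fun ξ => fundSol a ξ 1 * M) (fun τ => ?_)
    (fun τ => ae_of_all _ fun ξ => ?_) ((integrable_fundSol_one ha).mul_const M)
    (ae_of_all _ fun ξ => ?_)
  · exact ((differentiable_fundSol ha 1).continuous.mul
      (hψc.comp (by fun_prop))).aestronglyMeasurable
  · rw [norm_mul, Real.norm_of_nonneg (fundSol_nonneg a ξ 1)]
    exact mul_le_mul_of_nonneg_left (hM _) (fundSol_nonneg a ξ 1)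
  · exact continuous_const.mul (hψc.comp (by fun_prop))

/-- The right side is the mean of the `τ`-derivative of `ψ (q + (√τ ξ, τ))`. Its spatial part `ξ /
(2√τ)` becomes the elliptic operator after Gaussian integration by parts, so the heat equation for
`G` is never verified by differentiating `G` twice. -/
theorem integral_fundSol_mul_opHstar {τ : ℝ} (hτ : 0 < τ) :
    ∫ ξ : Space n, fundSol a ξ τ * opHstar a ψ (q + (ξ, τ)) =
      ∫ ξ : Space n, fundSol a ξ 1 *
        fderiv ℝ ψ (q + (√τ • ξ, τ)) ((1 / (2 * √τ)) • ξ, 1) := by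
  have h0 : 0 < √τ := Real.sqrt_pos.2 hτ
  set e : Fin n → Space n × ℝ := fun k => (EuclideanSpace.single k 1, 0) with he
  have hcont : ∀ {φ : Space n × ℝ → ℝ}, ContDiff ℝ ∞ φ →
      ContDiff ℝ ∞ fun ξ : Space n => φ (q + (√τ • ξ, τ)) := fun hφ =>
    hφ.comp (contDiff_const.add ((contDiff_const_smul _).prodMk contDiff_const))
  have hbdd : ∀ {φ : Space n × ℝ → ℝ}, ContDiff ℝ ∞ φ → HasCompactSupport φ →
      ∃ M, ∀ ξ : Space n, ‖φ (q + (√τ • ξ, τ))‖ ≤ M := fun hφ hcφ => by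
    obtain ⟨M, hM⟩ := hcφ.exists_bound_of_continuous hφ.continuous
    exact ⟨M, fun ξ => hM _⟩
  have hint : ∀ {φ : Space n × ℝ → ℝ}, ContDiff ℝ ∞ φ → HasCompactSupport φ →
      Integrable fun ξ : Space n => fundSol a ξ 1 * φ (q + (√τ • ξ, τ)) := fun hφ hcφ => by
    obtain ⟨M, hM⟩ := hbdd hφ hcφ
    exact integrable_fundSol_one_mul ha (hcont hφ).continuous hM
  have hsm1 := fun w => contDiff_dirDeriv hψ w
  have hcs1 := fun w => hasCompactSupport_dirDeriv hc w
  have hsm2 := fun w w' => contDiff_dirDeriv (hsm1 w) w'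
  have hcs2 := fun w w' => hasCompactSupport_dirDeriv (hcs1 w) w'
  have hfd : ∀ (k : Fin n) (ξ : Space n),
      fderiv ℝ (fun ξ : Space n => dirDeriv (e k) ψ (q + (√τ • ξ, τ))) ξ
        (Matrix.toEuclideanLin a (EuclideanSpace.single k 1)) =
      √τ * ∑ h, a h k * dirDeriv (e h) (dirDeriv (e k) ψ) (q + (√τ • ξ, τ)) := fun k ξ => by
    have h1 : HasFDerivAt (fun ξ : Space n => q + (√τ • ξ, τ))
        ((√τ • ContinuousLinearMap.id ℝ (Space n)).prod 0) ξ :=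
      (((hasFDerivAt_id ξ).const_smul √τ).prodMk (hasFDerivAt_const τ ξ)).const_add q
    have h2 := HasFDerivAt.comp ξ
      ((hsm1 (e k)).differentiable (by simp) (q + (√τ • ξ, τ))).hasFDerivAt h1
    have h3 : fderiv ℝ (fun ξ : Space n => dirDeriv (e k) ψ (q + (√τ • ξ, τ))) ξ = _ := h2.fderiv
    have h4 : ((Matrix.toEuclideanLin a (EuclideanSpace.single k 1) : Space n), (0 : ℝ)) =
        ∑ h, a h k • e h := by
      refine Prod.ext ?_ ?_
      · ext i
        simp [he, Prod.fst_sum, Matrix.toLpLin_apply, Pi.single_apply]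
      · simp [he, Prod.snd_sum]
    have h5 : ((√τ • ContinuousLinearMap.id ℝ (Space n)).prod (0 : Space n →L[ℝ] ℝ))
        (Matrix.toEuclideanLin a (EuclideanSpace.single k 1)) = √τ • ∑ h, a h k • e h := by
      rw [← h4]
      simp
    rw [h3, ContinuousLinearMap.comp_apply, h5, map_smul, map_sum]
    simp [dirDeriv]
  -- One integration by parts per coordinate. The chain rule yields the factor `√τ`, and `2√τ` is
  -- exactly what `1 / (2√τ)` cancels.
  have hibp : ∀ k : Fin n,
      ∫ ξ : Space n, fundSol a ξ 1 * (ξ k * dirDeriv (e k) ψ (q + (√τ • ξ, τ))) =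
      2 * √τ * ∫ ξ : Space n, fundSol a ξ 1 *
        ∑ h, a h k * dirDeriv (e h) (dirDeriv (e k) ψ) (q + (√τ • ξ, τ)) := fun k => by
    obtain ⟨M, hM⟩ := hbdd (hsm1 (e k)) (hcs1 (e k))
    have hN : ∃ N, ∀ ξ, ‖fderiv ℝ (fun ξ : Space n => dirDeriv (e k) ψ (q + (√τ • ξ, τ))) ξ
        (Matrix.toEuclideanLin a (EuclideanSpace.single k 1))‖ ≤ N := by
      choose N hN using fun h => hbdd (hsm2 (e k) (e h)) (hcs2 (e k) (e h))
      refine ⟨‖√τ‖ * ∑ h, ‖a h k‖ * N h, fun ξ => ?_⟩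
      rw [hfd, norm_mul]
      gcongr
      refine (norm_sum_le _ _).trans (Finset.sum_le_sum fun h _ => ?_)
      rw [norm_mul]
      gcongr
      exact hN h ξ
    obtain ⟨N, hN⟩ := hN
    have h1 := integral_fundSol_one_mul_coord ha ((hcont (hsm1 (e k))).of_le (by simp)) hM
      (EuclideanSpace.single k 1) hN
    simp only [hfd, EuclideanSpace.inner_single_right, conj_trivial, one_mul] at h1
    rw [h1, mul_assoc, ← integral_const_mul √τ]
    simp only [mul_left_comm _ √τ]
  have hcoord : ∀ ξ : Space n, fderiv ℝ ψ (q + (√τ • ξ, τ)) ((1 / (2 * √τ)) • ξ, 1) =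
      (∑ k, 1 / (2 * √τ) * (ξ k * dirDeriv (e k) ψ (q + (√τ • ξ, τ)))) +
        dirDeriv (0, 1) ψ (q + (√τ • ξ, τ)) := fun ξ => by
    have h1 : (((1 / (2 * √τ)) • ξ, 1) : Space n × ℝ) =
        (∑ k, (1 / (2 * √τ)) • ξ k • e k) + (0, 1) := by
      refine Prod.ext ?_ ?_
      · ext i
        simp [he, Prod.fst_sum, Pi.single_apply]
      · simp [he, Prod.snd_sum]
    rw [h1, map_add, map_sum]
    simp [dirDeriv]
  have hintc : ∀ k, Integrable fun ξ : Space n =>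
      fundSol a ξ 1 * (1 / (2 * √τ) * (ξ k * dirDeriv (e k) ψ (q + (√τ • ξ, τ)))) := fun k => by
    obtain ⟨M, hM⟩ := hbdd (hsm1 (e k)) (hcs1 (e k))
    have hM0 : 0 ≤ M := (norm_nonneg _).trans (hM 0)
    refine ((integrable_norm_mul_fundSol_one ha).mul_const (1 / (2 * √τ) * M)).mono' ?_
      (ae_of_all _ fun ξ => ?_)
    · have h1 := (differentiable_fundSol ha 1).continuous
      have h2 := (hcont (hsm1 (e k))).continuous
      exact (h1.mul (continuous_const.mul
        ((EuclideanSpace.proj k).continuous.mul h2))).aestronglyMeasurable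
    · have h3 := fundSol_nonneg a ξ 1
      rw [norm_mul, norm_mul, norm_mul, Real.norm_of_nonneg h3,
        Real.norm_of_nonneg (by positivity : 0 ≤ 1 / (2 * √τ))]
      calc _ ≤ fundSol a ξ 1 * (1 / (2 * √τ) * (‖ξ‖ * M)) := by
            gcongr
            · exact PiLp.norm_apply_le ξ k
            · exact hM ξ
        _ = _ := by ring
  have hint2 : ∀ h k : Fin n, Integrable fun ξ : Space n => fundSol a ξ 1 *
      (a h k * dirDeriv (e h) (dirDeriv (e k) ψ) (q + (√τ • ξ, τ))) := fun h k => by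
    simp only [mul_left_comm _ (a h k)]
    exact (hint (hsm2 _ _) (hcs2 _ _)).const_mul _
  rw [integral_fundSol_mul (fun ξ => opHstar a ψ (q + (ξ, τ))) hτ]
  simp only [opHstar_eq a hψ, hcoord, mul_add, Finset.mul_sum]
  simp only [Finset.mul_sum] at hibp
  rw [integral_add (integrable_finsetSum _ fun h _ => integrable_finsetSum _ fun k _ => hint2 h k)
    (hint (hsm1 _) (hcs1 _)), integral_add (integrable_finsetSum _ fun k _ => hintc k)
    (hint (hsm1 _) (hcs1 _)), integral_finsetSum _ fun k _ => hintc k,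
    integral_finsetSum _ fun h _ => integrable_finsetSum _ fun k _ => hint2 h k]
  congr 1
  have h1 : ∀ k, ∫ ξ : Space n, fundSol a ξ 1 *
      (1 / (2 * √τ) * (ξ k * dirDeriv (e k) ψ (q + (√τ • ξ, τ)))) =
      ∑ h, ∫ ξ : Space n, fundSol a ξ 1 *
        (a h k * dirDeriv (e h) (dirDeriv (e k) ψ) (q + (√τ • ξ, τ))) := fun k => by
    simp only [mul_left_comm _ (1 / (2 * √τ)), integral_const_mul, hibp]
    rw [← mul_assoc, show 1 / (2 * √τ) * (2 * √τ) = 1 by field_simp, one_mul,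
      integral_finsetSum _ fun h _ => hint2 h k]
  simp only [h1]
  rw [Finset.sum_comm]
  exact Finset.sum_congr rfl fun h _ => integral_finsetSum _ fun k _ => hint2 h k

theorem hasDerivAt_gaussianMean {τ : ℝ} (hτ : 0 < τ) :
    HasDerivAt (fun τ : ℝ => ∫ ξ : Space n, fundSol a ξ 1 * ψ (q + (√τ • ξ, τ)))
      (∫ ξ : Space n, fundSol a ξ τ * opHstar a ψ (q + (ξ, τ))) τ := by
  rw [integral_fundSol_mul_opHstar ha hψ hc q hτ]
  have hψc := hψ.continuous
  have hG := (differentiable_fundSol ha 1 (n := n)).continuous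
  have hfc : Continuous (fderiv ℝ ψ) := hψ.continuous_fderiv (by simp)
  obtain ⟨M, hM⟩ := hc.exists_bound_of_continuous hψ.continuous
  obtain ⟨N, hN⟩ := (hc.fderiv ℝ).exists_bound_of_continuous hfc
  have hN0 : 0 ≤ N := (norm_nonneg _).trans (hN 0)
  have h0 : 0 < √(τ / 2) := Real.sqrt_pos.2 (by positivity)
  -- On `t > τ/2` the factor `1 / (2√t)` is bounded, so `‖ξ‖ G(ξ, 1)` and `G(ξ, 1)` together
  -- dominate the derivative.
  refine (hasDerivAt_integral_of_dominated_loc_of_deriv_le (μ := (volume : Measure (Space n)))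
    (s := Ioi (τ / 2))
    (F := fun τ ξ => fundSol a ξ 1 * ψ (q + (√τ • ξ, τ)))
    (F' := fun τ ξ => fundSol a ξ 1 * fderiv ℝ ψ (q + (√τ • ξ, τ)) ((1 / (2 * √τ)) • ξ, 1))
    (bound := fun ξ => ‖ξ‖ * fundSol a ξ 1 * (N * (1 / (2 * √(τ / 2)))) + fundSol a ξ 1 * N)
    (Ioi_mem_nhds (by linarith)) (Eventually.of_forall fun t => ?_) ?_ ?_
    (ae_of_all _ fun ξ t ht => ?_) ?_ (ae_of_all _ fun ξ t ht => ?_)).2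
  · exact (hG.mul (hψc.comp (by fun_prop))).aestronglyMeasurable
  · exact integrable_fundSol_one_mul ha (hψc.comp (by fun_prop)) fun ξ => hM _
  · exact (hG.mul ((hfc.comp (by fun_prop)).clm_apply (by fun_prop))).aestronglyMeasurable
  · have ht : τ / 2 < t := ht
    have h1 : √(τ / 2) ≤ √t := Real.sqrt_le_sqrt ht.le
    have h2 := fundSol_nonneg a ξ 1
    rw [norm_mul, Real.norm_of_nonneg h2]
    have h3 : ‖(((1 / (2 * √t)) • ξ, 1) : Space n × ℝ)‖ ≤ 1 / (2 * √(τ / 2)) * ‖ξ‖ + 1 := by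
      rw [Prod.norm_mk]
      refine max_le ?_ ?_
      · rw [norm_smul, Real.norm_of_nonneg (by positivity)]
        have : 1 / (2 * √t) * ‖ξ‖ ≤ 1 / (2 * √(τ / 2)) * ‖ξ‖ := by gcongr
        linarith
      · rw [norm_one]
        have : 0 ≤ 1 / (2 * √(τ / 2)) * ‖ξ‖ := by positivity
        linarith
    calc _ ≤ fundSol a ξ 1 * (N * (1 / (2 * √(τ / 2)) * ‖ξ‖ + 1)) := by
          gcongr
          exact (ContinuousLinearMap.le_opNorm _ _).trans
            (mul_le_mul (hN _) h3 (norm_nonneg _) hN0)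
      _ = _ := by ring
  · exact ((integrable_norm_mul_fundSol_one ha).mul_const _).add
      ((integrable_fundSol_one ha).mul_const _)
  · have ht : 0 < t := lt_trans (by positivity) ht
    have h1 : HasDerivAt (fun t : ℝ => q + (√t • ξ, t)) ((1 / (2 * √t)) • ξ, 1) t :=
      (((Real.hasDerivAt_sqrt ht.ne').smul_const ξ).prodMk (hasDerivAt_id t)).const_add q
    exact (((hψ.differentiable (by simp)) _).hasFDerivAt.comp_hasDerivAt t h1).const_mul _

/-- After Fubini the time integrand is the derivative of the Gaussian mean of `ψ`. That mean starts
at `ψ q` for `τ = 0`, because `G (·, 1)` has mass one, and vanishes for large `τ`, because `ψ` has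
compact support. -/
theorem heatPotential_opHstar (hn : 3 ≤ n) : heatPotential a (opHstar a ψ) q = -ψ q := by
  have hi := integrable_mul_comp_add (locallyIntegrable_heatKernel hn ha)
    (contDiff_opHstar a hψ).continuous (hasCompactSupport_opHstar a hψ hc) q
  rw [heatPotential]
  rw [Measure.volume_eq_prod] at hi ⊢
  rw [integral_prod_symm _ hi]
  have hi' : Integrable fun τ => ∫ ξ : Space n, fundSol a ξ τ * opHstar a ψ (q + (ξ, τ)) :=
    hi.integral_prod_right
  have h1 : ∀ τ ∉ Ioi (0 : ℝ), ∫ ξ : Space n, fundSol a ξ τ * opHstar a ψ (q + (ξ, τ)) = 0 :=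
    fun τ hτ => by simp [fundSol_of_nonpos a _ (not_lt.1 hτ)]
  change ∫ τ, ∫ ξ : Space n, fundSol a ξ τ * opHstar a ψ (q + (ξ, τ)) = _
  rw [← setIntegral_eq_integral_of_forall_compl_eq_zero h1]
  have hlim : Tendsto (fun τ : ℝ => ∫ ξ : Space n, fundSol a ξ 1 * ψ (q + (√τ • ξ, τ))) atTop
      (𝓝 0) := by
    obtain ⟨R, hR⟩ := hc.isCompact.isBounded.subset_closedBall 0
    refine tendsto_const_nhds.congr' ?_
    filter_upwards [eventually_gt_atTop (R - q.2)] with τ hτ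
    symm
    refine integral_eq_zero_of_ae (ae_of_all _ fun ξ => ?_)
    have h2 : q + (√τ • ξ, τ) ∉ tsupport ψ := fun hmem => by
      have h3 := hR hmem
      rw [mem_closedBall_zero_iff] at h3
      have h4 := (norm_snd_le (q + (√τ • ξ, τ))).trans h3
      have h5 := (le_abs_self _).trans h4
      simp only [Prod.snd_add] at h5
      linarith
    simp [image_eq_zero_of_notMem_tsupport h2]
  rw [integral_Ioi_of_hasDerivAt_of_tendsto
    (continuous_gaussianMean ha hψ hc q).continuousWithinAt
    (fun τ hτ => hasDerivAt_gaussianMean ha hψ hc q hτ) hi'.integrableOn hlim]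
  simp only [Real.sqrt_zero, zero_smul, show ((0 : Space n), (0 : ℝ)) = 0 from rfl, add_zero]
  rw [integral_mul_const, integral_fundSol_one ha]
  ring

end

/-! ### Local `Lᵖ` bounds for the layer potentials. -/

/-- The integral of `F` in the second variable converges absolutely almost everywhere, and is
locally in `Lᵖ`. -/
def HasLpPotential {n : ℕ} {β : Type*} [MeasurableSpace β] (p : ℝ≥0∞) (ρ : Measure β)
    (F : (Space n × ℝ) × β → ℝ) : Prop :=
  ∀ R : ℝ, Integrable F ((volume.restrict (Metric.closedBall 0 R)).prod ρ) ∧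
    MemLp (fun z => ∫ q, F (z, q) ∂ρ) p (volume.restrict (Metric.closedBall 0 R))

theorem hasLpPotential_of_schur {n : ℕ} {β : Type*} [MeasurableSpace β] {ρ : Measure β}
    [SFinite ρ] {p : ℝ≥0∞} (hp : 1 ≤ p) (hp' : p ≠ ⊤) {h : β → ℝ} (hh : MemLp h p ρ)
    {k : (Space n × ℝ) × β → ℝ}
    (hk : ∀ R, AEStronglyMeasurable k ((volume.restrict (Metric.closedBall 0 R)).prod ρ))
    {κ : Space n × ℝ → β → ℝ≥0∞} {C : ℝ≥0∞} (hC : C ≠ ⊤)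
    (hκ : ∀ z, ∀ᵐ q ∂ρ, ‖k (z, q)‖ₑ ≤ C * κ z q)
    (hs : ∀ R : ℝ, ∃ M : ℝ≥0∞, M ≠ ⊤ ∧ ∀ h : β → ℝ≥0∞, AEMeasurable h ρ →
      ∫⁻ z in Metric.closedBall 0 R, (∫⁻ q, κ z q * h q ∂ρ) ^ p.toReal ≤
        M * ∫⁻ q, h q ^ p.toReal ∂ρ) :
    HasLpPotential p ρ fun x => h x.2 * k x := by
  intro R
  have hfin : IsFiniteMeasure (volume.restrict (Metric.closedBall (0 : Space n × ℝ) R)) :=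
    ⟨by rw [Measure.restrict_apply_univ]; exact measure_closedBall_lt_top⟩
  refine integrable_memLp_of_lintegral_rpow_lt_top
    ((hh.aestronglyMeasurable.comp_snd).mul (hk R)) hp hp' ?_
  obtain ⟨M, hM, hle⟩ := hs R
  have h1 := hle (fun q => C * ‖h q‖ₑ) (hh.aestronglyMeasurable.enorm.const_mul C)
  have hp0 : 0 ≤ p.toReal := by positivity
  refine lt_of_le_of_lt (le_trans (lintegral_mono fun z => ?_) h1) ?_
  · refine ENNReal.rpow_le_rpow (lintegral_mono_ae ?_) hp0
    filter_upwards [hκ z] with q hq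
    change ‖h q * k (z, q)‖ₑ ≤ _
    rw [enorm_mul]
    calc _ ≤ ‖h q‖ₑ * (C * κ z q) := by gcongr
      _ = _ := by ring
  · refine ENNReal.mul_lt_top hM.lt_top ?_
    simp only [ENNReal.mul_rpow_of_nonneg _ _ hp0]
    rw [lintegral_const_mul' _ _ (ENNReal.rpow_ne_top_of_nonneg hp0 hC)]
    refine ENNReal.mul_lt_top (ENNReal.rpow_ne_top_of_nonneg hp0 hC).lt_top ?_
    exact lintegral_rpow_enorm_lt_top_of_eLpNorm_lt_top (one_pos.trans_le hp).ne' hp' hh.2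

/-- The support of `ψ` lies in a ball, where `F` is jointly integrable, and `ψ` is bounded; Fubini
applies. -/
theorem HasLpPotential.integrable_and_swap {n : ℕ} {β : Type*} [MeasurableSpace β]
    {ρ : Measure β} [SFinite ρ] {p : ℝ≥0∞} {F : (Space n × ℝ) × β → ℝ}
    (hF : HasLpPotential p ρ F) {ψ : Space n × ℝ → ℝ} (hψ : Continuous ψ)
    (hc : HasCompactSupport ψ) :
    Integrable (fun q => ∫ z, ψ z * F (z, q)) ρ ∧ Integrable (fun z => ψ z * ∫ q, F (z, q) ∂ρ) ∧
      ∫ q, (∫ z, ψ z * F (z, q)) ∂ρ = ∫ z, ψ z * ∫ q, F (z, q) ∂ρ := by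
  obtain ⟨R, hR⟩ := hc.isCompact.isBounded.subset_closedBall 0
  obtain ⟨M, hM⟩ := hc.exists_bound_of_continuous hψ
  have h0 : ∀ z ∉ Metric.closedBall 0 R, ψ z = 0 := fun z hz =>
    image_eq_zero_of_notMem_tsupport fun h => hz (hR h)
  have hi : Integrable (fun x : (Space n × ℝ) × β => ψ x.1 * F x)
      ((volume.restrict (Metric.closedBall 0 R)).prod ρ) :=
    (hF R).1.bdd_mul (hψ.aestronglyMeasurable.comp_fst) (ae_of_all _ fun x => hM x.1)
  have e1 : ∀ q, ∫ z, ψ z * F (z, q) = ∫ z in Metric.closedBall 0 R, ψ z * F (z, q) := fun q =>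
    (setIntegral_eq_integral_of_forall_compl_eq_zero fun z hz => by rw [h0 z hz, zero_mul]).symm
  have e2 : ∫ z, ψ z * ∫ q, F (z, q) ∂ρ =
      ∫ z in Metric.closedBall 0 R, ψ z * ∫ q, F (z, q) ∂ρ :=
    (setIntegral_eq_integral_of_forall_compl_eq_zero fun z hz => by rw [h0 z hz, zero_mul]).symm
  refine ⟨?_, ?_, ?_⟩
  · simp only [e1]
    exact hi.integral_prod_right
  · have h1 := hi.integral_prod_left
    simp only [integral_const_mul] at h1
    refine (integrableOn_iff_integrable_of_support_subset fun z hz => ?_).1 h1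
    by_contra hz'
    exact hz (by simp only [h0 z hz', zero_mul])
  · rw [e2]
    simp only [e1, ← integral_const_mul]
    exact (integral_integral_swap (f := fun z q => ψ z * F (z, q)) hi).symm

section

variable {n : ℕ} (hn : 3 ≤ n) {Ω : Set (Space n)} (hΩ : HasC1Boundary Ω)
  (hb : Bornology.IsBounded Ω) (T : ℝ) {a : Matrix (Fin n) (Fin n) ℝ} (ha : a.PosDef)
  {p : ℝ≥0∞} (hp : 1 ≤ p) (hp' : p ≠ ⊤)

include hp hp' in
theorem one_le_toReal : 1 ≤ p.toReal := by
  rw [← ENNReal.toReal_one]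
  exact ENNReal.toReal_mono hp' hp

include hΩ in
theorem aemeasurable_innerNormal :
    AEMeasurable (fun q : Space n × ℝ => innerNormal Ω q.1) (lateralMeasure Ω T) := by
  have h1 : AEMeasurable (innerNormal Ω)
      ((μHE[n - 1] : Measure (Space n)).restrict (frontier Ω)) :=
    (continuousOn_innerNormal hΩ).aemeasurable isClosed_frontier.measurableSet
  exact h1.comp_quasiMeasurePreserving Measure.quasiMeasurePreserving_fst

theorem ae_lateralMeasure_mem :
    ∀ᵐ q ∂(lateralMeasure Ω T), q.1 ∈ frontier Ω ∧ q.2 ∈ Ioo 0 T := by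
  have h1 : ∀ᵐ q ∂(lateralMeasure Ω T), q.1 ∈ frontier Ω :=
    Measure.quasiMeasurePreserving_fst.ae (ae_restrict_mem isClosed_frontier.measurableSet)
  have h2 : ∀ᵐ q ∂(lateralMeasure Ω T), q.2 ∈ Ioo 0 T :=
    Measure.quasiMeasurePreserving_snd.ae (ae_restrict_mem measurableSet_Ioo)
  exact h1.and h2

include hn hΩ hb ha hp hp'

theorem hasLpPotential_doubleLayer {A : Space n × ℝ → ℝ} (hA : MemLp A p (lateralMeasure Ω T)) :
    HasLpPotential p (lateralMeasure Ω T) fun x : (Space n × ℝ) × (Space n × ℝ) =>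
      A x.2 * conormalKernel a (innerNormal Ω x.2.1) (x.1 - x.2) := by
  have hn3 : (3 : ℝ) ≤ n := by exact_mod_cast hn
  have := isFiniteMeasure_lateralMeasure (by omega) hΩ hb T
  obtain ⟨θ, h0, h1, hs⟩ := exists_lateral_schur hn hΩ hb T (one_le_toReal hp hp')
  -- The choice `α = 1 - θ` gives `n + 1 - 2α = n - 1 + 2θ`, the exponent of the lateral Schur
  -- bound.
  obtain ⟨C, hC, hle⟩ := exists_conormalKernel_le ha (α := 1 - θ) (by linarith)
  refine hasLpPotential_of_schur hp hp' hA (fun R => ?_) hC (fun z => ?_)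
    (hs (1 - θ) (by linarith) (by linarith))
  · have hm : AEMeasurable (fun x : (Space n × ℝ) × (Space n × ℝ) =>
        (innerNormal Ω x.2.1, x.1 - x.2))
        ((volume.restrict (Metric.closedBall 0 R)).prod (lateralMeasure Ω T)) :=
      ((aemeasurable_innerNormal hΩ T).comp_snd).prodMk
        (measurable_fst.sub measurable_snd).aemeasurable
    exact ((measurable_conormalKernel a).comp_aemeasurable hm).aestronglyMeasurable
  · filter_upwards [ae_lateralMeasure_mem T] with q hq
    refine (hle _ _).trans ?_
    rw [show (n : ℝ) + 1 - 2 * (1 - θ) = n - 1 + 2 * θ by ring]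
    gcongr
    have h2 : ‖innerNormal Ω q.1‖ₑ ≤ 1 := by
      rw [← ofReal_norm, ← ENNReal.ofReal_one]
      exact ENNReal.ofReal_le_ofReal (norm_innerNormal_le hΩ hq.1)
    calc _ ≤ C * 1 := by gcongr
      _ = C := mul_one C

theorem hasLpPotential_singleLayer {B : Space n × ℝ → ℝ} (hB : MemLp B p (lateralMeasure Ω T)) :
    HasLpPotential p (lateralMeasure Ω T) fun x : (Space n × ℝ) × (Space n × ℝ) =>
      B x.2 * heatKernel a (x.1 - x.2) := by
  have hn3 : (3 : ℝ) ≤ n := by exact_mod_cast hn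
  have := isFiniteMeasure_lateralMeasure (by omega) hΩ hb T
  obtain ⟨θ, h0, h1, hs⟩ := exists_lateral_schur hn hΩ hb T (one_le_toReal hp hp')
  -- Here `n - 2α = n - 1 + 2θ` again, and `θ < 1/2` keeps `α` positive.
  obtain ⟨C, hC, hle⟩ := exists_heatKernel_le ha (α := 1 / 2 - θ) (by linarith)
  refine hasLpPotential_of_schur hp hp' hB (fun R => ?_) hC (fun z => ?_)
    (hs (1 / 2 - θ) (by linarith) (by linarith))
  · exact ((measurable_heatKernel a).comp (measurable_fst.sub measurable_snd)).aestronglyMeasurable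
  · refine ae_of_all _ fun q => (hle _).trans_eq ?_
    rw [show (n : ℝ) - 2 * (1 / 2 - θ) = n - 1 + 2 * θ by ring]

omit hΩ in
theorem hasLpPotential_section (τ : ℝ) {A : Space n × ℝ → ℝ}
    (hA : MemLp (fun y => A (y, τ)) p (volume.restrict Ω)) :
    HasLpPotential p (volume.restrict Ω) fun x : (Space n × ℝ) × Space n =>
      A (x.2, τ) * heatKernel a (x.1 - (x.2, τ)) := by
  have hn3 : (3 : ℝ) ≤ n := by exact_mod_cast hn
  obtain ⟨α, h0, h1, hs⟩ := exists_section_schur hn hb τ (one_le_toReal hp hp')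
  obtain ⟨C, hC, hle⟩ := exists_heatKernel_le ha (α := α) (by linarith)
  refine hasLpPotential_of_schur (h := fun y => A (y, τ))
    (k := fun x : (Space n × ℝ) × Space n => heatKernel a (x.1 - (x.2, τ)))
    hp hp' hA (fun R => ?_) hC (fun z => ae_of_all _ fun q => hle _) hs
  exact ((measurable_heatKernel a).comp (by fun_prop)).aestronglyMeasurable

end

/-! ### The Stokes potential and its duality with heat potentials. -/

theorem stokesPotential_eq {n : ℕ} {a : Matrix (Fin n) (Fin n) ℝ} (ha : a.PosDef)
    (Ω : Set (Space n)) (T : ℝ) (A B : Space n × ℝ → ℝ) (z : Space n × ℝ) :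
    stokesPotential a Ω T A B z =
      (∫ q, (A q * conormalKernel a (innerNormal Ω q.1) (z - q) - B q * heatKernel a (z - q))
        ∂(lateralMeasure Ω T))
      - (∫ y in Ω, A (y, T) * heatKernel a (z - (y, T)))
      + ∫ y in Ω, A (y, 0) * heatKernel a (z - (y, 0)) := by
  simp only [stokesPotential, conormalDeriv_fundSol ha, heatKernel, Prod.fst_sub, Prod.snd_sub,
    sub_zero]

theorem measurableEmbedding_section {n : ℕ} (τ : ℝ) :
    MeasurableEmbedding fun x : Space n => (x, τ) :=
  MeasurableEmbedding.prodMk_right MeasurableEmbedding.id τ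

theorem integral_sectionMeasure {n : ℕ} (Ω : Set (Space n)) (τ : ℝ) (f : Space n × ℝ → ℝ) :
    ∫ z, f z ∂(sectionMeasure Ω τ) = ∫ y in Ω, f (y, τ) :=
  (measurableEmbedding_section τ).integral_map f

theorem memLp_of_memLp_boundaryMeasure {n : ℕ} (Ω : Set (Space n)) (T : ℝ) {A : Space n × ℝ → ℝ}
    {p : ℝ≥0∞} (hA : MemLp A p (boundaryMeasure Ω T)) : MemLp A p (lateralMeasure Ω T) ∧
      MemLp (fun y => A (y, T)) p (volume.restrict Ω) ∧
      MemLp (fun y => A (y, 0)) p (volume.restrict Ω) := by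
  have h : ∀ τ, MemLp A p (sectionMeasure Ω τ) ↔
      MemLp (fun y => A (y, τ)) p (volume.restrict Ω) := fun τ =>
    (measurableEmbedding_section τ).memLp_map_measure_iff
  rw [← h, ← h]
  unfold boundaryMeasure at hA
  exact ⟨hA.left_of_add_measure.left_of_add_measure, hA.left_of_add_measure.right_of_add_measure,
    hA.right_of_add_measure⟩

section

variable {n : ℕ} (hn : 3 ≤ n) {Ω : Set (Space n)} (hΩ : HasC1Boundary Ω)
  (hb : Bornology.IsBounded Ω) (T : ℝ) {a : Matrix (Fin n) (Fin n) ℝ} (ha : a.PosDef)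
  {p : ℝ≥0∞} (hp : 1 ≤ p) (hp' : p ≠ ⊤) {A B : Space n × ℝ → ℝ}
  (hA : MemLp A p (boundaryMeasure Ω T)) (hB : MemLp B p (lateralMeasure Ω T))

include hn hΩ hb ha hp hp' hA hB

/-- Almost everywhere, the Stokes potential is the sum of its four absolutely convergent parts. -/
theorem stokesPotential_ae_eq (R : ℝ) :
    stokesPotential a Ω T A B =ᵐ[volume.restrict (Metric.closedBall 0 R)] fun z =>
      (∫ q, A q * conormalKernel a (innerNormal Ω q.1) (z - q) ∂(lateralMeasure Ω T))
      - (∫ q, B q * heatKernel a (z - q) ∂(lateralMeasure Ω T))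
      - (∫ y in Ω, A (y, T) * heatKernel a (z - (y, T)))
      + ∫ y in Ω, A (y, 0) * heatKernel a (z - (y, 0)) := by
  have := isFiniteMeasure_lateralMeasure (by omega) hΩ hb T
  have hA1 := (memLp_of_memLp_boundaryMeasure Ω T hA).1
  filter_upwards [(hasLpPotential_doubleLayer hn hΩ hb T ha hp hp' hA1 R).1.prod_right_ae,
    (hasLpPotential_singleLayer hn hΩ hb T ha hp hp' hB R).1.prod_right_ae] with z h1 h2
  rw [stokesPotential_eq ha, integral_sub h1 h2]

theorem memLp_stokesPotential (R : ℝ) :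
    MemLp (stokesPotential a Ω T A B) p (volume.restrict (Metric.closedBall 0 R)) := by
  obtain ⟨hA1, hA2, hA3⟩ := memLp_of_memLp_boundaryMeasure Ω T hA
  refine (memLp_congr_ae (stokesPotential_ae_eq hn hΩ hb T ha hp hp' hA hB R)).2 ?_
  exact ((((hasLpPotential_doubleLayer hn hΩ hb T ha hp hp' hA1 R).2.sub
    (hasLpPotential_singleLayer hn hΩ hb T ha hp hp' hB R).2).sub
    (hasLpPotential_section hn hb ha hp hp' T hA2 R).2).add
    (hasLpPotential_section hn hb ha hp hp' 0 hA3 R).2)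

theorem locallyIntegrable_stokesPotential : LocallyIntegrable (stokesPotential a Ω T A B) := by
  refine locallyIntegrable_iff.2 fun k hk => ?_
  obtain ⟨R, hR⟩ := hk.isBounded.subset_closedBall 0
  have hfin : IsFiniteMeasure (volume.restrict (Metric.closedBall (0 : Space n × ℝ) R)) :=
    ⟨by rw [Measure.restrict_apply_univ]; exact measure_closedBall_lt_top⟩
  exact IntegrableOn.mono_set
    ((memLp_stokesPotential hn hΩ hb T ha hp hp' hA hB R).integrable hp) hR

/-- Duality between the Stokes potential and the heat potential. -/
theorem integral_mul_stokesPotential {ψ : Space n × ℝ → ℝ} (hψ : ContDiff ℝ ∞ ψ)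
    (hc : HasCompactSupport ψ) {v : Space n × ℝ → ℝ} (hv : ∀ q, v q = -heatPotential a ψ q) :
    (∫ z, (B z * v z - A z * conormalDeriv a Ω v z) ∂(lateralMeasure Ω T))
      + (∫ z, A z * v z ∂(sectionMeasure Ω T)) - ∫ z, A z * v z ∂(sectionMeasure Ω 0) =
    ∫ z, ψ z * stokesPotential a Ω T A B z := by
  have := isFiniteMeasure_lateralMeasure (by omega) hΩ hb T
  obtain ⟨hA1, hA2, hA3⟩ := memLp_of_memLp_boundaryMeasure Ω T hA
  obtain ⟨i1, j1, s1⟩ := (hasLpPotential_doubleLayer hn hΩ hb T ha hp hp' hA1).integrable_and_swap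
    hψ.continuous hc
  obtain ⟨i2, j2, s2⟩ := (hasLpPotential_singleLayer hn hΩ hb T ha hp hp' hB).integrable_and_swap
    hψ.continuous hc
  obtain ⟨i3, j3, s3⟩ := (hasLpPotential_section hn hb ha hp hp' T hA2).integrable_and_swap
    hψ.continuous hc
  obtain ⟨i4, j4, s4⟩ := (hasLpPotential_section hn hb ha hp hp' 0 hA3).integrable_and_swap
    hψ.continuous hc
  simp only at i1 i2 i3 i4 j1 j2 j3 j4 s1 s2 s3 s4
  obtain ⟨R, hR⟩ := hc.isCompact.isBounded.subset_closedBall 0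
  have hP : ∫ z, ψ z * stokesPotential a Ω T A B z =
      (∫ z, ψ z * ∫ q, A q * conormalKernel a (innerNormal Ω q.1) (z - q) ∂(lateralMeasure Ω T))
      - (∫ z, ψ z * ∫ q, B q * heatKernel a (z - q) ∂(lateralMeasure Ω T))
      - (∫ z, ψ z * ∫ y in Ω, A (y, T) * heatKernel a (z - (y, T)))
      + ∫ z, ψ z * ∫ y in Ω, A (y, 0) * heatKernel a (z - (y, 0)) := by
    rw [← integral_sub j1 j2]
    have k2 := integral_sub (j1.sub j2) j3
    have k3 := integral_add ((j1.sub j2).sub j3) j4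
    simp only [Pi.sub_apply] at k2 k3
    rw [← k2, ← k3]
    refine integral_congr_ae ?_
    filter_upwards [(ae_restrict_iff' Metric.isClosed_closedBall.measurableSet).1
      (stokesPotential_ae_eq hn hΩ hb T ha hp hp' hA hB R)] with z hz
    by_cases h : z ∈ Metric.closedBall 0 R
    · rw [hz h]
      ring
    · have h0 : ψ z = 0 := image_eq_zero_of_notMem_tsupport fun h' => h (hR h')
      simp [h0]
  -- The minus sign in `v` makes the Green boundary terms match those of the Stokes potential, term
  -- by term.
  have hcv : ∀ q, conormalDeriv a Ω v q =
      -∫ z, ψ z * conormalKernel a (innerNormal Ω q.1) (z - q) := fun q => by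
    rw [← conormalDeriv_heatPotential hn ha hψ hc, funext hv, conormalDeriv, conormalDeriv,
      fderiv_fun_neg, _root_.neg_apply]
  have e1 : ∀ q, B q * v q - A q * conormalDeriv a Ω v q =
      (∫ z, ψ z * (A q * conormalKernel a (innerNormal Ω q.1) (z - q))) -
        ∫ z, ψ z * (B q * heatKernel a (z - q)) := fun q => by
    simp only [hcv, hv, heatPotential_eq_integral, mul_left_comm (ψ _), integral_const_mul]
    ring
  have e2 : ∀ τ, ∫ z, A z * v z ∂(sectionMeasure Ω τ) =
      -∫ y in Ω, ∫ z, ψ z * (A (y, τ) * heatKernel a (z - (y, τ))) := fun τ => by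
    rw [integral_sectionMeasure, ← integral_neg]
    simp only [hv, heatPotential_eq_integral, mul_left_comm (ψ _), integral_const_mul, mul_neg]
  simp only [e1, e2]
  rw [integral_sub i1 i2, s1, s2, s3, s4, hP]
  ring

end

/-! ### Continuity of the Stokes potential off the closed cylinder. -/

/-- The fundamental solution and its conormal derivatives are continuous away from the origin. -/
theorem continuousOn_kernels {n : ℕ} {a : Matrix (Fin n) (Fin n) ℝ}
    (ha : a.PosDef) :
    ContinuousOn (heatKernel a) {0}ᶜ ∧
    ContinuousOn (fun x : Space n × (Space n × ℝ) => conormalKernel a x.1 x.2)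
      (univ ×ˢ {0}ᶜ) := by
  -- Away from `x = 0`, `G` is `O(t²)`, obtained with `α = -1` and `j = 1`. Both powers matter: the
  -- conormal kernel divides by `t` and must still tend to zero.
  have key : ∀ z : Space n × ℝ, z.1 ≠ 0 → ∃ C : ℝ, 0 ≤ C ∧ ∀ᶠ y : Space n × ℝ in 𝓝 z,
      ‖heatKernel a y‖ ≤ C * |y.2| * |y.2| := by
    intro z hz
    obtain ⟨C, hC, h⟩ := exists_fundSol_le ha (α := -1) (j := 1)
      (by have : (0 : ℝ) ≤ n := n.cast_nonneg; linarith)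
    have hc : ContinuousAt (fun y : Space n × ℝ => C * ‖y.1‖ ^ (-((n : ℝ) + 2 * 1 - 2 * -1))) z :=
      continuousAt_const.mul (continuous_fst.norm.continuousAt.rpow_const
        (Or.inl (norm_ne_zero_iff.2 hz)))
    refine ⟨C * ‖z.1‖ ^ (-((n : ℝ) + 2 * 1 - 2 * -1)) + 1, by positivity, ?_⟩
    filter_upwards [hc.eventually_lt continuousAt_const (lt_add_one _),
      continuous_fst.continuousAt.eventually_ne hz] with y hy hy0
    rcases le_or_gt y.2 0 with ht | ht
    · rw [heatKernel, fundSol_of_nonpos a _ ht, norm_zero]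
      positivity
    · have h1 := h y.1 hy0 y.2 ht
      rw [neg_neg, Real.rpow_one, Real.rpow_neg_one, inv_mul_le_iff₀ ht] at h1
      rw [heatKernel, Real.norm_of_nonneg (fundSol_nonneg a _ _), abs_of_pos ht]
      refine h1.trans ?_
      rw [show ∀ r, y.2 * (C * (y.2 * r)) = C * r * y.2 * y.2 from fun r => by ring]
      gcongr
  have h0 : ∀ z : Space n × ℝ, z.2 = 0 → heatKernel a z = 0 := fun z hz =>
    fundSol_of_nonpos a _ hz.le
  have hne : ∀ z : Space n × ℝ, z ≠ 0 → z.2 = 0 → z.1 ≠ 0 := fun z hz h2 h1 =>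
    hz (Prod.ext h1 h2)
  constructor
  · intro z hz
    refine ContinuousAt.continuousWithinAt ?_
    rcases eq_or_ne z.2 0 with h2 | h2
    · obtain ⟨C, hC, h⟩ := key z (hne z hz h2)
      rw [ContinuousAt, h0 z h2]
      refine squeeze_zero_norm' h ?_
      have h3 : Continuous fun y : Space n × ℝ => C * |y.2| * |y.2| := by fun_prop
      simpa [h2] using h3.tendsto z
    · exact continuousAt_heatKernel ha h2
  · rintro ⟨ν, z⟩ ⟨-, hz⟩
    refine ContinuousAt.continuousWithinAt ?_
    have hi : Continuous fun x : Space n × (Space n × ℝ) => (inner ℝ x.2.1 x.1 : ℝ) :=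
      (continuous_fst.comp continuous_snd).inner continuous_fst
    have hsnd : Tendsto (fun x : Space n × (Space n × ℝ) => x.2) (𝓝 (ν, z)) (𝓝 z) :=
      continuous_snd.tendsto _
    rcases eq_or_ne z.2 0 with h2 | h2
    · obtain ⟨C, hC, h⟩ := key z (hne z hz h2)
      rw [ContinuousAt, show conormalKernel a ν z = 0 by rw [conormalKernel, h0 z h2, mul_zero]]
      have h3 : Continuous fun x : Space n × (Space n × ℝ) =>
          |(inner ℝ x.2.1 x.1 : ℝ)| * (C * |x.2.2|) :=
        hi.abs.mul (by fun_prop)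
      refine squeeze_zero_norm' (a := fun x : Space n × (Space n × ℝ) =>
          |(inner ℝ x.2.1 x.1 : ℝ)| * (C * |x.2.2|)) ?_ (by simpa [h2] using h3.tendsto (ν, z))
      filter_upwards [hsnd.eventually h] with x hx
      rw [conormalKernel, norm_mul, norm_div, Real.norm_eq_abs, Real.norm_eq_abs, abs_mul]
      rcases eq_or_ne x.2.2 0 with h4 | h4
      · rw [h0 _ h4]
        simp [h4]
      · have h5 : 0 < |x.2.2| := abs_pos.2 h4
        calc _ ≤ |(inner ℝ x.2.1 x.1 : ℝ)| / (|2| * |x.2.2|) * (C * |x.2.2| * |x.2.2|) := by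
              gcongr
          _ = |(inner ℝ x.2.1 x.1 : ℝ)| * (C * |x.2.2|) / 2 := by
              rw [abs_of_pos (two_pos : (0 : ℝ) < 2)]
              field_simp
          _ ≤ _ := half_le_self (by positivity)
    · have h3 : ContinuousAt (fun x : Space n × (Space n × ℝ) => heatKernel a x.2) (ν, z) :=
        ContinuousAt.comp (g := heatKernel a) (continuousAt_heatKernel ha h2) hsnd
      refine (hi.continuousAt.div ?_ ?_).mul h3
      · fun_prop
      · simpa using h2

/-- The kernels are uniformly bounded near a point at positive distance from the cylinder. -/
theorem exists_bound_kernels {n : ℕ} {a : Matrix (Fin n) (Fin n) ℝ}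
    (ha : a.PosDef) {K : Set (Space n × ℝ)} (hK : IsCompact K) {z₀ : Space n × ℝ} (hz₀ : z₀ ∉ K) :
    ∃ C : ℝ, ∀ᶠ z in 𝓝 z₀, ∀ q ∈ K, ‖heatKernel a (z - q)‖ ≤ C ∧
      ∀ ν : Space n, ‖ν‖ ≤ 1 → ‖conormalKernel a ν (z - q)‖ ≤ C := by
  obtain ⟨δ, hδ, hd⟩ := Metric.nhds_basis_closedBall.mem_iff.1 (hK.isClosed.isOpen_compl.mem_nhds hz₀)
  have hc : IsCompact (Metric.closedBall z₀ δ ×ˢ K) := (isCompact_closedBall z₀ δ).prod hK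
  have hmaps : MapsTo (fun x : (Space n × ℝ) × (Space n × ℝ) => x.1 - x.2)
      (Metric.closedBall z₀ δ ×ˢ K) {0}ᶜ := fun x hx h =>
    hd hx.1 (by rw [sub_eq_zero.1 h]; exact hx.2)
  have hsub : Continuous fun x : (Space n × ℝ) × (Space n × ℝ) => x.1 - x.2 :=
    continuous_fst.sub continuous_snd
  obtain ⟨h1, h2⟩ := continuousOn_kernels ha
  obtain ⟨C1, hC1⟩ := hc.exists_bound_of_continuousOn (h1.comp hsub.continuousOn hmaps)
  have h3 : ContinuousOn (fun x : Space n × ((Space n × ℝ) × (Space n × ℝ)) =>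
      conormalKernel a x.1 (x.2.1 - x.2.2))
      (Metric.closedBall 0 1 ×ˢ (Metric.closedBall z₀ δ ×ˢ K)) :=
    h2.comp (f := fun x : Space n × ((Space n × ℝ) × (Space n × ℝ)) => (x.1, x.2.1 - x.2.2))
      (continuous_fst.prodMk (hsub.comp continuous_snd)).continuousOn
      fun x hx => ⟨mem_univ _, hmaps hx.2⟩
  obtain ⟨C2, hC2⟩ := ((isCompact_closedBall (0 : Space n) 1).prod hc).exists_bound_of_continuousOn h3
  refine ⟨max C1 C2, ?_⟩
  filter_upwards [Metric.closedBall_mem_nhds z₀ hδ] with z hz q hq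
  refine ⟨(hC1 (z, q) ⟨hz, hq⟩).trans (le_max_left _ _), fun ν hν => ?_⟩
  exact (hC2 (ν, z, q) ⟨mem_closedBall_zero_iff.2 hν, hz, hq⟩).trans (le_max_right _ _)

/-- Dominated convergence: the kernels are bounded uniformly near `z₀`, and the data are integrable
since the boundary measures are finite. This upgrades vanishing almost everywhere to vanishing
everywhere. -/
theorem continuousAt_stokesPotential {n : ℕ} (hn : 3 ≤ n) {Ω : Set (Space n)}
    (hΩo : IsOpen Ω) (hΩ : HasC1Boundary Ω) (hb : Bornology.IsBounded Ω) {T : ℝ} (hT : 0 < T)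
    {a : Matrix (Fin n) (Fin n) ℝ} (ha : a.PosDef) {p : ℝ≥0∞} (hp : 1 ≤ p)
    {A B : Space n × ℝ → ℝ} (hA : MemLp A p (boundaryMeasure Ω T))
    (hB : MemLp B p (lateralMeasure Ω T)) {z₀ : Space n × ℝ}
    (hz₀ : z₀ ∉ closure (cylinder Ω T)) :
    ContinuousAt (stokesPotential a Ω T A B) z₀ := by
  have := isFiniteMeasure_lateralMeasure (by omega) hΩ hb T
  have hfin : IsFiniteMeasure (volume.restrict Ω) :=
    ⟨by rw [Measure.restrict_apply_univ]; exact hb.measure_lt_top⟩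
  obtain ⟨hA1, hA2, hA3⟩ := memLp_of_memLp_boundaryMeasure Ω T hA
  have hcl : closure (cylinder Ω T) = closure Ω ×ˢ Icc 0 T := by
    rw [cylinder, closure_prod_eq, closure_Ioo hT.ne]
  have hK : IsCompact (closure (cylinder Ω T)) := by
    rw [hcl]
    exact hb.isCompact_closure.prod isCompact_Icc
  obtain ⟨C, hC⟩ := exists_bound_kernels ha hK hz₀
  obtain ⟨k1, k2⟩ := continuousOn_kernels ha
  have hne : ∀ q ∈ closure (cylinder Ω T), z₀ - q ≠ 0 := fun q hq h =>
    hz₀ (by rw [sub_eq_zero.1 h]; exact hq)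
  have c1 : ∀ q ∈ closure (cylinder Ω T), ContinuousAt (fun z => heatKernel a (z - q)) z₀ :=
    fun q hq => ContinuousAt.comp (g := heatKernel a) (f := fun z => z - q)
      (k1.continuousAt (isOpen_compl_singleton.mem_nhds (hne q hq))) (by fun_prop)
  have c2 : ∀ ν, ∀ q ∈ closure (cylinder Ω T),
      ContinuousAt (fun z => conormalKernel a ν (z - q)) z₀ :=
    fun ν q hq => ContinuousAt.comp (g := fun x : Space n × (Space n × ℝ) =>
      conormalKernel a x.1 x.2) (f := fun z => (ν, z - q))
      (k2.continuousAt ((isOpen_univ.prod isOpen_compl_singleton).mem_nhds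
        ⟨mem_univ _, hne q hq⟩)) (by fun_prop)
  have hlat : ∀ᵐ q ∂(lateralMeasure Ω T), q ∈ closure (cylinder Ω T) ∧ ‖innerNormal Ω q.1‖ ≤ 1 := by
    filter_upwards [ae_lateralMeasure_mem T] with q hq
    rw [hcl]
    exact ⟨⟨frontier_subset_closure hq.1, Ioo_subset_Icc_self hq.2⟩, norm_innerNormal_le hΩ hq.1⟩
  have hsec : ∀ τ ∈ Icc 0 T, ∀ᵐ y ∂(volume.restrict Ω), (y, τ) ∈ closure (cylinder Ω T) := by
    intro τ hτ
    filter_upwards [ae_restrict_mem hΩo.measurableSet] with y hy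
    rw [hcl]
    exact ⟨subset_closure hy, hτ⟩
  have hsecc : ∀ τ ∈ Icc 0 T, MemLp (fun y => A (y, τ)) p (volume.restrict Ω) →
      ContinuousAt (fun z => ∫ y in Ω, A (y, τ) * heatKernel a (z - (y, τ))) z₀ := by
    intro τ hτ hAτ
    refine continuousAt_of_dominated (bound := fun y => ‖A (y, τ)‖ * C)
      (Eventually.of_forall fun z => ?_) ?_ ((hAτ.integrable hp).norm.mul_const C) ?_
    · exact hAτ.aestronglyMeasurable.mul
        ((measurable_heatKernel a).comp (by fun_prop)).aestronglyMeasurable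
    · filter_upwards [hC] with z hz
      filter_upwards [hsec τ hτ] with y hy
      rw [norm_mul]
      exact mul_le_mul_of_nonneg_left (hz _ hy).1 (norm_nonneg _)
    · filter_upwards [hsec τ hτ] with y hy
      exact continuousAt_const.mul (c1 _ hy)
  rw [funext (stokesPotential_eq ha Ω T A B)]
  refine (ContinuousAt.sub ?_ (hsecc T ⟨hT.le, le_rfl⟩ hA2)).add (hsecc 0 ⟨le_rfl, hT.le⟩ hA3)
  refine continuousAt_of_dominated (bound := fun q => ‖A q‖ * C + ‖B q‖ * C)
    (Eventually.of_forall fun z => ?_) ?_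
    (((hA1.integrable hp).norm.mul_const C).add ((hB.integrable hp).norm.mul_const C)) ?_
  · have hm : AEMeasurable (fun q : Space n × ℝ => (innerNormal Ω q.1, z - q))
        (lateralMeasure Ω T) :=
      (aemeasurable_innerNormal hΩ T).prodMk (measurable_const.sub measurable_id).aemeasurable
    exact (hA1.aestronglyMeasurable.mul
      ((measurable_conormalKernel a).comp_aemeasurable hm).aestronglyMeasurable).sub
      (hB.aestronglyMeasurable.mul
        ((measurable_heatKernel a).comp (by fun_prop)).aestronglyMeasurable)
  · filter_upwards [hC] with z hz
    filter_upwards [hlat] with q hq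
    refine (norm_sub_le _ _).trans ?_
    rw [norm_mul, norm_mul]
    exact add_le_add (mul_le_mul_of_nonneg_left ((hz _ hq.1).2 _ hq.2) (norm_nonneg _))
      (mul_le_mul_of_nonneg_left (hz _ hq.1).1 (norm_nonneg _))
  · filter_upwards [hlat] with q hq
    exact (continuousAt_const.mul (c2 _ _ hq.1)).sub (continuousAt_const.mul (c1 _ hq.1))

/-! ### The two inclusions for the classes of `H`. -/

theorem closure_cylinder {n : ℕ} (Ω : Set (Space n)) {T : ℝ} (hT : 0 < T) :
    closure (cylinder Ω T) = closure Ω ×ˢ Icc 0 T := by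
  rw [cylinder, closure_prod_eq, closure_Ioo hT.ne]

theorem isBounded_cylinder {n : ℕ} {Ω : Set (Space n)} (hb : Bornology.IsBounded Ω) (T : ℝ) :
    Bornology.IsBounded (cylinder Ω T) :=
  hb.prod (Metric.isBounded_Ioo 0 T)

theorem ae_mem_cylinder_or_notMem_closure {n : ℕ} (hn : 1 ≤ n) {Ω : Set (Space n)}
    (hΩo : IsOpen Ω) (hΩ : HasC1Boundary Ω) (hb : Bornology.IsBounded Ω) {T : ℝ} (hT : 0 < T) :
    ∀ᵐ z : Space n × ℝ, z ∈ cylinder Ω T ∨ z ∉ closure (cylinder Ω T) := by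
  have h1 : ∀ᵐ z : Space n × ℝ, z.1 ∉ frontier Ω :=
    Measure.quasiMeasurePreserving_fst.ae
      (measure_eq_zero_iff_ae_notMem.1 (volume_frontier_eq_zero hn hΩ hb))
  have h2 : ∀ s : ℝ, ∀ᵐ z : Space n × ℝ, z.2 ≠ s := fun s =>
    Measure.quasiMeasurePreserving_snd.ae (Measure.ae_ne volume s)
  filter_upwards [h1, h2 0, h2 T] with z h1 h2 h3
  rw [closure_cylinder Ω hT, or_iff_not_imp_right, not_not]
  rintro ⟨h4, h5⟩
  refine ⟨?_, lt_of_le_of_ne h5.1 (Ne.symm h2), lt_of_le_of_ne h5.2 h3⟩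
  by_contra h6
  exact h1 (by rw [hΩo.frontier_eq]; exact ⟨h4, h6⟩)

theorem opHstar_congr {n : ℕ} (a : Matrix (Fin n) (Fin n) ℝ) {v v' : Space n × ℝ → ℝ}
    (hv : ContDiff ℝ ∞ v) (hv' : ContDiff ℝ ∞ v') {z : Space n × ℝ} (h : v' =ᶠ[𝓝 z] v) :
    opHstar a v' z = opHstar a v z := by
  have h1 : ∀ {u u' : Space n × ℝ → ℝ} (w), u' =ᶠ[𝓝 z] u → dirDeriv w u' =ᶠ[𝓝 z] dirDeriv w u :=
    fun w h => h.fderiv.mono fun y hy => by rw [dirDeriv, hy, dirDeriv]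
  rw [opHstar_eq a hv, opHstar_eq a hv', (h1 _ h).eq_of_nhds]
  simp only [(h1 _ (h1 _ h)).eq_of_nhds]

theorem conormalDeriv_congr {n : ℕ} (a : Matrix (Fin n) (Fin n) ℝ) (Ω : Set (Space n))
    {v v' : Space n × ℝ → ℝ} (hv : ContDiff ℝ ∞ v) (hv' : ContDiff ℝ ∞ v') {z : Space n × ℝ}
    (h : v' =ᶠ[𝓝 z] v) : conormalDeriv a Ω v' z = conormalDeriv a Ω v z := by
  rw [conormalDeriv_eq hv, conormalDeriv_eq hv', dirDeriv, dirDeriv, h.fderiv_eq]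

section

variable {n : ℕ} (hn : 3 ≤ n) {Ω : Set (Space n)} (hΩo : IsOpen Ω) (hΩ : HasC1Boundary Ω)
  (hb : Bornology.IsBounded Ω) {T : ℝ} (hT : 0 < T) {a : Matrix (Fin n) (Fin n) ℝ}
  (ha : a.PosDef) {p : ℝ≥0∞} (hp : 1 ≤ p) (hp' : p ≠ ⊤)
include hn hΩo hΩ hb hT ha hp hp'

theorem classA_subset_classB : classA a Ω T p ⊆ classB a Ω T p := by
  rintro u ⟨hu, A, B, hA, hB, hG⟩
  have hcm : MeasurableSet (cylinder Ω T) := hΩo.measurableSet.prod measurableSet_Ioo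
  have hfin : IsFiniteMeasure (volume.restrict (cylinder Ω T)) :=
    ⟨by rw [Measure.restrict_apply_univ]; exact (isBounded_cylinder hb T).measure_lt_top⟩
  set P := stokesPotential a Ω T A B with hP
  have hPi : LocallyIntegrable P := locallyIntegrable_stokesPotential hn hΩ hb T ha hp hp' hA hB
  have hui : Integrable ((cylinder Ω T).indicator u) :=
    (integrable_indicator_iff hcm).2 (hu.integrable hp)
  -- Test against an arbitrary `g`, using as `v` in Green's formula the heat potential of `-g`, for
  -- which `H* v = g`.
  have hae : ∀ᵐ z, (cylinder Ω T).indicator u z - P z = 0 := by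
    refine ae_eq_zero_of_integral_contDiff_smul_eq_zero (hui.locallyIntegrable.sub hPi)
      fun g hg hgc => ?_
    have hi1 : Integrable fun z => g z * (cylinder Ω T).indicator u z :=
      hui.locallyIntegrable.integrable_smul_left_of_hasCompactSupport hg.continuous hgc
    have hi2 : Integrable fun z => g z * P z :=
      hPi.integrable_smul_left_of_hasCompactSupport hg.continuous hgc
    have hng : ContDiff ℝ ∞ fun z => -g z := hg.neg
    have hngc : HasCompactSupport fun z => -g z := hgc.neg
    have hv : ∀ q, heatPotential a (fun z => -g z) q = -heatPotential a g q := fun q => by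
      simp only [heatPotential, mul_neg, integral_neg]
    have hop : ∀ z, opHstar a (heatPotential a fun z => -g z) z = g z := fun z => by
      rw [opHstar_heatPotential hn ha hng hngc, heatPotential_opHstar ha hng hngc z hn, neg_neg]
    have h1 := hG _ (contDiff_heatPotential hn ha hng hngc)
    rw [integral_mul_stokesPotential hn hΩ hb T ha hp hp' hA hB hg hgc hv] at h1
    simp only [hop] at h1
    simp only [smul_eq_mul, mul_sub]
    rw [integral_sub hi1 hi2, sub_eq_zero, ← h1, ← integral_indicator hcm]
    refine integral_congr_ae (ae_of_all _ fun z => ?_)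
    by_cases hz : z ∈ cylinder Ω T <;> simp [hz, mul_comm]
  -- The representative of `u` is the potential itself, so the interior identity is trivial.
  refine ⟨P, A, B, ?_, hA, hB, fun _ _ => rfl, ?_⟩
  · filter_upwards [ae_restrict_of_ae hae, ae_restrict_mem hcm] with z hz hzc
    rw [indicator_of_mem hzc] at hz
    linarith
  · have h1 : P =ᵐ[volume.restrict (closure (cylinder Ω T))ᶜ] fun _ => 0 := by
      filter_upwards [ae_restrict_of_ae hae, ae_restrict_mem isClosed_closure.measurableSet.compl]
        with z hz hzc
      rw [indicator_of_notMem fun h => hzc (subset_closure h)] at hz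
      linarith
    have h2 := Measure.eqOn_open_of_ae_eq h1 isClosed_closure.isOpen_compl
      (fun z hz => (continuousAt_stokesPotential hn hΩo hΩ hb hT ha hp hA hB hz).continuousWithinAt)
      continuousOn_const
    exact fun z hz => h2 hz

theorem classB_subset_classA : classB a Ω T p ⊆ classA a Ω T p := by
  rintro u ⟨w, A, B, huw, hA, hB, hin, hout⟩
  have hcm : MeasurableSet (cylinder Ω T) := hΩo.measurableSet.prod measurableSet_Ioo
  set P := stokesPotential a Ω T A B with hP
  have huP : u =ᵐ[volume.restrict (cylinder Ω T)] P := by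
    filter_upwards [huw, ae_restrict_mem hcm] with z hz hzc
    rw [hz, hin z hzc]
  obtain ⟨R, hR⟩ := (isBounded_cylinder hb T).closure.subset_ball_lt 0 0
  refine ⟨(memLp_congr_ae huP).2 ((memLp_stokesPotential hn hΩ hb T ha hp hp' hA hB R).mono_measure
    (Measure.restrict_mono (subset_closure.trans (hR.2.trans Metric.ball_subset_closedBall))
      le_rfl)), A, B, hA, hB, fun v hv => ?_⟩
  -- The cutoff is 1 on an open ball containing the closed cylinder, so the truncated function and
  -- `v` have the same derivatives at all points of the closure, boundary included.
  let χ : ContDiffBump (0 : Space n × ℝ) := ⟨R, R + 1, hR.1, lt_add_one R⟩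
  set v' : Space n × ℝ → ℝ := fun z => χ z * v z with hv'
  have hv's : ContDiff ℝ ∞ v' := χ.contDiff.mul hv
  have hv'c : HasCompactSupport v' := χ.hasCompactSupport.mul_right
  have heq : ∀ z ∈ closure (cylinder Ω T), v' =ᶠ[𝓝 z] v := fun z hz => by
    filter_upwards [Metric.isOpen_ball.mem_nhds (hR.2 hz)] with y hy
    rw [hv']
    simp only
    rw [χ.one_of_mem_closedBall (Metric.ball_subset_closedBall hy), one_mul]
  -- The duality is used with `ψ = H* v'`: then `v' = -Nψ` because `v'` has compact support.
  have key := integral_mul_stokesPotential hn hΩ hb T ha hp hp' hA hB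
    (contDiff_opHstar a hv's) (hasCompactSupport_opHstar a hv's hv'c) (v := v')
    fun q => by rw [heatPotential_opHstar ha hv's hv'c q hn, neg_neg]
  have hsec : ∀ τ ∈ Icc 0 T, ∫ z, A z * v' z ∂(sectionMeasure Ω τ) =
      ∫ z, A z * v z ∂(sectionMeasure Ω τ) := fun τ hτ => by
    rw [integral_sectionMeasure, integral_sectionMeasure]
    refine setIntegral_congr_fun hΩo.measurableSet fun y hy => ?_
    have h1 : (y, τ) ∈ closure (cylinder Ω T) := by
      rw [closure_cylinder Ω hT]
      exact ⟨subset_closure hy, hτ⟩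
    simp only [(heq _ h1).eq_of_nhds]
  have hlat : ∫ z, (B z * v' z - A z * conormalDeriv a Ω v' z) ∂(lateralMeasure Ω T) =
      ∫ z, (B z * v z - A z * conormalDeriv a Ω v z) ∂(lateralMeasure Ω T) := by
    have := isFiniteMeasure_surface (by omega : 1 ≤ n) hΩ hb
    refine integral_congr_ae ?_
    filter_upwards [ae_lateralMeasure_mem (Ω := Ω) T] with q hq
    have h1 : q ∈ closure (cylinder Ω T) := by
      rw [closure_cylinder Ω hT]
      exact ⟨frontier_subset_closure hq.1, Ioo_subset_Icc_self hq.2⟩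
    rw [(heq _ h1).eq_of_nhds, conormalDeriv_congr a Ω hv hv's (heq _ h1)]
  rw [hlat, hsec T ⟨hT.le, le_rfl⟩, hsec 0 ⟨le_rfl, hT.le⟩] at key
  -- The potential is not controlled on the boundary of the cylinder, but that set is null; beyond
  -- it the potential vanishes.
  have h0 : ∀ᵐ z, z ∉ cylinder Ω T → opHstar a v' z * stokesPotential a Ω T A B z = 0 := by
    filter_upwards [ae_mem_cylinder_or_notMem_closure (by omega) hΩo hΩ hb hT] with z hz hzc
    rw [← hP, hout z (hz.resolve_left hzc), mul_zero]
  rw [key, ← setIntegral_eq_integral_of_ae_compl_eq_zero h0]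
  refine integral_congr_ae ?_
  filter_upwards [huP, ae_restrict_mem hcm] with z hz hzc
  rw [hz, opHstar_congr a hv hv's (heq z (subset_closure hzc)), mul_comm]

end

/-! ### Time reversal -/

/-- The reflection of the time interval `(0, T)`. -/
def timeReversal {n : ℕ} (T : ℝ) (z : Space n × ℝ) : Space n × ℝ := (z.1, T - z.2)

section

variable {n : ℕ} (T : ℝ)

theorem timeReversal_timeReversal (z : Space n × ℝ) :
    timeReversal T (timeReversal T z) = z := by
  simp [timeReversal]

theorem measurableEmbedding_timeReversal :
    MeasurableEmbedding (timeReversal T : Space n × ℝ → Space n × ℝ) := by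
  have hm : Measurable (timeReversal T : Space n × ℝ → Space n × ℝ) := by
    unfold timeReversal
    fun_prop
  exact (MeasurableEquiv.mk ⟨timeReversal T, timeReversal T, timeReversal_timeReversal T,
    timeReversal_timeReversal T⟩ hm hm).measurableEmbedding

theorem measurePreserving_timeReversal_prod (μ : Measure (Space n)) [SFinite μ] :
    MeasurePreserving (timeReversal T) (μ.prod (volume.restrict (Ioo 0 T)))
      (μ.prod (volume.restrict (Ioo 0 T))) := by
  have h1 : MeasurePreserving (fun t : ℝ => T - t) (volume.restrict (Ioo 0 T))
      (volume.restrict (Ioo 0 T)) := by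
    have h2 := (Measure.measurePreserving_sub_left (volume : Measure ℝ) T).restrict_preimage
      (measurableSet_Ioo (a := (0 : ℝ)) (b := T))
    simpa using h2
  exact (MeasurePreserving.id μ).prod h1

theorem measurePreserving_timeReversal_cylinder (Ω : Set (Space n)) :
    MeasurePreserving (timeReversal T) (volume.restrict (cylinder Ω T))
      (volume.restrict (cylinder Ω T)) := by
  rw [cylinder, Measure.volume_eq_prod, ← Measure.prod_restrict]
  exact measurePreserving_timeReversal_prod T _

theorem map_timeReversal_sectionMeasure (Ω : Set (Space n)) (τ : ℝ) :
    (sectionMeasure Ω τ).map (timeReversal T) = sectionMeasure Ω (T - τ) := by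
  rw [sectionMeasure, Measure.map_map (measurableEmbedding_timeReversal T).measurable
    (measurableEmbedding_section τ).measurable]
  rfl

theorem measurePreserving_timeReversal_boundary {Ω : Set (Space n)}
    (h : MeasurePreserving (timeReversal T) (lateralMeasure Ω T) (lateralMeasure Ω T)) :
    MeasurePreserving (timeReversal T) (boundaryMeasure Ω T) (boundaryMeasure Ω T) := by
  have hm := (measurableEmbedding_timeReversal (n := n) T).measurable
  refine ⟨hm, ?_⟩
  rw [boundaryMeasure, Measure.map_add _ _ hm, Measure.map_add _ _ hm, h.map_eq,
    map_timeReversal_sectionMeasure, map_timeReversal_sectionMeasure, sub_self, sub_zero,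
    add_right_comm]

theorem opHstar_comp_timeReversal (a : Matrix (Fin n) (Fin n) ℝ) (v : Space n × ℝ → ℝ)
    (z : Space n × ℝ) : opHstar a (v ∘ timeReversal T) z = opH a v (timeReversal T z) := by
  have h1 : partialT (v ∘ timeReversal T) z = -partialT v (timeReversal T z) :=
    deriv_comp_const_sub (fun t => v (z.1, t)) T z.2
  rw [opHstar, opH, h1, sub_eq_add_neg]
  rfl

theorem conormalDeriv_comp_timeReversal (a : Matrix (Fin n) (Fin n) ℝ) (Ω : Set (Space n))
    (v : Space n × ℝ → ℝ) (z : Space n × ℝ) :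
    conormalDeriv a Ω (v ∘ timeReversal T) z = conormalDeriv a Ω v (timeReversal T z) := rfl

theorem contDiff_comp_timeReversal {v : Space n × ℝ → ℝ} (hv : ContDiff ℝ ∞ v) :
    ContDiff ℝ ∞ (v ∘ timeReversal T) :=
  hv.comp (contDiff_fst.prodMk (contDiff_const.sub contDiff_snd))

theorem comp_timeReversal_comp_timeReversal (u : Space n × ℝ → ℝ) :
    (u ∘ timeReversal T) ∘ timeReversal T = u :=
  funext fun z => congrArg u (timeReversal_timeReversal T z)

theorem integral_section_comp_timeReversal (Ω : Set (Space n)) (τ : ℝ) (f : Space n × ℝ → ℝ) :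
    ∫ z, f (timeReversal T z) ∂(sectionMeasure Ω τ) = ∫ z, f z ∂(sectionMeasure Ω (T - τ)) := by
  rw [integral_sectionMeasure, integral_sectionMeasure]
  rfl

variable {T} {Ω : Set (Space n)} {a : Matrix (Fin n) (Fin n) ℝ} {p : ℝ≥0∞}
  (hlat : MeasurePreserving (timeReversal T) (lateralMeasure Ω T) (lateralMeasure Ω T))
include hlat

/-- The reflection exchanges `H` and `H*` and swaps the top and bottom sections, which accounts for
the opposite signs of the section terms. -/
theorem mem_classAstar_iff {u : Space n × ℝ → ℝ} :
    u ∈ classAstar a Ω T p ↔ u ∘ timeReversal T ∈ classA a Ω T p := by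
  have hemb := measurableEmbedding_timeReversal (n := n) T
  have hcyl := measurePreserving_timeReversal_cylinder T Ω
  have hbd := measurePreserving_timeReversal_boundary T hlat
  have hs := integral_section_comp_timeReversal T Ω
  constructor
  · rintro ⟨hu, A, B, hA, hB, hG⟩
    refine ⟨hu.comp_measurePreserving hcyl, A ∘ timeReversal T, B ∘ timeReversal T,
      hA.comp_measurePreserving hbd, hB.comp_measurePreserving hlat, fun v hv => ?_⟩
    have h1 := hG _ (contDiff_comp_timeReversal T hv)
    rw [← hcyl.integral_comp hemb, ← hlat.integral_comp hemb] at h1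
    have h2 := hs 0 fun z => A z * (v ∘ timeReversal T) z
    have h3 := hs T fun z => A z * (v ∘ timeReversal T) z
    rw [sub_zero] at h2
    rw [sub_self] at h3
    rw [← h2, ← h3] at h1
    simp only [← opHstar_comp_timeReversal, comp_timeReversal_comp_timeReversal,
      ← conormalDeriv_comp_timeReversal, Function.comp_apply, timeReversal_timeReversal] at h1 ⊢
    rw [h1]
    ring
  · rintro ⟨hu, A, B, hA, hB, hG⟩
    have hu' := hu.comp_measurePreserving hcyl
    rw [comp_timeReversal_comp_timeReversal] at hu'
    refine ⟨hu', A ∘ timeReversal T, B ∘ timeReversal T,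
      hA.comp_measurePreserving hbd, hB.comp_measurePreserving hlat, fun v hv => ?_⟩
    have h1 := hG _ (contDiff_comp_timeReversal T hv)
    simp only [opHstar_comp_timeReversal] at h1
    rw [← hlat.integral_comp hemb,
      show ∫ z in cylinder Ω T, (u ∘ timeReversal T) z * opH a v (timeReversal T z) =
        ∫ z in cylinder Ω T, u z * opH a v z from
        hcyl.integral_comp hemb fun z => u z * opH a v z] at h1
    have h2 := hs 0 fun z => A z * (v ∘ timeReversal T) z
    have h3 := hs T fun z => A z * (v ∘ timeReversal T) z
    rw [sub_zero] at h2
    rw [sub_self] at h3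
    rw [← h2, ← h3] at h1
    simp only [← conormalDeriv_comp_timeReversal, comp_timeReversal_comp_timeReversal,
      Function.comp_apply, timeReversal_timeReversal] at h1 ⊢
    rw [h1]
    ring

/-- `G` is even in `x`, and reflecting both points reverses the order of their times, so the adjoint
kernel becomes the direct one. -/
theorem stokesPotentialStar_eq (A B : Space n × ℝ → ℝ) (z : Space n × ℝ) :
    stokesPotentialStar a Ω T A B z =
      stokesPotential a Ω T (A ∘ timeReversal T) (B ∘ timeReversal T) (timeReversal T z) := by
  have hG : ∀ r : Space n × ℝ, fundSol a (r.1 - z.1) (r.2 - z.2) =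
      fundSol a ((timeReversal T z).1 - (timeReversal T r).1)
        ((timeReversal T z).2 - (timeReversal T r).2) := fun r => by
    rw [← fundSol_neg]
    simp only [timeReversal]
    congr 1 <;> abel
  have hc : ∀ q : Space n × ℝ,
      conormalDeriv a Ω (fun r => fundSol a (r.1 - z.1) (r.2 - z.2)) q =
      conormalDeriv a Ω (fun r => fundSol a ((timeReversal T z).1 - r.1)
        ((timeReversal T z).2 - r.2)) (timeReversal T q) := fun q => by
    rw [← conormalDeriv_comp_timeReversal]
    exact congrArg (conormalDeriv a Ω · q) (funext hG)
  have hL : ∫ q, (A q * conormalDeriv a Ω (fun r => fundSol a (r.1 - z.1) (r.2 - z.2)) q -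
        B q * fundSol a (q.1 - z.1) (q.2 - z.2)) ∂(lateralMeasure Ω T) =
      ∫ q, ((A ∘ timeReversal T) q * conormalDeriv a Ω (fun r =>
          fundSol a ((timeReversal T z).1 - r.1) ((timeReversal T z).2 - r.2)) q -
        (B ∘ timeReversal T) q * fundSol a ((timeReversal T z).1 - q.1)
          ((timeReversal T z).2 - q.2)) ∂(lateralMeasure Ω T) := by
    refine Eq.trans (integral_congr_ae (ae_of_all _ fun q => ?_))
      (hlat.integral_comp (measurableEmbedding_timeReversal T) _)
    simp only [hc q, hG q, Function.comp_apply, timeReversal_timeReversal]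
  have h1 : ∀ x : Space n, fundSol a (x - z.1) (T - z.2) =
      fundSol a ((timeReversal T z).1 - x) (timeReversal T z).2 := fun x => by
    rw [← fundSol_neg, neg_sub]
    rfl
  have h2 : ∀ x : Space n, fundSol a (x - z.1) (-z.2) =
      fundSol a ((timeReversal T z).1 - x) ((timeReversal T z).2 - T) := fun x => by
    rw [← fundSol_neg, neg_sub]
    simp [timeReversal]
  have h3 : ∀ y : Space n, timeReversal T (y, T) = (y, 0) := fun y => by simp [timeReversal]
  have h4 : ∀ y : Space n, timeReversal T (y, 0) = (y, T) := fun y => by simp [timeReversal]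
  rw [stokesPotentialStar, stokesPotential, hL]
  simp only [h1, h2, h3, h4, Function.comp_apply]
  ring

theorem mem_classBstar_iff (hT : 0 < T) {u : Space n × ℝ → ℝ} :
    u ∈ classBstar a Ω T p ↔ u ∘ timeReversal T ∈ classB a Ω T p := by
  have hcyl := measurePreserving_timeReversal_cylinder T Ω
  have hbd := measurePreserving_timeReversal_boundary T hlat
  have hmem : ∀ z, timeReversal T z ∈ cylinder Ω T ↔ z ∈ cylinder Ω T := fun z => by
    simp only [cylinder, timeReversal, mem_prod, mem_Ioo, sub_pos, sub_lt_self_iff]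
    tauto
  have hmem' : ∀ z, timeReversal T z ∈ closure (cylinder Ω T) ↔ z ∈ closure (cylinder Ω T) :=
    fun z => by
      simp only [closure_cylinder Ω hT, timeReversal, mem_prod, mem_Icc, sub_nonneg,
        sub_le_self_iff]
      tauto
  constructor
  · rintro ⟨w, A, B, huw, hA, hB, h1, h2⟩
    refine ⟨w ∘ timeReversal T, A ∘ timeReversal T, B ∘ timeReversal T,
      hcyl.quasiMeasurePreserving.ae_eq_comp huw,
      hA.comp_measurePreserving hbd, hB.comp_measurePreserving hlat, fun z hz => ?_, fun z hz => ?_⟩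
    · have := h1 _ ((hmem z).2 hz)
      rwa [stokesPotentialStar_eq hlat, timeReversal_timeReversal] at this
    · have := h2 _ (fun h => hz ((hmem' z).1 h))
      rwa [stokesPotentialStar_eq hlat, timeReversal_timeReversal] at this
  · rintro ⟨w, A, B, huw, hA, hB, h1, h2⟩
    have huw' := hcyl.quasiMeasurePreserving.ae_eq_comp huw
    rw [comp_timeReversal_comp_timeReversal] at huw'
    refine ⟨w ∘ timeReversal T, A ∘ timeReversal T, B ∘ timeReversal T, huw',
      hA.comp_measurePreserving hbd, hB.comp_measurePreserving hlat, fun z hz => ?_, fun z hz => ?_⟩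
    · rw [stokesPotentialStar_eq hlat, comp_timeReversal_comp_timeReversal,
        comp_timeReversal_comp_timeReversal]
      exact h1 _ ((hmem z).2 hz)
    · rw [stokesPotentialStar_eq hlat, comp_timeReversal_comp_timeReversal,
        comp_timeReversal_comp_timeReversal]
      exact h2 _ (fun h => hz ((hmem' z).1 h))

end

end Parabolic

theorem mainTheorem8 (n : ℕ) (hn : 3 ≤ n)
    (Ω : Set (Parabolic.Space n)) (hΩo : IsOpen Ω) (hΩc : IsConnected Ω)
    (hΩb : Bornology.IsBounded Ω) (hΩe : IsConnected (closure Ω)ᶜ)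
    (hΩ1 : Parabolic.HasC1Boundary Ω)
    (T : ℝ) (hT : 0 < T)
    (a : Matrix (Fin n) (Fin n) ℝ) (ha : a.PosDef)
    (p : ℝ≥0∞) (hp : 1 ≤ p) (hp' : p ≠ ⊤) :
    Parabolic.classA a Ω T p = Parabolic.classB a Ω T p ∧
      Parabolic.classAstar a Ω T p = Parabolic.classBstar a Ω T p := by
  have h := (Parabolic.classA_subset_classB hn hΩo hΩ1 hΩb hT ha hp hp').antisymm
    (Parabolic.classB_subset_classA hn hΩo hΩ1 hΩb hT ha hp hp')
  have := Parabolic.isFiniteMeasure_surface (by omega : 1 ≤ n) hΩ1 hΩb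
  have hlat : MeasurePreserving (Parabolic.timeReversal T) (Parabolic.lateralMeasure Ω T)
      (Parabolic.lateralMeasure Ω T) := Parabolic.measurePreserving_timeReversal_prod T _
  refine ⟨h, Set.ext fun u => ?_⟩
  rw [Parabolic.mem_classAstar_iff hlat, h, Parabolic.mem_classBstar_iff hlat hT]
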